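/- Let $\Omega\subset\mathbb R^2$ be a bounded domain with smooth boundary, and let $D_1,\dots,D_m$ ($m<\infty$) be the connected components of an open set $D$ with Lipschitz boundary, $\overline D\subset\Omega$, such that $\overline{D_j}\cap\overline{D_{j'}}=\emptyset$ for $j\ne j'$. Let $k_j>0$, let $\gamma=k_j$ on $D_j$ and $\gamma=1$ on $\Omega\setminus D$, and let $\nu$ be the unit normal field to $\partial(\Omega\setminus\overline D)$ that is outward with respect to $\Omega\setminus\overline D$. Fix distinct points $P,Q\in\partial\Omega$. For $g\in L^\infty(\partial\Omega)$ (complex valued) with $\int_{\partial\Omega}g=0$ let $\Lambda_\gamma(P,Q)g=u(P)-u(Q)$, where $u\in H^1(\Omega)$ is a weak solution, continuous on $\overline\Omega$, of $\nabla\cdot\gamma\nabla u=0$ in $\Omega$, $\partial u/\partial\nu=g$ on $\partial\Omega$; $\Lambda_1(P,Q)$ is the same map for $\gamma\equiv1$. Let $$V(x)=-\tfrac1\pi\bigl(\log|P-x|-\log|Q-x|\bigr),\qquad \Psi(y)=-\tfrac1\pi\Bigl(\tfrac{y-P}{|y-P|^2}-\tfrac{y-Q}{|y-Q|^2}\Bigr)\cdot\nu(y),$$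 let $\mathcal E\in H^1(\Omega)$ be the weak solution of $$\nabla\cdot\gamma\nabla\mathcal E=-\nabla\cdot(\gamma-1)\nabla V\ \text{in }\Omega,\qquad \frac{\partial\mathcal E}{\partial\nu}=-\Psi\ \text{on }\partial\Omega,\qquad \int_{\partial\Omega}\mathcal E=0,$$ and put $\mathcal D(P,Q;\cdot)=V+\mathcal E$ in $\Omega$ (so that $\nabla\cdot\gamma\nabla\mathcal D=0$ in $\Omega$ and $\partial\mathcal D/\partial\nu=\delta_P-\delta_Q$ on $\partial\Omega$). Then $\mathcal D(P,Q;\cdot)\in H^1(D_j)$ has a trace in $L^2(\partial D_j)$ for every $j$, which is denoted by the same symbol below, and the following hold. (i) Let $\omega,\omega^\perp$ be unit vectors in $\mathbb R^2$ with $\omega\cdot\omega^\perp=0$ and $\det(\omega\ \omega^\perp)<0$, let $\tau>0$, $t\in\mathbb R$, $v_\omega(x;\tau)=e^{\tau x\cdot(\omega+i\omega^\perp)}$ and $g_\omega=\partial v_\omega/\partial\nu|_{\partial\Omega}$. The indicator function $I_\omega(\tau,t)=e^{-\tau t}\{\Lambda_\gamma(P,Q)-\Lambda_1(P,Q)\}g_\omega(\cdot;\tau)$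 satisfies $$I_\omega(\tau,t)=e^{-\tau t}\sum_{j=1}^m(k_j-1)\int_{\partial D_j}\mathcal D(P,Q;\cdot)\,\frac{\partial v_\omega(\cdot;\tau)}{\partial\nu}.$$ (ii) More generally, for every $g\in L^\infty(\partial\Omega)$ with $\int_{\partial\Omega}g=0$ and every harmonic $v\in H^1(\Omega)$ with $\partial v/\partial\nu=g$ on $\partial\Omega$ in the weak sense, $$\{\Lambda_\gamma(P,Q)-\Lambda_1(P,Q)\}g=\sum_{j=1}^m(k_j-1)\int_{\partial D_j}\mathcal D(P,Q;\cdot)\,\frac{\partial v}{\partial\nu}.$$ -/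

import Mathlib

open MeasureTheory Topology Filter

noncomputable section

namespace Inclusion

/-- The Euclidean plane. -/
abbrev Plane : Type := EuclideanSpace ℝ (Fin 2)

/-- Arc length on the boundary of `U` (one-dimensional Hausdorff measure). -/
def arcLength (U : Set Plane) : Measure Plane :=
  (Measure.hausdorffMeasure 1 : Measure Plane).restrict (frontier U)

/-! ### Regularity of boundaries and the unit outward normal -/

/-- In a neighbourhood of each of its boundary points, and in suitable Cartesian coordinates, `U` is
the set of points lying strictly below the graph of a function with property `R`. -/
def HasGraphBoundary (R : (ℝ → ℝ) → Prop) (U : Set Plane) : Prop :=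
  ∀ x ∈ frontier U, ∃ (A : Plane ≃ₗᵢ[ℝ] Plane) (h : ℝ → ℝ), R h ∧
    ∀ᶠ y in 𝓝 x, (y ∈ U ↔ A (y - x) 1 < h (A (y - x) 0))

def HasLipschitzBoundary (U : Set Plane) : Prop :=
  HasGraphBoundary (fun h => ∃ K, LipschitzWith K h) U

def HasSmoothBoundary (U : Set Plane) : Prop :=
  HasGraphBoundary (fun h => ContDiff ℝ (⊤ : ℕ∞) h) U

/-- `n` is the unit outward normal to `U` at `x`: to first order at `x`, the set `U` is the half-plane
`⟪y - x, n⟫ < 0`. Such an `n` is unique; if `U` is the set below a graph, it exists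
exactly where the graph function is differentiable. -/
def IsOuterNormal (U : Set Plane) (x n : Plane) : Prop :=
  ‖n‖ = 1 ∧ ∀ ε > 0, ∀ᶠ y in 𝓝 x,
    (y ∈ U → inner ℝ (y - x) n ≤ ε * ‖y - x‖) ∧
    (y ∉ U → -(ε * ‖y - x‖) ≤ inner ℝ (y - x) n)

open Classical in
/-- The unit outward normal field to `U` (with value `0` where there is no normal). -/
def outerNormal (U : Set Plane) (x : Plane) : Plane :=
  if h : ∃ n, IsOuterNormal U x n then h.choose else 0

/-! ### Sobolev functions and traces -/

section Sobolev

variable {F : Type*} [NormedAddCommGroup F] [NormedSpace ℝ F]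

/-- `u` belongs to `H¹(U)` and has the weak derivative `G`. -/
structure IsH1 (U : Set Plane) (u : Plane → F) (G : Plane → Plane →L[ℝ] F) : Prop where
  memLp : MemLp u 2 (volume.restrict U)
  memLp_deriv : MemLp G 2 (volume.restrict U)
  weak_deriv : ∀ φ : Plane → ℝ, ContDiff ℝ (⊤ : ℕ∞) φ → HasCompactSupport φ → tsupport φ ⊆ U →
    ∀ e : Plane, ∫ x in U, fderiv ℝ φ x e • u x = -∫ x in U, φ x • G x e

/-- `T ∈ L²(∂U)` is the trace on `∂U` of the `H¹(U)` function `f`: smooth functions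
that converge to `f` in `H¹(U)` have restrictions that converge to `T` in `L²(∂U)`. -/
def IsTrace (U : Set Plane) (f T : Plane → F) : Prop :=
  MemLp T 2 (arcLength U) ∧ ∃ G : Plane → Plane →L[ℝ] F, IsH1 U f G ∧
    ∃ φ : ℕ → Plane → F, (∀ n, ContDiff ℝ (⊤ : ℕ∞) (φ n)) ∧
      Tendsto (fun n => eLpNorm (φ n - f) 2 (volume.restrict U)) atTop (𝓝 0) ∧
      Tendsto (fun n => eLpNorm (fderiv ℝ (φ n) - G) 2 (volume.restrict U)) atTop (𝓝 0) ∧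
      Tendsto (fun n => eLpNorm (φ n - T) 2 (arcLength U)) atTop (𝓝 0)

open Classical in
/-- The trace on `∂U` of a function in `H¹(U)`. -/
def boundaryTrace (U : Set Plane) (f : Plane → F) : Plane → F :=
  if h : ∃ T, IsTrace U f T then h.choose else 0

/-! ### The conductivity problem and the Neumann-to-Dirichlet data -/

/-- `u` is an `H¹(Ω)` weak solution of `∇ · γ∇u = 0` in `Ω`, `∂u/∂ν = g` on `∂Ω`
(where `γ = 1` near `∂Ω`). -/
def IsNeumannSolution (Ω : Set Plane) (γ : Plane → ℝ) (g u : Plane → F) : Prop :=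
  ∃ G : Plane → Plane →L[ℝ] F, IsH1 Ω u G ∧
    ∀ φ : Plane → ℝ, ContDiff ℝ (⊤ : ℕ∞) φ →
      ∫ x in Ω, γ x • G x (gradient φ x) = ∫ y, φ y • g y ∂(arcLength Ω)

/-- `a = Λ_γ(P, Q) g`, that is, `a = u(P) - u(Q)` for a solution `u` of the Neumann problem with
datum `g`, where `u` stands for its representative that is continuous on `closure Ω`. -/
def IsNDValue (Ω : Set Plane) (γ : Plane → ℝ) (P Q : Plane) (g : Plane → F) (a : F) : Prop :=
  ∃ u : Plane → F, IsNeumannSolution Ω γ g u ∧ ContinuousOn u (closure Ω) ∧ a = u P - u Q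

end Sobolev

/-! ### Inclusions -/

/-- `Ω` is a bounded domain with smooth boundary, and `D j` are the finitely many connected components
of an open set with Lipschitz boundary whose closure lies in `Ω`; the closures of the components are
pairwise disjoint. -/
structure IsInclusion {m : ℕ} (Ω : Set Plane) (D : Fin m → Set Plane) : Prop where
  isOpen_domain : IsOpen Ω
  isConnected_domain : IsConnected Ω
  isBounded_domain : Bornology.IsBounded Ω
  smooth_domain : HasSmoothBoundary Ω
  isOpen : ∀ j, IsOpen (D j)
  isConnected : ∀ j, IsConnected (D j)
  lipschitz : ∀ j, HasLipschitzBoundary (D j)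
  closure_subset : ∀ j, closure (D j) ⊆ Ω
  disjoint : Pairwise fun i j => Disjoint (closure (D i)) (closure (D j))

/-- The conductivity: `k j` on `D j` and `1` elsewhere. -/
def conductivity {m : ℕ} (D : Fin m → Set Plane) (k : Fin m → ℝ) (x : Plane) : ℝ :=
  1 + ∑ j, (D j).indicator (fun _ => k j - 1) x

/-- The unit normal field `ν` to `∂(Ω \ closure D)`, outward with respect to `Ω \ closure D`. -/
def normal {m : ℕ} (Ω : Set Plane) (D : Fin m → Set Plane) : Plane → Plane :=
  outerNormal (Ω \ closure (⋃ j, D j))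

/-- The normal derivative `∂v/∂ν` of a function `v` that is differentiable at `y`. -/
def normalDeriv (ν : Plane → Plane) (v : Plane → ℂ) (y : Plane) : ℂ :=
  fderiv ℝ v y (ν y)

/-! ### The solution with boundary flux `δ_P - δ_Q` -/

/-- `V(P, Q; x) = -(1/π) (log |P - x| - log |Q - x|)`. -/
def potV (P Q x : Plane) : ℝ :=
  -(1 / Real.pi) * (Real.log ‖P - x‖ - Real.log ‖Q - x‖)

/-- `Ψ(P, Q; y) = -(1/π) ((y - P)/|y - P|² - (y - Q)/|y - Q|²) · ν(y)`. -/
def fluxPsi (ν : Plane → Plane) (P Q y : Plane) : ℝ :=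
  -(1 / Real.pi) *
    inner ℝ ((1 / ‖y - P‖ ^ 2) • (y - P) - (1 / ‖y - Q‖ ^ 2) • (y - Q)) (ν y)

/-- `e` is the `H¹(Ω)` weak solution of `∇ · γ∇e = -∇ · (γ - 1)∇V` in `Ω`, `∂e/∂ν = -Ψ` on `∂Ω`,
`∫_{∂Ω} e = 0`. -/
def IsCorrector (Ω : Set Plane) (γ : Plane → ℝ) (ν : Plane → Plane) (P Q : Plane)
    (e : Plane → ℝ) : Prop :=
  (∃ G : Plane → Plane →L[ℝ] ℝ, IsH1 Ω e G ∧
    ∀ φ : Plane → ℝ, ContDiff ℝ (⊤ : ℕ∞) φ →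
      ∫ x in Ω, γ x * G x (gradient φ x) =
        -(∫ x in Ω, (γ x - 1) * inner ℝ (gradient (potV P Q) x) (gradient φ x))
          - ∫ y, fluxPsi ν P Q y * φ y ∂(arcLength Ω)) ∧
  ∃ T : Plane → ℝ, IsTrace Ω e T ∧ ∫ y, T y ∂(arcLength Ω) = 0

/-- `𝒟 = V + e` in `Ω`, with `e` the corrector: the solution of `∇ · γ∇𝒟 = 0` in `Ω`,
`∂𝒟/∂ν = δ_P - δ_Q` on `∂Ω`. -/
def IsDipoleSolution (Ω : Set Plane) (γ : Plane → ℝ) (ν : Plane → Plane) (P Q : Plane)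
    (𝒟 : Plane → ℝ) : Prop :=
  ∃ e : Plane → ℝ, IsCorrector Ω γ ν P Q e ∧ ∀ x ∈ Ω, 𝒟 x = potV P Q x + e x

/-- `∑_j (k_j - 1) ∫_{∂D_j} 𝒟 ∂v/∂ν`, where `𝒟` on `∂D_j` is the trace of `𝒟 ∈ H¹(D_j)`. -/
def boundarySum {m : ℕ} (Ω : Set Plane) (D : Fin m → Set Plane) (k : Fin m → ℝ)
    (𝒟 : Plane → ℝ) (v : Plane → ℂ) : ℂ :=
  ∑ j, ((k j - 1 : ℝ) : ℂ) *
    ∫ y, ((boundaryTrace (D j) 𝒟 y : ℝ) : ℂ) * normalDeriv (normal Ω D) v y ∂(arcLength (D j))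

/-! ### The special harmonic functions and the indicator function -/

/-- `v_ω(x; τ) = exp(τ x · (ω + i ω'))`. -/
def expSol (ω ω' : Plane) (τ : ℝ) (x : Plane) : ℂ :=
  Complex.exp (τ * ((inner ℝ x ω : ℝ) + Complex.I * (inner ℝ x ω' : ℝ)))

/-- `a = I_ω(τ, t) = e^{-τt} (Λ_γ(P, Q) - Λ_1(P, Q)) g_ω(·; τ)`, where `g_ω = ∂v_ω/∂ν` on `∂Ω`. -/
def IsIndicatorValue {m : ℕ} (Ω : Set Plane) (D : Fin m → Set Plane) (k : Fin m → ℝ)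
    (P Q ω ω' : Plane) (τ t : ℝ) (a : ℂ) : Prop :=
  ∃ b c : ℂ,
    IsNDValue Ω (conductivity D k) P Q (normalDeriv (normal Ω D) (expSol ω ω' τ)) b ∧
    IsNDValue Ω (fun _ => 1) P Q (normalDeriv (normal Ω D) (expSol ω ω' τ)) c ∧
    a = Complex.exp (-(τ * t)) * (b - c)

end Inclusion

end

noncomputable section

namespace Inclusion

/-! ### Lipschitz graphs in the plane and their arc length -/

/-! Let `u` and `u₁` solve the Neumann problems for γ and for 1 with the same datum, and let w = u -
u₁, which is continuous on the closure of Ω. Formally w(P) - w(Q) is the boundary pairing of w with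
the flux δ_P - δ_Q of 𝒟. Green's formula turns it into -∫ (γ - 1) ∇𝒟 · ∇u₁, an energy carried by the
inclusions. Here ∇u₁ = ∇v by uniqueness of the gradient (`ae_eq_of_integral_pair_eq`), and v is
harmonic, so a second Green formula on each D_j (`green_trace`) moves the energy to ∂D_j. The sign
changes because ν points into D_j (`ae_normal_eq`).

To make this rigorous without testing against point fluxes, 𝒟 is split as V + e and three identities
are combined in `dipole_identity`: (A) w(P) - w(Q) + ∫_{∂Ω} w Ψ = -∫ (γ - 1) ∇V · ∇u; (B) ∫ γ ∇e ·
∇w = -∫ (γ - 1) ∇V · ∇w - ∫_{∂Ω} w Ψ; (C) ∫ γ ∇u · ∇e = ∫ ∇u₁ · ∇e. Eliminating ∫ w Ψ and ∫ γ ∇u ·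
∇e leaves the energy above.

(B) and (C) are the weak formulations with w and e as test functions. They follow from density of
smooth functions (`exists_smooth_approx`). The approximations of a function continuous up to the
boundary also converge uniformly, which handles the boundary term of (B).

(A) is a Green formula with a pole on ∂Ω. The potential is regularized to -(1/2π) log(|x - c|² +
ε²). Minus its Laplacian is a kernel of total mass 2 concentrating at c, and near a boundary point Ω
fills half of the plane, so the limit is exactly w(c) (`tendsto_integral_mul_kernel`). The normal
derivatives stay bounded because on a smooth boundary the chord from c is tangent to second order
(`HasSmoothBoundary.exists_abs_inner_outerNormal_le`). The terms with γ - 1 never see the pole.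

The rest is analysis on Lipschitz domains with Hausdorff measure on the boundary. The area formula
for a graph (`restrict_range_curve`) and Fubini give the divergence theorem below a graph. A
partition of unity (`localization`) globalizes it (`divergence`). The trace inequality comes from a
vector transversal to the graph, and density from mollification with a kernel shifted so that it
looks into the domain.

Everything is done for real functions; complex data are treated through real-linear functionals on
ℂ. -/

/-- Cartesian coordinates `(a, b)` with origin `x` and a Lipschitz function `h`. -/
structure GraphChart where
  x : Plane
  a : Plane
  b : Plane
  norm_a : ‖a‖ = 1
  norm_b : ‖b‖ = 1
  inner_ab : inner ℝ a b = 0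
  h : ℝ → ℝ
  K : NNReal
  lip : LipschitzWith K h

namespace GraphChart

variable (c : GraphChart)

/-- The parametrization of the graph of `h`. -/
def curve (t : ℝ) : Plane := c.x + (t • c.a + c.h t • c.b)

/-- The speed `√(1 + h'²)` of the parametrization. -/
def speed (t : ℝ) : ℝ := √(1 + deriv c.h t ^ 2)

lemma inner_comb (s t s' t' : ℝ) :
    inner ℝ (s • c.a + t • c.b) (s' • c.a + t' • c.b) = s * s' + t * t' := by
  have h2 : inner ℝ c.b c.a = 0 := by rw [real_inner_comm]; exact c.inner_ab
  simp only [inner_add_left, inner_add_right, inner_smul_left, inner_smul_right, c.inner_ab, h2,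
    real_inner_self_eq_norm_sq, c.norm_a, c.norm_b]
  simp only [conj_trivial]
  ring

lemma norm_comb (s t : ℝ) : ‖s • c.a + t • c.b‖ = √(s ^ 2 + t ^ 2) := by
  rw [← Real.sqrt_sq (norm_nonneg _), ← real_inner_self_eq_norm_sq, c.inner_comb]
  ring_nf

lemma one_le_speed (t : ℝ) : 1 ≤ c.speed t := by
  rw [speed, Real.one_le_sqrt]; nlinarith [sq_nonneg (deriv c.h t)]

lemma speed_pos (t : ℝ) : 0 < c.speed t := lt_of_lt_of_le one_pos (c.one_le_speed t)

lemma abs_deriv_le (t : ℝ) : |deriv c.h t| ≤ c.K := norm_deriv_le_of_lipschitz c.lip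

lemma speed_le (t : ℝ) : c.speed t ≤ 1 + c.K := by
  rw [speed]
  apply Real.sqrt_le_iff.2 ⟨by positivity, ?_⟩
  have := sq_le_sq' (neg_le_of_abs_le (c.abs_deriv_le t)) (le_of_abs_le (c.abs_deriv_le t))
  nlinarith [c.K.coe_nonneg]

lemma measurable_speed : Measurable c.speed :=
  ((measurable_deriv c.h).pow_const 2 |>.const_add 1).sqrt

lemma intervalIntegrable_of_bdd {f : ℝ → ℝ} (hf : Measurable f) {C : ℝ} (hC : ∀ t, |f t| ≤ C)
    (s t : ℝ) : IntervalIntegrable f volume s t := by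
  refine (intervalIntegrable_const (c := C)).mono_fun hf.aestronglyMeasurable ?_
  filter_upwards with u
  exact (hC u).trans (le_abs_self C)

lemma intervalIntegrable_speed (s t : ℝ) : IntervalIntegrable c.speed volume s t :=
  intervalIntegrable_of_bdd c.measurable_speed (C := 1 + c.K)
    (fun u => by rw [abs_of_pos (c.speed_pos u)]; exact c.speed_le u) s t

lemma integral_deriv (s t : ℝ) : ∫ u in s..t, deriv c.h u = c.h t - c.h s :=
  (c.lip.lipschitzOnWith).absolutelyContinuousOnInterval.integral_deriv_eq_sub

lemma continuous_curve : Continuous c.curve := by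
  have := c.lip.continuous
  unfold curve; fun_prop

lemma curve_sub (s t : ℝ) : c.curve t - c.curve s = (t - s) • c.a + (c.h t - c.h s) • c.b := by
  simp only [curve, sub_smul]; abel

lemma dist_curve (s t : ℝ) : dist (c.curve t) (c.curve s) = √((t - s) ^ 2 + (c.h t - c.h s) ^ 2) := by
  rw [dist_eq_norm, curve_sub, norm_comb]

lemma abs_sub_le_dist_curve (s t : ℝ) : |t - s| ≤ dist (c.curve t) (c.curve s) := by
  rw [dist_curve]; apply Real.abs_le_sqrt; nlinarith [sq_nonneg (c.h t - c.h s)]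

lemma injective_curve : Function.Injective c.curve := by
  intro s t hst
  have := c.abs_sub_le_dist_curve s t
  rw [hst, dist_self] at this
  have := abs_nonpos_iff.1 this
  linarith

lemma isClosedEmbedding_curve : IsClosedEmbedding c.curve := by
  have h : AntilipschitzWith 1 c.curve := AntilipschitzWith.of_le_mul_dist fun s t => by
    rw [dist_comm s t, dist_comm (c.curve s), Real.dist_eq]
    simpa using c.abs_sub_le_dist_curve s t
  refine h.isClosedEmbedding ?_
  have hh := c.lip.uniformContinuous
  have h1 : UniformContinuous fun t : ℝ => t • c.a :=
    (ContinuousLinearMap.toSpanSingleton ℝ c.a).uniformContinuous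
  have h2 : UniformContinuous fun t : ℝ => c.h t • c.b :=
    (ContinuousLinearMap.toSpanSingleton ℝ c.b).uniformContinuous.comp hh
  exact uniformContinuous_const.add (h1.add h2)

lemma measurableEmbedding_curve : MeasurableEmbedding c.curve :=
  c.isClosedEmbedding_curve.measurableEmbedding

/-- Cauchy–Schwarz: if (Δt, Δh) is the chord and L its length, then L² = ∫ (Δt + Δh h') ≤ L ∫ √(1 +
h'²). -/
lemma dist_curve_le_integral {s t : ℝ} (hst : s ≤ t) :
    dist (c.curve t) (c.curve s) ≤ ∫ u in s..t, c.speed u := by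
  set L := √((t - s) ^ 2 + (c.h t - c.h s) ^ 2) with hL
  rw [dist_curve, ← hL]
  have hL2 : L ^ 2 = (t - s) ^ 2 + (c.h t - c.h s) ^ 2 := Real.sq_sqrt (by positivity)
  have hL0 : 0 ≤ L := Real.sqrt_nonneg _
  rcases hL0.eq_or_lt with h0 | hpos
  · rw [← h0]
    exact intervalIntegral.integral_nonneg hst fun u _ => (c.speed_pos u).le
  have hint : IntervalIntegrable (fun u => (t - s) + (c.h t - c.h s) * deriv c.h u) volume s t :=
    intervalIntegrable_const.add ((intervalIntegrable_of_bdd (measurable_deriv c.h)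
      c.abs_deriv_le s t).const_mul _)
  have h1 : ∫ u in s..t, ((t - s) + (c.h t - c.h s) * deriv c.h u) = L ^ 2 := by
    rw [intervalIntegral.integral_add intervalIntegrable_const
      ((intervalIntegrable_of_bdd (measurable_deriv c.h) c.abs_deriv_le s t).const_mul _),
      intervalIntegral.integral_const_mul, c.integral_deriv, hL2]
    simp; ring
  have h2 : ∫ u in s..t, ((t - s) + (c.h t - c.h s) * deriv c.h u) ≤ ∫ u in s..t, L * c.speed u := by
    apply intervalIntegral.integral_mono_on hst hint ((c.intervalIntegrable_speed s t).const_mul _)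
    intro u _
    rw [speed, hL, ← Real.sqrt_mul (by positivity)]
    apply Real.le_sqrt_of_sq_le
    nlinarith [sq_nonneg ((t - s) * deriv c.h u - (c.h t - c.h s))]
  rw [h1, intervalIntegral.integral_const_mul] at h2
  nlinarith

/-- The arc length function. -/
def arc (t : ℝ) : ℝ := ∫ u in (0 : ℝ)..t, c.speed u

lemma arc_sub (s t : ℝ) : c.arc t - c.arc s = ∫ u in s..t, c.speed u :=
  intervalIntegral.integral_interval_sub_left (c.intervalIntegrable_speed _ _)
    (c.intervalIntegrable_speed _ _)

lemma dist_curve_le_dist_arc (s t : ℝ) :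
    dist (c.curve t) (c.curve s) ≤ dist (c.arc t) (c.arc s) := by
  wlog hst : s ≤ t generalizing s t
  · rw [dist_comm (c.curve t), dist_comm (c.arc t)]
    exact this t s (le_of_not_ge hst)
  rw [Real.dist_eq, c.arc_sub]
  exact (c.dist_curve_le_integral hst).trans (le_abs_self _)

lemma injective_arc : Function.Injective c.arc := by
  intro s t hst
  apply c.injective_curve
  have := c.dist_curve_le_dist_arc s t
  rw [hst, dist_self] at this
  exact (dist_le_zero.1 this).symm

lemma monotone_arc : Monotone c.arc := by
  intro s t hst
  have : 0 ≤ c.arc t - c.arc s := by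
    rw [arc_sub]
    exact intervalIntegral.integral_nonneg hst fun u _ => (c.speed_pos u).le
  linarith

/-- Parametrized by arc length the curve is 1-Lipschitz, so its Hausdorff measure is at most the
Lebesgue measure of the arc length interval. Half of the area formula. -/
lemma hausdorffMeasure_curve_le (s t : ℝ) :
    Measure.hausdorffMeasure 1 (c.curve '' Set.Ioc s t) ≤
      ENNReal.ofReal (∫ u in s..t, c.speed u) := by
  have hinv : Function.LeftInverse (Function.invFun c.arc) c.arc :=
    Function.leftInverse_invFun c.injective_arc
  have hl : LipschitzOnWith 1 (c.curve ∘ Function.invFun c.arc) (c.arc '' Set.Ioc s t) := by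
    apply LipschitzOnWith.of_dist_le_mul
    rintro _ ⟨p, _, rfl⟩ _ ⟨q, _, rfl⟩
    simp only [Function.comp, hinv p, hinv q, NNReal.coe_one, one_mul]
    exact c.dist_curve_le_dist_arc q p
  have h1 := hl.hausdorffMeasure_image_le (d := 1) zero_le_one
  rw [← Set.image_comp, Function.comp_assoc, hinv.comp_eq_id, Function.comp_id,
    hausdorffMeasure_real] at h1
  refine h1.trans ?_
  simp only [ENNReal.coe_one, ENNReal.one_rpow, one_mul]
  rw [← arc_sub, ← Real.volume_Icc]
  apply measure_mono
  rintro _ ⟨p, hp, rfl⟩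
  exact ⟨c.monotone_arc hp.1.le, c.monotone_arc hp.2⟩

/-- The Hausdorff measure of the graph, as a measure on the parameter interval. -/
def pullback : Measure ℝ := (Measure.hausdorffMeasure 1 : Measure Plane).comap c.curve

lemma pullback_apply (B : Set ℝ) :
    c.pullback B = Measure.hausdorffMeasure 1 (c.curve '' B) :=
  c.measurableEmbedding_curve.comap_apply _ _

lemma pullback_Ioc_le (s t : ℝ) :
    c.pullback (Set.Ioc s t) ≤ ENNReal.ofReal (∫ u in s..t, c.speed u) :=
  (c.pullback_apply _).trans_le (c.hausdorffMeasure_curve_le s t)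

lemma pullback_Ioc_ne_top (s t : ℝ) : c.pullback (Set.Ioc s t) ≠ ⊤ := by
  exact ((c.pullback_Ioc_le s t).trans_lt ENNReal.ofReal_lt_top).ne

instance : IsLocallyFiniteMeasure c.pullback where
  finiteAtNhds t := ⟨Set.Ioc (t - 1) (t + 1), Ioc_mem_nhds (by linarith) (by linarith),
    (c.pullback_Ioc_ne_top _ _).lt_top⟩

/-- Orthogonal projection onto the chord direction is 1-Lipschitz, and by the intermediate value
theorem the projected arc covers a segment as long as the chord. -/
lemma ofReal_dist_le_hausdorffMeasure {s t : ℝ} (hst : s ≤ t) :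
    ENNReal.ofReal (dist (c.curve t) (c.curve s)) ≤ c.pullback (Set.Ioc s t) := by
  set n := c.curve t - c.curve s with hn
  rcases eq_or_ne n 0 with h0 | h0
  · rw [dist_eq_norm, ← hn, h0]; simp
  have hnpos : 0 < ‖n‖ := norm_pos_iff.2 h0
  let p : Plane → ℝ := fun y => inner ℝ (‖n‖⁻¹ • n) y
  have hp : LipschitzWith 1 p := by
    apply LipschitzWith.of_dist_le_mul
    intro y z
    rw [Real.dist_eq, ← inner_sub_right, dist_eq_norm]
    refine (abs_real_inner_le_norm _ _).trans ?_
    rw [norm_smul, norm_inv, norm_norm, inv_mul_cancel₀ hnpos.ne']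
    simp
  have h1 := hp.hausdorffMeasure_image_le (d := 1) zero_le_one (c.curve '' Set.Ioc s t)
  rw [hausdorffMeasure_real] at h1
  simp only [ENNReal.coe_one, ENNReal.one_rpow, one_mul] at h1
  rw [pullback_apply]
  refine le_trans ?_ h1
  have hpn : p (c.curve t) - p (c.curve s) = ‖n‖ := by
    simp only [p]
    rw [← inner_sub_right, ← hn, inner_smul_left, real_inner_self_eq_norm_sq]
    simp; field_simp
  have hsub : Set.Ioc (p (c.curve s)) (p (c.curve t)) ⊆ p '' (c.curve '' Set.Ioc s t) := by
    rw [← Set.image_comp]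
    exact intermediate_value_Ioc hst ((hp.continuous.comp c.continuous_curve).continuousOn)
  refine le_trans ?_ (measure_mono hsub)
  rw [Real.volume_Ioc, hpn, dist_eq_norm]

lemma ae_hasDerivAt : ∀ᵐ t, HasDerivAt c.h (deriv c.h t) t := by
  filter_upwards [c.lip.ae_differentiableAt_real] with t ht using ht.hasDerivAt

lemma hasDerivAt_curve {t : ℝ} {h' : ℝ} (ht : HasDerivAt c.h h' t) :
    HasDerivAt c.curve (c.a + h' • c.b) t := by
  have := ((hasDerivAt_id t).smul_const c.a).add (ht.smul_const c.b)
  have h := this.const_add c.x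
  rw [one_smul] at h
  exact h

/-- For the lower bound, the distribution function `F` of the measure is Lipschitz, hence the
integral of its derivative. Its increments dominate the chords, so `deriv F` is at least the norm of
the velocity, which is the speed, wherever both derivatives exist. -/
lemma pullback_Ioc {s t : ℝ} (hst : s ≤ t) :
    c.pullback (Set.Ioc s t) = ENNReal.ofReal (∫ u in s..t, c.speed u) := by
  apply le_antisymm (c.pullback_Ioc_le s t)
  let F : ℝ → ℝ := fun r => c.pullback.real (Set.Ioc s r)
  have hsub : ∀ q r, s ≤ q → q ≤ r → F r - F q = c.pullback.real (Set.Ioc q r) := by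
    intro q r hq hr
    have : Set.Ioc s r = Set.Ioc s q ∪ Set.Ioc q r := (Set.Ioc_union_Ioc_eq_Ioc hq hr).symm
    simp only [F]
    rw [this, measureReal_union (Set.Ioc_disjoint_Ioc_of_le le_rfl) measurableSet_Ioc
      (c.pullback_Ioc_ne_top _ _) (c.pullback_Ioc_ne_top _ _)]
    ring
  have hlow : ∀ q r, s ≤ q → q ≤ r → dist (c.curve r) (c.curve q) ≤ F r - F q := by
    intro q r hq hr
    rw [hsub q r hq hr]
    exact (ENNReal.ofReal_le_iff_le_toReal (c.pullback_Ioc_ne_top _ _)).1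
      (c.ofReal_dist_le_hausdorffMeasure hr)
  have hup : ∀ q r, s ≤ q → q ≤ r → F r - F q ≤ (1 + c.K) * (r - q) := by
    intro q r hq hr
    rw [hsub q r hq hr]
    have h1 : c.pullback.real (Set.Ioc q r) ≤ ∫ u in q..r, c.speed u :=
      ENNReal.toReal_le_of_le_ofReal
        (intervalIntegral.integral_nonneg hr fun u _ => (c.speed_pos u).le) (c.pullback_Ioc_le q r)
    refine h1.trans ?_
    refine (intervalIntegral.integral_mono_on hr (c.intervalIntegrable_speed q r)
      intervalIntegrable_const fun u _ => c.speed_le u).trans ?_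
    rw [intervalIntegral.integral_const, smul_eq_mul, mul_comm]
  have hlip : LipschitzOnWith (1 + c.K) F (Set.uIcc s t) := by
    rw [Set.uIcc_of_le hst]
    apply LipschitzOnWith.of_dist_le_mul
    have key : ∀ q r, s ≤ q → q ≤ r → dist (F r) (F q) ≤ (1 + c.K : NNReal) * dist r q := by
      intro q r hq hr
      rw [Real.dist_eq, abs_of_nonneg (dist_nonneg.trans (hlow q r hq hr)), Real.dist_eq,
        abs_of_nonneg (by linarith)]
      push_cast
      exact hup q r hq hr
    intro q hq r hr
    rcases le_total q r with hqr | hqr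
    · rw [dist_comm (F q), dist_comm q]; exact key q r hq.1 hqr
    · exact key r q hr.1 hqr
  have hac := hlip.absolutelyContinuousOnInterval
  have hFTC := hac.integral_deriv_eq_sub
  have hFs : F s = 0 := by simp [F]
  have hle : ∫ u in s..t, c.speed u ≤ ∫ u in s..t, deriv F u := by
    apply intervalIntegral.integral_mono_ae_restrict hst (c.intervalIntegrable_speed s t)
      hac.intervalIntegrable_deriv
    have hne : ∀ᵐ u : ℝ, u ≠ t := by simp [ae_iff]
    rw [EventuallyLE, ae_restrict_iff' measurableSet_Icc]
    have hne' : ∀ᵐ u : ℝ, u ≠ s := by simp [ae_iff]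
    filter_upwards [hac.ae_differentiableAt, c.ae_hasDerivAt, hne, hne'] with u hF hh hut hus hu
    rw [Set.uIcc_of_le hst] at hF
    have hF := (hF hu).hasDerivAt
    have hsu : s < u := lt_of_le_of_ne hu.1 (Ne.symm hus)
    have hd1 := hF.tendsto_slope
    have hd2 := (c.hasDerivAt_curve hh).tendsto_slope.norm
    have hn : ‖c.a + deriv c.h u • c.b‖ = c.speed u := by
      have := c.norm_comb 1 (deriv c.h u)
      simpa [speed] using this
    rw [hn] at hd2
    have hmono : 𝓝[>] u ≤ 𝓝[≠] u := nhdsWithin_mono _ fun y hy => ne_of_gt hy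
    refine le_of_tendsto_of_tendsto (hd2.mono_left hmono) (hd1.mono_left hmono) ?_
    filter_upwards [self_mem_nhdsWithin] with r hr
    have hr : u < r := hr
    have h := hlow u r hu.1 hr.le
    rw [slope_def_field, slope_def_module, norm_smul, norm_inv, Real.norm_of_nonneg (by linarith),
      ← dist_eq_norm, div_eq_inv_mul]
    exact mul_le_mul_of_nonneg_left h (inv_nonneg.2 (by linarith))
  rw [hFTC, hFs, sub_zero] at hle
  exact ENNReal.ofReal_le_of_le_toReal hle

lemma pullback_eq : c.pullback = volume.withDensity fun t => (Real.toNNReal (c.speed t) : ENNReal) := by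
  apply Measure.ext_of_Ioc
  intro s t hst
  rw [c.pullback_Ioc hst.le, withDensity_apply _ measurableSet_Ioc,
    intervalIntegral.integral_of_le hst.le, ofReal_integral_eq_lintegral_ofReal]
  · rfl
  · exact ((intervalIntegrable_iff_integrableOn_Ioc_of_le hst.le).1 (c.intervalIntegrable_speed s t))
  · exact ae_of_all _ fun u => (c.speed_pos u).le

/-- Area formula for the graph. -/
theorem restrict_range_curve :
    (Measure.hausdorffMeasure 1 : Measure Plane).restrict (Set.range c.curve) =
      (volume.withDensity fun t => (Real.toNNReal (c.speed t) : ENNReal)).map c.curve := by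
  rw [← pullback_eq, pullback, c.measurableEmbedding_curve.map_comap]

theorem integral_curve {F : Type*} [NormedAddCommGroup F] [NormedSpace ℝ F] (f : Plane → F) :
    ∫ y in Set.range c.curve, f y ∂(Measure.hausdorffMeasure 1 : Measure Plane) =
      ∫ t, c.speed t • f (c.curve t) := by
  rw [restrict_range_curve, c.measurableEmbedding_curve.integral_map,
    integral_withDensity_eq_integral_smul c.measurable_speed.real_toNNReal]
  refine integral_congr_ae (ae_of_all _ fun t => ?_)
  simp only [NNReal.smul_def, Real.coe_toNNReal _ (c.speed_pos t).le]

end GraphChart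

/-! ### Outward normals -/

/-- The two half planes disagree in the direction d = n' - n, where ⟪d, n⟫ = -‖d‖²/2 and ⟪d, n'⟫ =
‖d‖²/2. A nearby point x + r d violates the second condition if it is in `U` and the first if it is
not. -/
lemma IsOuterNormal.unique {U : Set Plane} {x n n' : Plane} (h : IsOuterNormal U x n)
    (h' : IsOuterNormal U x n') : n = n' := by
  by_contra hne
  have hd : 0 < ‖n' - n‖ := norm_pos_iff.2 (sub_ne_zero.2 (Ne.symm hne))
  set d := n' - n with hdef
  have h1 : inner ℝ d n = -(‖d‖ ^ 2 / 2) := by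
    have := norm_sub_sq_real n' n
    rw [h.1, h'.1, ← hdef] at this
    rw [hdef, inner_sub_left, real_inner_self_eq_norm_sq, h.1]
    linarith
  have h2 : inner ℝ d n' = ‖d‖ ^ 2 / 2 := by
    have := norm_sub_sq_real n' n
    rw [h.1, h'.1, ← hdef, real_inner_comm] at this
    rw [hdef, inner_sub_left, real_inner_self_eq_norm_sq, h'.1]
    linarith
  -- Any tolerance below ‖d‖ / 2 contradicts the two inner products.
  have hε : 0 < ‖d‖ / 4 := by positivity
  have ht : Tendsto (fun r : ℝ => x + r • d) (𝓝[>] 0) (𝓝 x) := by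
    have : Tendsto (fun r : ℝ => x + r • d) (𝓝 0) (𝓝 (x + (0 : ℝ) • d)) :=
      Continuous.tendsto (by fun_prop) _
    rw [zero_smul, add_zero] at this
    exact this.mono_left nhdsWithin_le_nhds
  obtain ⟨r, ⟨e1, e2⟩, hr⟩ := ((ht.eventually (h.2 _ hε)).and (ht.eventually (h'.2 _ hε)) |>.and
    self_mem_nhdsWithin).exists
  have hr : 0 < r := hr
  simp only [add_sub_cancel_left, norm_smul, Real.norm_of_nonneg hr.le, inner_smul_left,
    conj_trivial, h1, h2] at e1 e2
  have hp : 0 < r * ‖d‖ ^ 2 := by positivity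
  by_cases hU : x + r • d ∈ U
  · nlinarith [e2.1 hU]
  · nlinarith [e1.2 hU]

lemma IsOuterNormal.outerNormal_eq {U : Set Plane} {x n : Plane} (h : IsOuterNormal U x n) :
    outerNormal U x = n := by
  have hex : ∃ n, IsOuterNormal U x n := ⟨n, h⟩
  rw [outerNormal, dif_pos hex]
  exact hex.choose_spec.unique h

lemma IsOuterNormal.congr {U V : Set Plane} {x n : Plane} (h : IsOuterNormal U x n)
    (hUV : ∀ᶠ y in 𝓝 x, (y ∈ U ↔ y ∈ V)) : IsOuterNormal V x n := by
  refine ⟨h.1, fun ε hε => ?_⟩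
  filter_upwards [h.2 ε hε, hUV] with y hy hi
  rwa [← hi]

lemma outerNormal_congr {U V : Set Plane} {x : Plane}
    (hUV : ∀ᶠ y in 𝓝 x, (y ∈ U ↔ y ∈ V)) : outerNormal U x = outerNormal V x := by
  by_cases h : ∃ n, IsOuterNormal U x n
  · obtain ⟨n, hn⟩ := h
    rw [hn.outerNormal_eq, (hn.congr hUV).outerNormal_eq]
  · have h' : ¬ ∃ n, IsOuterNormal V x n := fun ⟨n, hn⟩ =>
      h ⟨n, hn.congr (hUV.mono fun _ h => h.symm)⟩
    rw [outerNormal, outerNormal, dif_neg h, dif_neg h']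

lemma norm_outerNormal_le (U : Set Plane) (x : Plane) : ‖outerNormal U x‖ ≤ 1 := by
  by_cases h : ∃ n, IsOuterNormal U x n
  · obtain ⟨n, hn⟩ := h
    rw [hn.outerNormal_eq, hn.1]
  · rw [outerNormal, dif_neg h]; simp

/-- The inequality valid on `U` near `x` is a closed condition and passes to the closure of `U`.
This is what relates the normal of Ω minus the closed inclusions to the normals of the inclusions.
-/
lemma IsOuterNormal.compl_closure {U : Set Plane} {x n : Plane} (h : IsOuterNormal U x n) :
    IsOuterNormal (closure U)ᶜ x (-n) := by
  refine ⟨by rw [norm_neg, h.1], fun ε hε => ?_⟩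
  filter_upwards [(h.2 ε hε).eventually_nhds] with y hy
  simp only [inner_neg_right]
  constructor
  · intro hyU
    have := hy.self_of_nhds.2 fun hU => hyU (subset_closure hU)
    linarith
  · intro hyU
    rw [Set.notMem_compl_iff] at hyU
    have hfr := mem_closure_iff_frequently.1 hyU
    have hcl : IsClosed {z : Plane | inner ℝ (z - x) n ≤ ε * ‖z - x‖} :=
      isClosed_le (by fun_prop) (by fun_prop)
    have : inner ℝ (y - x) n ≤ ε * ‖y - x‖ := by
      have hf : ∃ᶠ z in 𝓝 y, z ∈ {z : Plane | inner ℝ (z - x) n ≤ ε * ‖z - x‖} :=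
        (hfr.and_eventually hy).mono fun z hz => hz.2.1 hz.1
      exact hcl.closure_subset (mem_closure_iff_frequently.2 hf)
    linarith

/-! ### The region below a Lipschitz graph -/

namespace GraphChart

variable (c : GraphChart)

lemma orthonormal : Orthonormal ℝ ![c.a, c.b] := by
  have h2 : inner ℝ c.b c.a = 0 := by rw [real_inner_comm]; exact c.inner_ab
  constructor
  · intro i; fin_cases i
    · exact c.norm_a
    · exact c.norm_b
  · intro i j hij; fin_cases i <;> fin_cases j
    · simp at hij
    · exact c.inner_ab
    · exact h2
    · simp at hij

/-- The orthonormal basis `(a, b)`. -/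
def basis : OrthonormalBasis (Fin 2) ℝ Plane :=
  OrthonormalBasis.mk c.orthonormal (by
    rw [c.orthonormal.linearIndependent.span_eq_top_of_card_eq_finrank' (by simp)])

lemma basis_zero : c.basis 0 = c.a := by simp [basis]
lemma basis_one : c.basis 1 = c.b := by simp [basis]

lemma eq_comb (y : Plane) : y = (inner ℝ y c.a : ℝ) • c.a + (inner ℝ y c.b : ℝ) • c.b := by
  have := (c.basis.sum_repr' y).symm
  rwa [Fin.sum_univ_two, basis_zero, basis_one, real_inner_comm, real_inner_comm y c.b] at this

lemma inner_comb_a (s t : ℝ) : inner ℝ (s • c.a + t • c.b) c.a = s := by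
  simpa using c.inner_comb s t 1 0

lemma inner_comb_b (s t : ℝ) : inner ℝ (s • c.a + t • c.b) c.b = t := by
  simpa using c.inner_comb s t 0 1

/-- Coordinates adapted to the graph: the second one is the height above the graph. -/
def param : ℝ × ℝ ≃ₜ Plane where
  toFun p := c.x + (p.1 • c.a + (c.h p.1 + p.2) • c.b)
  invFun y := (inner ℝ (y - c.x) c.a, inner ℝ (y - c.x) c.b - c.h (inner ℝ (y - c.x) c.a))
  left_inv p := by
    simp only [add_sub_cancel_left, inner_comb_a, inner_comb_b]
  right_inv y := by
    simp only [add_sub_cancel]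
    rw [← c.eq_comb]; abel
  continuous_toFun := by
    have := c.lip.continuous
    fun_prop
  continuous_invFun := by
    have := c.lip.continuous
    fun_prop

lemma param_apply (p : ℝ × ℝ) : c.param p = c.x + (p.1 • c.a + (c.h p.1 + p.2) • c.b) := rfl

lemma param_zero (t : ℝ) : c.param (t, 0) = c.curve t := by
  simp [param_apply, curve]

/-- A shear followed by a rigid motion. The shear translates each vertical line, so Fubini suffices
and no change of variables for Lipschitz maps is needed. -/
lemma measurePreserving_param : MeasurePreserving c.param (volume.prod volume) volume := by
  have h1 : MeasurePreserving (fun p : ℝ × ℝ => (p.1, c.h p.1 + p.2)) (volume.prod volume)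
      (volume.prod volume) := by
    refine (MeasurePreserving.id volume).skew_product (g := fun s t => c.h s + t) ?_ ?_
    · have := c.lip.continuous
      exact Continuous.measurable (by fun_prop)
    · exact ae_of_all _ fun s => (measurePreserving_add_left volume (c.h s)).map_eq
  have h2 := ((volume_preserving_finTwoArrow ℝ).symm MeasurableEquiv.finTwoArrow)
  have h3 := PiLp.volume_preserving_toLp (Fin 2)
  have h4 := c.basis.measurePreserving_repr_symm
  have h5 := measurePreserving_add_left (volume : Measure Plane) c.x
  have := h5.comp (h4.comp (h3.comp (h2.comp h1)))
  convert this using 1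
  ext1 p
  simp only [Function.comp, param_apply]
  congr 1
  rw [← c.basis.sum_repr_symm, Fin.sum_univ_two, basis_zero, basis_one]
  rfl

/-- The region below the graph. -/
def region : Set Plane := {y | inner ℝ (y - c.x) c.b < c.h (inner ℝ (y - c.x) c.a)}

lemma param_mem_region (p : ℝ × ℝ) : c.param p ∈ c.region ↔ p.2 < 0 := by
  simp only [region, Set.mem_ofPred_eq, param_apply, add_sub_cancel_left, inner_comb_a, inner_comb_b]
  constructor <;> intro h <;> linarith

lemma preimage_region : c.param ⁻¹' c.region = Set.univ ×ˢ Set.Iio (0 : ℝ) := by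
  ext p; simp [param_mem_region]

lemma frontier_region : frontier c.region = Set.range c.curve := by
  have h1 : frontier (c.param ⁻¹' c.region) = c.param ⁻¹' frontier c.region :=
    (c.param.preimage_frontier _).symm
  rw [preimage_region, frontier_univ_prod_eq, frontier_Iio] at h1
  rw [← Set.image_preimage_eq (frontier c.region) c.param.surjective, ← h1]
  ext y
  simp only [Set.mem_image, Set.mem_prod, Set.mem_univ, true_and, Set.mem_singleton_iff,
    Set.mem_range, Prod.exists]
  constructor
  · rintro ⟨s, t, rfl, h⟩; exact ⟨s, by rw [← param_zero, h]⟩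
  · rintro ⟨s, rfl⟩; exact ⟨s, 0, rfl, c.param_zero s⟩

/-- The unit normal to the graph. -/
def graphNormal (t : ℝ) : Plane := (c.speed t)⁻¹ • ((-deriv c.h t) • c.a + (1 : ℝ) • c.b)

lemma norm_graphNormal (t : ℝ) : ‖c.graphNormal t‖ = 1 := by
  have hs := c.speed_pos t
  have h : √((-deriv c.h t) ^ 2 + 1 ^ 2) = c.speed t := by rw [speed]; ring_nf
  rw [graphNormal, norm_smul, norm_comb, h, norm_inv, Real.norm_of_nonneg hs.le,
    inv_mul_cancel₀ hs.ne']

/-- Up to the factor 1/speed, the component of y - curve t along the normal is the height of y above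
the tangent line. Below the graph it is at most the first order Taylor remainder of `h`, and above
the graph at least that remainder. -/
lemma isOuterNormal_curve {t : ℝ} (ht : DifferentiableAt ℝ c.h t) :
    IsOuterNormal c.region (c.curve t) (c.graphNormal t) := by
  refine ⟨c.norm_graphNormal t, fun ε hε => ?_⟩
  have hd := ht.hasDerivAt.isLittleO.def hε
  have hcont : Tendsto (fun y : Plane => inner ℝ (y - c.x) c.a) (𝓝 (c.curve t)) (𝓝 t) := by
    have : Tendsto (fun y : Plane => inner ℝ (y - c.x) c.a) (𝓝 (c.curve t))
      (𝓝 (inner ℝ (c.curve t - c.x) c.a)) := Continuous.tendsto (by fun_prop) _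
    rwa [curve, add_sub_cancel_left, inner_comb_a] at this
  filter_upwards [hcont.eventually hd] with y hy
  set p := inner ℝ (y - c.x) c.a with hp
  set q := inner ℝ (y - c.x) c.b with hq
  have hyx : y - c.curve t = (p - t) • c.a + (q - c.h t) • c.b := by
    have := c.eq_comb (y - c.x)
    rw [← hp, ← hq] at this
    rw [curve, ← sub_sub, this]
    simp only [sub_smul]; abel
  have hs := c.speed_pos t
  have hs1 := c.one_le_speed t
  have hin : inner ℝ (y - c.curve t) (c.graphNormal t) =
      (c.speed t)⁻¹ * (q - c.h t - (p - t) * deriv c.h t) := by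
    rw [hyx, graphNormal, inner_smul_right, inner_comb]; ring
  have hnorm : |p - t| ≤ ‖y - c.curve t‖ := by
    rw [hyx, norm_comb]; apply Real.abs_le_sqrt; nlinarith [sq_nonneg (q - c.h t)]
  rw [hin]
  simp only [smul_eq_mul, Real.norm_eq_abs] at hy
  have hy' := abs_le.1 (hy.trans (mul_le_mul_of_nonneg_left hnorm hε.le))
  have hB : 0 ≤ ε * ‖y - c.curve t‖ := by positivity
  have hinv : (c.speed t)⁻¹ ≤ 1 := inv_le_one_of_one_le₀ hs1
  have hinv0 : 0 < (c.speed t)⁻¹ := inv_pos.2 hs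
  constructor
  · intro hyU
    have : q < c.h p := hyU
    calc (c.speed t)⁻¹ * (q - c.h t - (p - t) * deriv c.h t)
        ≤ (c.speed t)⁻¹ * (ε * ‖y - c.curve t‖) := by gcongr; linarith
      _ ≤ 1 * (ε * ‖y - c.curve t‖) := by gcongr
      _ = _ := one_mul _
  · intro hyU
    have : c.h p ≤ q := not_lt.1 hyU
    have h1 : (c.speed t)⁻¹ * (-(ε * ‖y - c.curve t‖)) ≤
        (c.speed t)⁻¹ * (q - c.h t - (p - t) * deriv c.h t) := by gcongr; linarith
    nlinarith

lemma arcLength_region : arcLength c.region =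
    (volume.withDensity fun t => (Real.toNNReal (c.speed t) : ENNReal)).map c.curve := by
  rw [arcLength, frontier_region, restrict_range_curve]

lemma ae_arcLength_region {p : Plane → Prop} (h : ∀ᵐ t, p (c.curve t)) :
    ∀ᵐ y ∂arcLength c.region, p y := by
  rw [arcLength_region, c.measurableEmbedding_curve.ae_map_iff]
  exact (withDensity_absolutelyContinuous _ _).ae_le h

lemma ae_outerNormal_curve : ∀ᵐ t, outerNormal c.region (c.curve t) = c.graphNormal t := by
  filter_upwards [c.lip.ae_differentiableAt_real] with t ht
  exact (c.isOuterNormal_curve ht).outerNormal_eq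

lemma ae_isOuterNormal_region :
    ∀ᵐ y ∂arcLength c.region, IsOuterNormal c.region y (outerNormal c.region y) := by
  apply c.ae_arcLength_region
  filter_upwards [c.lip.ae_differentiableAt_real] with t ht
  have := c.isOuterNormal_curve ht
  rwa [this.outerNormal_eq]

lemma measurable_graphNormal : Measurable c.graphNormal := by
  have h1 := measurable_deriv c.h
  have h2 := c.measurable_speed
  unfold graphNormal
  fun_prop

lemma aestronglyMeasurable_outerNormal_region :
    AEStronglyMeasurable (outerNormal c.region) (arcLength c.region) := by
  rw [arcLength_region, c.measurableEmbedding_curve.aestronglyMeasurable_map_iff]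
  refine ⟨c.graphNormal, c.measurable_graphNormal.stronglyMeasurable, ?_⟩
  exact (withDensity_absolutelyContinuous _ _).ae_le c.ae_outerNormal_curve

lemma le_inner_outerNormal_region :
    ∀ᵐ y ∂arcLength c.region, (1 + c.K : ℝ)⁻¹ ≤ inner ℝ (outerNormal c.region y) c.b := by
  apply c.ae_arcLength_region
  filter_upwards [c.ae_outerNormal_curve] with t ht
  rw [ht, graphNormal, inner_smul_left, inner_comb_b]
  simpa using inv_anti₀ (c.speed_pos t) (c.speed_le t)

lemma arcLength_region_lt_top {B : Set Plane} (hB : IsCompact B) :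
    arcLength c.region B < ⊤ := by
  rw [arcLength_region, c.measurableEmbedding_curve.map_apply, ← pullback_eq]
  exact (c.isClosedEmbedding_curve.isCompact_preimage hB).measure_lt_top

lemma integral_arcLength_region {F : Type*} [NormedAddCommGroup F] [NormedSpace ℝ F]
    (f : Plane → F) : ∫ y, f y ∂arcLength c.region = ∫ t, c.speed t • f (c.curve t) := by
  rw [arcLength, frontier_region, integral_curve]

/-- Supplies mollification kernels that look from the closed region into the open one. A vertical
shift by δ/2 beats every perturbation of size `r`, since such a perturbation changes the height
above the graph by at most r (1 + K). -/
lemma shift_region {δ : ℝ} (hδ : 0 < δ) : ∃ (z : Plane) (r : ℝ), 0 < r ∧ ‖z‖ + r < δ ∧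
    ∀ y ∈ closure c.region, ∀ w ∈ Metric.ball z r, y - w ∈ c.region := by
  have hK := c.K.coe_nonneg
  -- The radius is chosen so that r (1 + K) = δ/4, half of the vertical shift.
  refine ⟨(δ / 2) • c.b, δ / (4 * (1 + c.K)), by positivity, ?_, ?_⟩
  · rw [norm_smul, c.norm_b, Real.norm_of_nonneg (by positivity)]
    have : δ / (4 * (1 + c.K)) ≤ δ / 4 := by
      apply div_le_div_of_nonneg_left hδ.le (by norm_num) (by linarith)
    linarith
  · intro y hy w hw
    have hy' : inner ℝ (y - c.x) c.b ≤ c.h (inner ℝ (y - c.x) c.a) := by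
      have hcl : IsClosed {y : Plane | inner ℝ (y - c.x) c.b ≤ c.h (inner ℝ (y - c.x) c.a)} := by
        have := c.lip.continuous
        exact isClosed_le (by fun_prop) (by fun_prop)
      have hsub : c.region ⊆ {y : Plane | inner ℝ (y - c.x) c.b ≤ c.h (inner ℝ (y - c.x) c.a)} := by
        intro y hy
        have hy : inner ℝ (y - c.x) c.b < c.h (inner ℝ (y - c.x) c.a) := hy
        exact hy.le
      exact closure_minimal hsub hcl hy
    rw [mem_ball_iff_norm] at hw
    set r := δ / (4 * (1 + c.K)) with hr
    have hwa : |inner ℝ w c.a| ≤ r := by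
      have h1 : inner ℝ w c.a = inner ℝ (w - (δ / 2) • c.b) c.a := by
        rw [inner_sub_left, inner_smul_left, real_inner_comm c.a c.b, c.inner_ab]; simp
      rw [h1]
      refine (abs_real_inner_le_norm _ _).trans ?_
      rw [c.norm_a]; linarith
    have hwb : δ / 2 - r ≤ inner ℝ w c.b := by
      have h1 : inner ℝ w c.b = inner ℝ (w - (δ / 2) • c.b) c.b + δ / 2 := by
        rw [inner_sub_left, inner_smul_left, real_inner_self_eq_norm_sq, c.norm_b]; simp
      have h2 := (abs_real_inner_le_norm (w - (δ / 2) • c.b) c.b)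
      rw [c.norm_b] at h2
      linarith [neg_abs_le (inner ℝ (w - (δ / 2) • c.b) c.b)]
    show inner ℝ (y - w - c.x) c.b < c.h (inner ℝ (y - w - c.x) c.a)
    have e1 : y - w - c.x = (y - c.x) - w := by abel
    rw [e1, inner_sub_left, inner_sub_left (y - c.x) w c.a]
    have hl := c.lip.dist_le_mul (inner ℝ (y - c.x) c.a) (inner ℝ (y - c.x) c.a - inner ℝ w c.a)
    rw [Real.dist_eq, Real.dist_eq, sub_sub_cancel] at hl
    have h3 := (le_abs_self _).trans hl
    have h4 : c.K * |inner ℝ w c.a| ≤ c.K * r := by gcongr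
    have h5 : r * (1 + c.K) = δ / 4 := by rw [hr]; field_simp
    nlinarith

end GraphChart

/-! ### The divergence theorem below a Lipschitz graph -/

lemma integral_deriv_eq_zero_of_lipschitz {f : ℝ → ℝ} {K : NNReal} (hf : LipschitzWith K f)
    (hc : HasCompactSupport f) : ∫ t, deriv f t = 0 := by
  obtain ⟨R, hR⟩ := hc.isCompact.isBounded.subset_closedBall (0 : ℝ)
  set M := |R| + 1 with hM
  have hout : ∀ t, M ≤ |t| → t ∉ tsupport f := by
    intro t ht hmem
    have := hR hmem
    rw [mem_closedBall_zero_iff, Real.norm_eq_abs] at this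
    linarith [le_abs_self R]
  have hMpos : 0 < M := by positivity
  have h1 : ∫ t in Set.Ioc (-M) M, deriv f t = ∫ t, deriv f t := by
    apply setIntegral_eq_integral_of_forall_compl_eq_zero
    intro t ht
    have htM : M ≤ |t| := by
      by_contra hlt
      rw [not_le, abs_lt] at hlt
      exact ht ⟨hlt.1, hlt.2.le⟩
    have := (notMem_tsupport_iff_eventuallyEq.1 (hout t htM)).deriv_eq
    simpa using this
  rw [← h1, ← intervalIntegral.integral_of_le (by linarith),
    hf.lipschitzOnWith.absolutelyContinuousOnInterval.integral_deriv_eq_sub,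
    image_eq_zero_of_notMem_tsupport (hout M (le_abs_self M)),
    image_eq_zero_of_notMem_tsupport (hout (-M) (by rw [abs_neg]; exact le_abs_self M)), sub_zero]

lemma exists_lipschitzWith {ψ : Plane → ℝ} (hψ : ContDiff ℝ 1 ψ) (hc : HasCompactSupport ψ) :
    ∃ C, LipschitzWith C ψ := hψ.lipschitzWith_of_hasCompactSupport hc one_ne_zero

namespace GraphChart

variable (c : GraphChart)

lemma lipschitz_param_left (s : ℝ) : LipschitzWith (1 + c.K) fun t => c.param (t, s) := by
  apply LipschitzWith.of_dist_le_mul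
  intro t t'
  rw [dist_eq_norm]
  have : c.param (t, s) - c.param (t', s) = (t - t') • c.a + (c.h t - c.h t') • c.b := by
    simp only [param_apply, sub_smul, add_smul]; abel
  rw [this]
  refine (norm_add_le _ _).trans ?_
  rw [norm_smul, norm_smul, c.norm_a, c.norm_b, Real.norm_eq_abs, Real.norm_eq_abs]
  have := c.lip.dist_le_mul t t'
  rw [Real.dist_eq, Real.dist_eq] at this
  push_cast
  rw [Real.dist_eq]
  linarith

lemma hasCompactSupport_param {ψ : Plane → ℝ} (hc : HasCompactSupport ψ) :
    HasCompactSupport (fun p => ψ (c.param p)) :=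
  hc.comp_isClosedEmbedding c.param.isClosedEmbedding

lemma hasDerivAt_param_right (t s : ℝ) : HasDerivAt (fun s => c.param (t, s)) c.b s := by
  have := ((((hasDerivAt_id s).const_add (c.h t)).smul_const c.b).const_add (t • c.a)).const_add c.x
  rw [one_smul] at this
  exact this

lemma hasDerivAt_param_left {t : ℝ} (s : ℝ) {h' : ℝ} (ht : HasDerivAt c.h h' t) :
    HasDerivAt (fun t => c.param (t, s)) (c.a + h' • c.b) t := by
  have := (((hasDerivAt_id t).smul_const c.a).add ((ht.add_const s).smul_const c.b)).const_add c.x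
  rw [one_smul] at this
  exact this

lemma integral_normal_comp {ψ : Plane → ℝ} (hψ : ContDiff ℝ 1 ψ) (hc : HasCompactSupport ψ)
    (t : ℝ) : ∫ s in Set.Iio (0 : ℝ), fderiv ℝ ψ (c.param (t, s)) c.b = ψ (c.curve t) := by
  have hd : ∀ s, HasDerivAt (fun s => ψ (c.param (t, s))) (fderiv ℝ ψ (c.param (t, s)) c.b) s :=
    fun s => (hψ.differentiable one_ne_zero _).hasFDerivAt.comp_hasDerivAt s
      (c.hasDerivAt_param_right t s)
  have hcs : HasCompactSupport (fun s => ψ (c.param (t, s))) :=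
    (c.hasCompactSupport_param hc).comp_isClosedEmbedding (g := fun s => (t, s))
      (Isometry.of_dist_eq fun _ _ => by simp [Prod.dist_eq]).isClosedEmbedding
  have hcd : ContDiff ℝ 1 (fun s => ψ (c.param (t, s))) := by
    refine hψ.comp ?_
    simp only [param_apply]
    fun_prop
  have := hcs.integral_Iic_deriv_eq hcd 0
  rw [integral_Iic_eq_integral_Iio] at this
  rw [← c.param_zero t, ← this]
  exact integral_congr_ae (ae_of_all _ fun s => (hd s).deriv.symm)

/-- At almost every t the integrand is the derivative of `ψ` along a vertical translate of the
graph, a compactly supported Lipschitz function of t. -/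
lemma integral_tangential_comp {ψ : Plane → ℝ} (hψ : ContDiff ℝ 1 ψ) (hc : HasCompactSupport ψ)
    (s : ℝ) : ∫ t, fderiv ℝ ψ (c.param (t, s)) (c.a + deriv c.h t • c.b) = 0 := by
  obtain ⟨C, hC⟩ := exists_lipschitzWith hψ hc
  have hcs : HasCompactSupport (fun t => ψ (c.param (t, s))) :=
    (c.hasCompactSupport_param hc).comp_isClosedEmbedding (g := fun t => (t, s))
      (Isometry.of_dist_eq fun _ _ => by simp [Prod.dist_eq]).isClosedEmbedding
  rw [← integral_deriv_eq_zero_of_lipschitz (hC.comp (c.lipschitz_param_left s)) hcs]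
  apply integral_congr_ae
  filter_upwards [c.ae_hasDerivAt] with t ht
  exact ((hψ.differentiable one_ne_zero _).hasFDerivAt.comp_hasDerivAt t
    (c.hasDerivAt_param_left s ht)).deriv.symm

lemma integrable_fderiv_param {ψ : Plane → ℝ} (hψ : ContDiff ℝ 1 ψ) (hc : HasCompactSupport ψ)
    (e : Plane) : Integrable (fun p => fderiv ℝ ψ (c.param p) e) (volume.prod volume) := by
  have h1 : Continuous fun y => fderiv ℝ ψ y e :=
    (hψ.continuous_fderiv one_ne_zero).clm_apply continuous_const
  have h2 : HasCompactSupport fun y => fderiv ℝ ψ y e := hc.fderiv_apply (𝕜 := ℝ) e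
  have h3 : HasCompactSupport fun p => fderiv ℝ ψ (c.param p) e :=
    h2.comp_isClosedEmbedding c.param.isClosedEmbedding
  exact (h1.comp c.param.continuous).integrable_of_hasCompactSupport h3

/-- Write e = (e_b - h' e_a) b + e_a (a + h' b). The second vector is tangent to the translates of
the graph and contributes zero. The first is vertical, with a coefficient independent of the height,
and the fundamental theorem of calculus on each vertical line leaves the value on the graph. -/
theorem divergence_region_param {ψ : Plane → ℝ} (hψ : ContDiff ℝ 1 ψ) (hc : HasCompactSupport ψ)
    (e : Plane) : ∫ y in c.region, fderiv ℝ ψ y e =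
      ∫ t, ψ (c.curve t) * (inner ℝ e c.b - deriv c.h t * inner ℝ e c.a) := by
  set ea := inner ℝ e c.a with hea
  set eb := inner ℝ e c.b with heb
  have ia := c.integrable_fderiv_param hψ hc c.a
  have ib := c.integrable_fderiv_param hψ hc c.b
  have ib' : Integrable (fun p : ℝ × ℝ => deriv c.h p.1 * fderiv ℝ ψ (c.param p) c.b)
      (volume.prod volume) := by
    refine ib.bdd_mul (c := c.K) ?_ ?_
    · exact ((measurable_deriv c.h).comp measurable_fst).aestronglyMeasurable
    · exact ae_of_all _ fun p => c.abs_deriv_le p.1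
  have it : Integrable (fun p : ℝ × ℝ => fderiv ℝ ψ (c.param p) (c.a + deriv c.h p.1 • c.b))
      (volume.prod volume) := by
    refine (ia.add ib').congr (ae_of_all _ fun p => ?_)
    simp
  have hset : ∫ y in c.region, fderiv ℝ ψ y e =
      ∫ p in Set.univ ×ˢ Set.Iio (0 : ℝ), fderiv ℝ ψ (c.param p) e ∂(volume.prod volume) := by
    rw [← c.measurePreserving_param.setIntegral_preimage_emb c.param.measurableEmbedding,
      preimage_region]
  have htan : ∫ p in Set.univ ×ˢ Set.Iio (0 : ℝ),
      fderiv ℝ ψ (c.param p) (c.a + deriv c.h p.1 • c.b) ∂(volume.prod volume) = 0 := by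
    rw [← Measure.prod_restrict, integral_prod_symm, Measure.restrict_univ]
    · simp only [c.integral_tangential_comp hψ hc, integral_zero]
    · rw [Measure.prod_restrict]; exact it.integrableOn
  have hnor : ∫ p in Set.univ ×ˢ Set.Iio (0 : ℝ),
      (eb - deriv c.h p.1 * ea) * fderiv ℝ ψ (c.param p) c.b ∂(volume.prod volume) =
      ∫ t, ψ (c.curve t) * (eb - deriv c.h t * ea) := by
    rw [setIntegral_prod]
    · rw [setIntegral_univ]
      refine integral_congr_ae (ae_of_all _ fun t => ?_)
      simp only
      rw [integral_const_mul, c.integral_normal_comp hψ hc, mul_comm]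
    · refine Integrable.integrableOn (((ib.const_mul eb).sub (ib'.const_mul ea)).congr
        (ae_of_all _ fun p => ?_))
      simp only [Pi.sub_apply]; ring
  have inor : Integrable (fun p : ℝ × ℝ => (eb - deriv c.h p.1 * ea) * fderiv ℝ ψ (c.param p) c.b)
      (volume.prod volume) := by
    refine (((ib.const_mul eb).sub (ib'.const_mul ea)).congr (ae_of_all _ fun p => ?_))
    simp only [Pi.sub_apply]; ring
  have hsum := integral_add inor.integrableOn (it.const_mul ea).integrableOn
    (μ := (volume.prod volume).restrict (Set.univ ×ˢ Set.Iio (0 : ℝ)))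
  rw [integral_const_mul, htan, mul_zero, add_zero, hnor] at hsum
  rw [hset, ← hsum]
  refine integral_congr_ae (ae_of_all _ fun p => ?_)
  simp only
  conv_lhs => rw [c.eq_comb e, ← hea, ← heb]
  simp only [map_add, map_smul, smul_eq_mul]
  ring

theorem divergence_region {ψ : Plane → ℝ} (hψ : ContDiff ℝ 1 ψ) (hc : HasCompactSupport ψ)
    (e : Plane) : ∫ y in c.region, fderiv ℝ ψ y e =
      ∫ y, ψ y * inner ℝ (outerNormal c.region y) e ∂arcLength c.region := by
  rw [c.divergence_region_param hψ hc, c.integral_arcLength_region]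
  apply integral_congr_ae
  filter_upwards [c.ae_outerNormal_curve] with t ht
  have hs := (c.speed_pos t).ne'
  rw [ht, graphNormal, inner_smul_left, inner_add_left, inner_smul_left, inner_smul_left,
    real_inner_comm e c.a, real_inner_comm e c.b]
  simp only [conj_trivial, smul_eq_mul]
  field_simp
  ring

end GraphChart

/-! ### Local models of a domain near a point -/

/-- The properties of the half plane below a Lipschitz graph which make it a local model of
a Lipschitz domain; they are shared by the empty set and by the whole plane. -/
structure IsModel (S : Set Plane) : Prop where
  arcLength_lt_top : ∀ B, IsCompact B → arcLength S B < ⊤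
  measurable_normal : AEStronglyMeasurable (outerNormal S) (arcLength S)
  isOuterNormal : ∀ᵐ y ∂arcLength S, IsOuterNormal S y (outerNormal S y)
  divergence : ∀ ψ : Plane → ℝ, ContDiff ℝ 1 ψ → HasCompactSupport ψ → ∀ e : Plane,
    ∫ y in S, fderiv ℝ ψ y e = ∫ y, ψ y * inner ℝ (outerNormal S y) e ∂arcLength S
  transversal : ∃ e : Plane, ∃ r > 0, ∀ᵐ y ∂arcLength S, r ≤ inner ℝ (outerNormal S y) e
  shift : ∀ δ > 0, ∃ (z : Plane) (r : ℝ), 0 < r ∧ ‖z‖ + r < δ ∧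
    ∀ y ∈ closure S, ∀ w ∈ Metric.ball z r, y - w ∈ S

lemma GraphChart.isModel (c : GraphChart) : IsModel c.region where
  arcLength_lt_top _ hB := c.arcLength_region_lt_top hB
  measurable_normal := c.aestronglyMeasurable_outerNormal_region
  isOuterNormal := c.ae_isOuterNormal_region
  divergence _ hψ hc e := c.divergence_region hψ hc e
  transversal := ⟨c.b, (1 + c.K : ℝ)⁻¹, by positivity, c.le_inner_outerNormal_region⟩
  shift _ hδ := c.shift_region hδ

lemma integral_fderiv_eq_zero {ψ : Plane → ℝ} (hψ : ContDiff ℝ 1 ψ) (hc : HasCompactSupport ψ)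
    (e : Plane) : ∫ y, fderiv ℝ ψ y e = 0 := by
  have h1 : Continuous fun y => fderiv ℝ ψ y e :=
    (hψ.continuous_fderiv one_ne_zero).clm_apply continuous_const
  have h2 : HasCompactSupport fun y => fderiv ℝ ψ y e := hc.fderiv_apply (𝕜 := ℝ) e
  have := integral_mul_fderiv_eq_neg_fderiv_mul_of_integrable (μ := (volume : Measure Plane))
    (f := fun _ => (1 : ℝ)) (g := ψ) (v := e) (by simp)
    (by simpa using h1.integrable_of_hasCompactSupport h2)
    (by simpa using hψ.continuous.integrable_of_hasCompactSupport hc)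
    (fun _ _ => by fun_prop) (fun x _ => hψ.differentiable one_ne_zero x)
  simpa using this

lemma isModel_univ : IsModel Set.univ where
  arcLength_lt_top B _ := by simp [arcLength]
  measurable_normal := by simp [arcLength]
  isOuterNormal := by simp [arcLength]
  divergence ψ hψ hc e := by simpa [arcLength] using integral_fderiv_eq_zero hψ hc e
  transversal := ⟨0, 1, one_pos, by simp [arcLength]⟩
  shift δ hδ := ⟨0, δ / 2, by positivity, by simpa using hδ, fun _ _ _ _ => Set.mem_univ _⟩

lemma isModel_empty : IsModel ∅ where
  arcLength_lt_top B _ := by simp [arcLength]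
  measurable_normal := by simp [arcLength]
  isOuterNormal := by simp [arcLength]
  divergence ψ hψ hc e := by simp [arcLength]
  transversal := ⟨0, 1, one_pos, by simp [arcLength]⟩
  shift δ hδ := ⟨0, δ / 2, by positivity, by simpa using hδ, fun y hy => by simp at hy⟩

/-- The chart given by a rigid motion. -/
def GraphChart.ofIsometry (x : Plane) (A : Plane ≃ₗᵢ[ℝ] Plane) {h : ℝ → ℝ} {K : NNReal}
    (hK : LipschitzWith K h) : GraphChart where
  x := x
  a := A.symm (EuclideanSpace.single 0 1)
  b := A.symm (EuclideanSpace.single 1 1)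
  norm_a := by simp
  norm_b := by simp
  inner_ab := by simp [EuclideanSpace.inner_single_left]
  h := h
  K := K
  lip := hK

lemma inner_symm_single (A : Plane ≃ₗᵢ[ℝ] Plane) (y : Plane) (i : Fin 2) :
    inner ℝ y (A.symm (EuclideanSpace.single i 1)) = A y i := by
  rw [← A.inner_map_map, A.apply_symm_apply, EuclideanSpace.inner_single_right]
  simp

lemma GraphChart.mem_region_ofIsometry (x : Plane) (A : Plane ≃ₗᵢ[ℝ] Plane) {h : ℝ → ℝ}
    {K : NNReal} (hK : LipschitzWith K h) (y : Plane) :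
    y ∈ (GraphChart.ofIsometry x A hK).region ↔ A (y - x) 1 < h (A (y - x) 0) := by
  rw [← inner_symm_single, ← inner_symm_single]
  rfl

/-- With the plane and the empty set as models at interior and exterior points, the partition of
unity arguments need not distinguish where a point lies. -/
lemma HasLipschitzBoundary.exists_isModel {U : Set Plane} (hU : HasLipschitzBoundary U)
    (x : Plane) : ∃ S, IsModel S ∧ ∀ᶠ y in 𝓝 x, (y ∈ U ↔ y ∈ S) := by
  by_cases h1 : x ∈ interior U
  · refine ⟨Set.univ, isModel_univ, ?_⟩
    filter_upwards [isOpen_interior.mem_nhds h1] with y hy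
    simp [interior_subset hy]
  by_cases h2 : x ∈ closure U
  · obtain ⟨A, h, ⟨K, hK⟩, hA⟩ := hU x ⟨h2, h1⟩
    refine ⟨(GraphChart.ofIsometry x A hK).region, GraphChart.isModel _, ?_⟩
    filter_upwards [hA] with y hy
    rw [hy, GraphChart.mem_region_ofIsometry]
  · refine ⟨∅, isModel_empty, ?_⟩
    filter_upwards [isClosed_closure.isOpen_compl.mem_nhds h2] with y hy
    simp only [Set.mem_empty_iff_false, iff_false]
    exact fun hyU => hy (subset_closure hyU)

/-! ### Cutoff functions and localization -/

open scoped Manifold ContDiff in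
lemma exists_cutoff {B O : Set Plane} (hB : IsCompact B) (hO : IsOpen O) (hBO : B ⊆ O) :
    ∃ χ : Plane → ℝ, ContDiff ℝ (⊤ : ℕ∞) χ ∧ HasCompactSupport χ ∧ tsupport χ ⊆ O ∧
      (∀ᶠ y in 𝓝ˢ B, χ y = 1) ∧ ∀ y, χ y ∈ Set.Icc (0 : ℝ) 1 := by
  obtain ⟨L, hL, hBL, hLO⟩ := exists_compact_between hB hO hBO
  obtain ⟨f, h1, h0, hf⟩ := exists_contMDiffMap_one_nhds_of_subset_interior 𝓘(ℝ, Plane)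
    (n := ⊤) hB.isClosed hBL
  have hts : tsupport f ⊆ L := closure_minimal
    (fun x hx => by by_contra hxL; exact hx (h0 x hxL)) hL.isClosed
  exact ⟨f, f.contMDiff.contDiff, HasCompactSupport.of_support_subset_isCompact hL
    (fun x hx => by by_contra hxL; exact hx (h0 x hxL)), hts.trans hLO, h1, hf⟩

open scoped Manifold ContDiff in
/-- A property of smooth compactly supported functions which is additive and holds for functions
supported near any given point holds for all of them. -/
theorem localization {p : (Plane → ℝ) → Prop} (h0 : p 0) (hadd : ∀ f g, p f → p g → p (f + g))
    (hloc : ∀ x, ∃ W ∈ 𝓝 x, ∀ χ : Plane → ℝ, ContDiff ℝ (⊤ : ℕ∞) χ → HasCompactSupport χ →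
      tsupport χ ⊆ W → p χ)
    {χ : Plane → ℝ} (hχ : ContDiff ℝ (⊤ : ℕ∞) χ) (hc : HasCompactSupport χ) : p χ := by
  classical
  choose W hW hp using hloc
  obtain ⟨t, -, ht⟩ := hc.isCompact.elim_nhds_subcover (fun x => interior (W x))
    (fun x _ => interior_mem_nhds.2 (hW x))
  obtain ⟨ρ, hρ⟩ := SmoothPartitionOfUnity.exists_isSubordinate 𝓘(ℝ, Plane)
    (isClosed_tsupport χ) (fun i : t => interior (W i)) (fun i => isOpen_interior)
    (by
      refine ht.trans ?_
      intro y hy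
      simp only [Set.mem_iUnion] at hy ⊢
      obtain ⟨i, hi, hy⟩ := hy
      exact ⟨⟨i, hi⟩, hy⟩)
  have hsum : χ = ∑ i, (fun y => ρ i y * χ y) := by
    ext y
    rw [Finset.sum_apply, ← Finset.sum_mul]
    by_cases hy : y ∈ tsupport χ
    · have := ρ.sum_eq_one hy
      rw [finsum_eq_sum_of_fintype] at this
      rw [this, one_mul]
    · rw [image_eq_zero_of_notMem_tsupport hy, mul_zero]
  rw [hsum]
  refine Finset.sum_induction _ p hadd h0 fun i _ => ?_
  refine hp i _ ((ρ i).contMDiff.contDiff.mul hχ) hc.mul_left ?_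
  exact ((tsupport_mul_subset_left).trans (hρ i)).trans interior_subset

/-! ### Two sets that agree on an open set -/

section Agree

variable {U S W : Set Plane}

lemma frontier_inter_of_agree (hW : IsOpen W) (h : U ∩ W = S ∩ W) :
    frontier U ∩ W = frontier S ∩ W := by
  rw [← frontier_inter_open_inter hW, h, frontier_inter_open_inter hW]

lemma arcLength_restrict_of_agree (hW : IsOpen W) (h : U ∩ W = S ∩ W) :
    (arcLength U).restrict W = (arcLength S).restrict W := by
  rw [arcLength, arcLength, Measure.restrict_restrict hW.measurableSet,
    Measure.restrict_restrict hW.measurableSet, Set.inter_comm W, Set.inter_comm W,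
    frontier_inter_of_agree hW h]

lemma volume_restrict_of_agree (hW : IsOpen W) (h : U ∩ W = S ∩ W) :
    ((volume : Measure Plane).restrict U).restrict W = (volume.restrict S).restrict W := by
  rw [Measure.restrict_restrict hW.measurableSet,
    Measure.restrict_restrict hW.measurableSet, Set.inter_comm W, Set.inter_comm W, h]

lemma eventually_mem_iff_of_agree (hW : IsOpen W) (h : U ∩ W = S ∩ W) {y : Plane} (hy : y ∈ W) :
    ∀ᶠ z in 𝓝 y, (z ∈ U ↔ z ∈ S) := by
  filter_upwards [hW.mem_nhds hy] with z hz
  have : z ∈ U ∩ W ↔ z ∈ S ∩ W := by rw [h]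
  simpa [hz] using this

lemma outerNormal_of_agree (hW : IsOpen W) (h : U ∩ W = S ∩ W) {y : Plane} (hy : y ∈ W) :
    outerNormal U y = outerNormal S y :=
  outerNormal_congr (eventually_mem_iff_of_agree hW h hy)

end Agree

lemma HasLipschitzBoundary.exists_agree {U : Set Plane} (hU : HasLipschitzBoundary U)
    (x : Plane) : ∃ S W, IsModel S ∧ IsOpen W ∧ x ∈ W ∧ U ∩ W = S ∩ W := by
  obtain ⟨S, hS, h⟩ := hU.exists_isModel x
  obtain ⟨W, hW, hWo, hx⟩ := eventually_nhds_iff.1 h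
  refine ⟨S, W, hS, hWo, hx, ?_⟩
  ext z
  simp only [Set.mem_inter_iff]
  exact ⟨fun hz => ⟨(hW z hz.2).1 hz.1, hz.2⟩, fun hz => ⟨(hW z hz.2).2 hz.1, hz.2⟩⟩

lemma integral_restrict_eq {μ : Measure Plane} {F : Type*} [NormedAddCommGroup F]
    [NormedSpace ℝ F] {f : Plane → F} {W : Set Plane} (hf : tsupport f ⊆ W) :
    ∫ y in W, f y ∂μ = ∫ y, f y ∂μ :=
  setIntegral_eq_integral_of_forall_compl_eq_zero fun _ hx =>
    image_eq_zero_of_notMem_tsupport fun h => hx (hf h)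

lemma aestronglyMeasurable_of_restrict {μ : Measure Plane} {F : Type*} [NormedAddCommGroup F]
    {f : Plane → F} {W : Set Plane} (hW : IsOpen W) (hf : tsupport f ⊆ W)
    (h : AEStronglyMeasurable f (μ.restrict W)) : AEStronglyMeasurable f μ := by
  have h1 : W.indicator f = f := by
    rw [Set.indicator_eq_self]; exact (subset_tsupport f).trans hf
  rw [← h1, aestronglyMeasurable_indicator_iff hW.measurableSet]
  exact h

/-! ### Bounded Lipschitz domains -/

section Lipschitz

variable {U : Set Plane}

lemma isCompact_frontier (hb : Bornology.IsBounded U) : IsCompact (frontier U) :=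
  hb.isCompact_closure.of_isClosed_subset isClosed_frontier frontier_subset_closure

lemma ae_mem_frontier (U : Set Plane) : ∀ᵐ y ∂arcLength U, y ∈ frontier U :=
  ae_restrict_mem isClosed_frontier.measurableSet

lemma exists_cutoff_closure (hb : Bornology.IsBounded U) :
    ∃ χ : Plane → ℝ, ContDiff ℝ (⊤ : ℕ∞) χ ∧ HasCompactSupport χ ∧
      (∀ᶠ y in 𝓝ˢ (closure U), χ y = 1) := by
  obtain ⟨χ, h1, h2, -, h3, -⟩ := exists_cutoff hb.isCompact_closure isOpen_univ (Set.subset_univ _)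
  exact ⟨χ, h1, h2, h3⟩

/-- This pattern recurs below: the claim is stated with a cutoff factor, proved for small supports
by comparison with a model, summed by `localization`, and applied to a cutoff equal to 1 near the
closure of `U`. -/
theorem isFiniteMeasure_arcLength (hb : Bornology.IsBounded U) (hL : HasLipschitzBoundary U) :
    IsFiniteMeasure (arcLength U) := by
  obtain ⟨χ, hχ, hc, h1⟩ := exists_cutoff_closure hb
  have key : Integrable χ (arcLength U) := by
    refine localization (p := fun χ => Integrable χ (arcLength U)) (integrable_zero _ _ _)
      (fun f g hf hg => hf.add hg) (fun x => ?_) hχ hc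
    obtain ⟨S, W, hS, hWo, hx, hUS⟩ := hL.exists_agree x
    refine ⟨W, hWo.mem_nhds hx, fun χ hχ hc hs => ?_⟩
    have : IsFiniteMeasureOnCompacts (arcLength S) := ⟨fun K hK => hS.arcLength_lt_top K hK⟩
    have h2 : Integrable χ (arcLength S) := hχ.continuous.integrable_of_hasCompactSupport hc
    have h3 : IntegrableOn χ W (arcLength U) := by
      rw [IntegrableOn, arcLength_restrict_of_agree hWo hUS]; exact h2.integrableOn
    exact h3.integrable_of_forall_notMem_eq_zero fun y hy =>
      image_eq_zero_of_notMem_tsupport fun h => hy (hs h)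
  have h2 : Integrable (fun _ : Plane => (1 : ℝ)) (arcLength U) := by
    refine key.congr ?_
    filter_upwards [ae_mem_frontier U] with y hy
    exact h1.self_of_nhdsSet y (frontier_subset_closure hy)
  rwa [integrable_const_iff_isFiniteMeasure one_ne_zero] at h2

theorem ae_isOuterNormal (hb : Bornology.IsBounded U) (hL : HasLipschitzBoundary U) :
    ∀ᵐ y ∂arcLength U, IsOuterNormal U y (outerNormal U y) := by
  obtain ⟨χ, hχ, hc, h1⟩ := exists_cutoff_closure hb
  have key : ∀ᵐ y ∂arcLength U, χ y ≠ 0 → IsOuterNormal U y (outerNormal U y) := by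
    refine localization (p := fun χ => ∀ᵐ y ∂arcLength U, χ y ≠ 0 →
      IsOuterNormal U y (outerNormal U y)) (by simp) (fun f g hf hg => ?_) (fun x => ?_) hχ hc
    · filter_upwards [hf, hg] with y h1 h2 h3
      by_cases h : f y = 0
      · exact h2 fun h' => h3 (by simp [h, h'])
      · exact h1 h
    · obtain ⟨S, W, hS, hWo, hx, hUS⟩ := hL.exists_agree x
      refine ⟨W, hWo.mem_nhds hx, fun χ hχ hc hs => ?_⟩
      have h2 : ∀ᵐ y ∂(arcLength U).restrict W, IsOuterNormal S y (outerNormal S y) := by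
        rw [arcLength_restrict_of_agree hWo hUS]
        exact ae_restrict_of_ae hS.isOuterNormal
      rw [ae_restrict_iff' hWo.measurableSet] at h2
      filter_upwards [h2] with y hy hne
      have hyW : y ∈ W := hs (subset_tsupport _ hne)
      rw [outerNormal_of_agree hWo hUS hyW]
      exact (hy hyW).congr ((eventually_mem_iff_of_agree hWo hUS hyW).mono fun _ h => h.symm)
  filter_upwards [key, ae_mem_frontier U] with y hy hy'
  exact hy (by rw [h1.self_of_nhdsSet y (frontier_subset_closure hy')]; exact one_ne_zero)

theorem aestronglyMeasurable_outerNormal (hb : Bornology.IsBounded U)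
    (hL : HasLipschitzBoundary U) : AEStronglyMeasurable (outerNormal U) (arcLength U) := by
  obtain ⟨χ, hχ, hc, h1⟩ := exists_cutoff_closure hb
  have key : AEStronglyMeasurable (fun y => χ y • outerNormal U y) (arcLength U) := by
    refine localization (p := fun χ => AEStronglyMeasurable (fun y => χ y • outerNormal U y)
      (arcLength U)) (by simpa using aestronglyMeasurable_const) (fun f g hf hg => ?_)
      (fun x => ?_) hχ hc
    · refine (hf.add hg).congr (ae_of_all _ fun y => ?_)
      simp [add_smul]
    · obtain ⟨S, W, hS, hWo, hx, hUS⟩ := hL.exists_agree x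
      refine ⟨W, hWo.mem_nhds hx, fun χ hχ hc hs => ?_⟩
      refine aestronglyMeasurable_of_restrict hWo
        ((tsupport_smul_subset_left χ (outerNormal U)).trans hs) ?_
      have h2 : AEStronglyMeasurable (fun y => χ y • outerNormal S y)
          ((arcLength S).restrict W) :=
        (hχ.continuous.aestronglyMeasurable.smul hS.measurable_normal).restrict
      rw [arcLength_restrict_of_agree hWo hUS]
      refine h2.congr ?_
      filter_upwards [ae_restrict_mem hWo.measurableSet] with y hy
      rw [outerNormal_of_agree hWo hUS hy]
  refine key.congr ?_
  filter_upwards [ae_mem_frontier U] with y hy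
  rw [h1.self_of_nhdsSet y (frontier_subset_closure hy), one_smul]

lemma integrable_arcLength_of_continuousOn (hb : Bornology.IsBounded U)
    (hL : HasLipschitzBoundary U) {f : Plane → ℝ} (hf : ContinuousOn f (frontier U)) :
    Integrable f (arcLength U) := by
  have := isFiniteMeasure_arcLength hb hL
  have h1 : IntegrableOn f (frontier U) (arcLength U) :=
    hf.integrableOn_compact (isCompact_frontier hb)
  rwa [IntegrableOn, arcLength, Measure.restrict_restrict isClosed_frontier.measurableSet,
    Set.inter_self] at h1

lemma integrable_mul_inner_outerNormal (hb : Bornology.IsBounded U) (hL : HasLipschitzBoundary U)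
    {f : Plane → ℝ} (hf : Integrable f (arcLength U)) (e : Plane) :
    Integrable (fun y => f y * inner ℝ (outerNormal U y) e) (arcLength U) := by
  refine hf.mul_bdd (c := ‖e‖) ?_ ?_
  · exact (aestronglyMeasurable_outerNormal hb hL).inner aestronglyMeasurable_const
  · refine ae_of_all _ fun y => (norm_inner_le_norm _ _).trans ?_
    exact mul_le_of_le_one_left (norm_nonneg e) (norm_outerNormal_le U y)

lemma integrableOn_fderiv (hb : Bornology.IsBounded U) {ψ : Plane → ℝ} (hψ : ContDiff ℝ 1 ψ)
    (e : Plane) : IntegrableOn (fun y => fderiv ℝ ψ y e) U := by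
  have h1 : Continuous fun y => fderiv ℝ ψ y e :=
    (hψ.continuous_fderiv one_ne_zero).clm_apply continuous_const
  exact (h1.continuousOn.integrableOn_compact hb.isCompact_closure).mono_set subset_closure

theorem divergence (hb : Bornology.IsBounded U) (hL : HasLipschitzBoundary U)
    {φ : Plane → ℝ} (hφ : ContDiff ℝ 1 φ) (e : Plane) :
    ∫ y in U, fderiv ℝ φ y e = ∫ y, φ y * inner ℝ (outerNormal U y) e ∂arcLength U := by
  obtain ⟨χ, hχ, hc, h1⟩ := exists_cutoff_closure hb
  have key : ContDiff ℝ 1 χ ∧ ∫ y in U, fderiv ℝ (fun y => χ y * φ y) y e =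
      ∫ y, χ y * φ y * inner ℝ (outerNormal U y) e ∂arcLength U := by
    refine localization (p := fun χ => ContDiff ℝ 1 χ ∧
      ∫ y in U, fderiv ℝ (fun y => χ y * φ y) y e =
      ∫ y, χ y * φ y * inner ℝ (outerNormal U y) e ∂arcLength U)
      ⟨contDiff_const, by simp⟩ ?_ (fun x => ?_) hχ hc
    · rintro f g ⟨hf, hf'⟩ ⟨hg, hg'⟩
      refine ⟨hf.add hg, ?_⟩
      have e1 : ∀ y, fderiv ℝ (fun y => (f + g) y * φ y) y e =
          fderiv ℝ (fun y => f y * φ y) y e + fderiv ℝ (fun y => g y * φ y) y e := by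
        intro y
        have : (fun y => (f + g) y * φ y) = (fun y => f y * φ y) + (fun y => g y * φ y) := by
          ext y; simp [add_mul]
        rw [this, fderiv_add ((hf.mul hφ).differentiable one_ne_zero y)
          ((hg.mul hφ).differentiable one_ne_zero y)]
        rfl
      have e2 : ∀ y, (f + g) y * φ y * inner ℝ (outerNormal U y) e =
          f y * φ y * inner ℝ (outerNormal U y) e + g y * φ y * inner ℝ (outerNormal U y) e := by
        intro y; simp only [Pi.add_apply]; ring
      simp only [e1, e2]
      rw [integral_add (integrableOn_fderiv hb (hf.mul hφ) e)
        (integrableOn_fderiv hb (hg.mul hφ) e), integral_add, hf', hg']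
      · exact integrable_mul_inner_outerNormal hb hL (integrable_arcLength_of_continuousOn hb hL
          (hf.mul hφ).continuous.continuousOn) e
      · exact integrable_mul_inner_outerNormal hb hL (integrable_arcLength_of_continuousOn hb hL
          (hg.mul hφ).continuous.continuousOn) e
    · obtain ⟨S, W, hS, hWo, hx, hUS⟩ := hL.exists_agree x
      refine ⟨W, hWo.mem_nhds hx, fun χ hχ hc hs => ?_⟩
      have hχ1 : ContDiff ℝ 1 χ := hχ.of_le (by exact_mod_cast le_top)
      refine ⟨hχ1, ?_⟩
      have hts : tsupport (fun y => χ y * φ y) ⊆ W := tsupport_mul_subset_left.trans hs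
      have hd := hS.divergence (fun y => χ y * φ y) (hχ1.mul hφ) hc.mul_right e
      have hts1 : tsupport (fun y => fderiv ℝ (fun y => χ y * φ y) y e) ⊆ W :=
        (tsupport_fderiv_apply_subset ℝ e).trans hts
      have hts2 : ∀ S, tsupport (fun y => χ y * φ y * inner ℝ (outerNormal S y) e) ⊆ W := fun S =>
        (tsupport_mul_subset_left (f := fun y => χ y * φ y)).trans hts
      -- All integrands are supported in `W`, where `U` and its model agree.
      rw [← integral_restrict_eq hts1, ← integral_restrict_eq (hts2 U),
        volume_restrict_of_agree hWo hUS, arcLength_restrict_of_agree hWo hUS,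
        integral_restrict_eq hts1, hd, ← integral_restrict_eq (hts2 S)]
      refine integral_congr_ae ?_
      filter_upwards [ae_restrict_mem hWo.measurableSet] with y hy
      rw [outerNormal_of_agree hWo hUS hy]
  have h2 : ∫ y in U, fderiv ℝ (fun y => χ y * φ y) y e = ∫ y in U, fderiv ℝ φ y e := by
    have hae : ∀ᵐ y ∂(volume.restrict U), y ∈ closure U := by
      have : ∀ᵐ y ∂(volume.restrict (closure U)), y ∈ closure U :=
        ae_restrict_mem isClosed_closure.measurableSet
      exact ae_mono (Measure.restrict_mono_set _ subset_closure) this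
    refine integral_congr_ae ?_
    filter_upwards [hae] with y hy
    have : (fun y => χ y * φ y) =ᶠ[𝓝 y] φ := by
      filter_upwards [eventually_nhdsSet_iff_forall.1 h1 y hy] with z hz
      rw [hz, one_mul]
    rw [this.fderiv_eq]
  rw [← h2, key.2]
  refine integral_congr_ae ?_
  filter_upwards [ae_mem_frontier U] with y hy
  rw [h1.self_of_nhdsSet y (frontier_subset_closure hy), one_mul]

end Lipschitz

/-! ### The inner product of covectors -/

/-- The inner product of two covectors. -/
def pair : (Plane →L[ℝ] ℝ) →L[ℝ] (Plane →L[ℝ] ℝ) →L[ℝ] ℝ :=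
  LinearMap.mkContinuous₂
    (LinearMap.mk₂ ℝ (fun ℓ m => ℓ ((InnerProductSpace.toDual ℝ Plane).symm m))
      (fun _ _ _ => by simp) (fun _ _ _ => by simp) (fun _ _ _ => by simp) (fun _ _ _ => by simp))
    1 (fun ℓ m => by
      simp only [LinearMap.mk₂_apply, one_mul]
      refine (ℓ.le_opNorm _).trans ?_
      rw [LinearIsometryEquiv.norm_map])

lemma pair_apply (ℓ m : Plane →L[ℝ] ℝ) :
    pair ℓ m = ℓ ((InnerProductSpace.toDual ℝ Plane).symm m) := rfl

lemma pair_eq_inner (ℓ m : Plane →L[ℝ] ℝ) : pair ℓ m =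
    inner ℝ ((InnerProductSpace.toDual ℝ Plane).symm ℓ)
      ((InnerProductSpace.toDual ℝ Plane).symm m) := by
  rw [InnerProductSpace.toDual_symm_apply, pair_apply]

lemma pair_comm (ℓ m : Plane →L[ℝ] ℝ) : pair ℓ m = pair m ℓ := by
  rw [pair_eq_inner, pair_eq_inner, real_inner_comm]

lemma pair_self (ℓ : Plane →L[ℝ] ℝ) : pair ℓ ℓ = ‖ℓ‖ ^ 2 := by
  rw [pair_eq_inner, real_inner_self_eq_norm_sq, LinearIsometryEquiv.norm_map]

lemma abs_pair_le (ℓ m : Plane →L[ℝ] ℝ) : |pair ℓ m| ≤ ‖ℓ‖ * ‖m‖ := by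
  rw [pair_eq_inner]
  refine (abs_real_inner_le_norm _ _).trans_eq ?_
  rw [LinearIsometryEquiv.norm_map, LinearIsometryEquiv.norm_map]

/-- The standard basis. -/
def stdBasis : OrthonormalBasis (Fin 2) ℝ Plane := EuclideanSpace.basisFun (Fin 2) ℝ

lemma pair_eq_sum (ℓ m : Plane →L[ℝ] ℝ) : pair ℓ m = ∑ i, ℓ (stdBasis i) * m (stdBasis i) := by
  rw [pair_apply]
  conv_lhs => rw [← stdBasis.sum_repr' ((InnerProductSpace.toDual ℝ Plane).symm m)]
  rw [map_sum]
  refine Finset.sum_congr rfl fun i _ => ?_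
  rw [map_smul, real_inner_comm, InnerProductSpace.toDual_symm_apply, smul_eq_mul, mul_comm]

lemma apply_eq_sum (ℓ : Plane →L[ℝ] ℝ) (n : Plane) :
    ℓ n = ∑ i, ℓ (stdBasis i) * inner ℝ n (stdBasis i) := by
  conv_lhs => rw [← stdBasis.sum_repr' n]
  rw [map_sum]
  refine Finset.sum_congr rfl fun i _ => ?_
  rw [map_smul, real_inner_comm, smul_eq_mul, mul_comm]

/-! ### Continuity of bilinear pairings in `L²` -/

section Bilinear

variable {α E F : Type*} [MeasurableSpace α] {μ : Measure α} [NormedAddCommGroup E]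
  [NormedSpace ℝ E] [NormedAddCommGroup F] [NormedSpace ℝ F]

lemma eLpNorm_bilin_le (B : E →L[ℝ] F →L[ℝ] ℝ) {f : α → E} {g : α → F}
    (hf : AEStronglyMeasurable f μ) (hg : AEStronglyMeasurable g μ) :
    eLpNorm (fun x => B (f x) (g x)) 1 μ ≤ ‖B‖₊ * eLpNorm f 2 μ * eLpNorm g 2 μ :=
  eLpNorm_le_eLpNorm_mul_eLpNorm'_of_norm hf hg (fun a b => B a b) ‖B‖₊
    (ae_of_all _ fun x => B.le_opNorm₂ (f x) (g x))

lemma integrable_bilin (B : E →L[ℝ] F →L[ℝ] ℝ) {f : α → E} {g : α → F}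
    (hf : MemLp f 2 μ) (hg : MemLp g 2 μ) : Integrable (fun x => B (f x) (g x)) μ := by
  rw [← memLp_one_iff_integrable]
  refine ⟨B.aestronglyMeasurable_comp₂ hf.1 hg.1, (eLpNorm_bilin_le B hf.1 hg.1).trans_lt ?_⟩
  exact ENNReal.mul_lt_top (ENNReal.mul_lt_top ENNReal.coe_lt_top hf.2) hg.2

/-- Used for every passage from smooth test functions to H¹ test functions, and from smooth
functions to their traces. -/
lemma tendsto_integral_bilin (B : E →L[ℝ] F →L[ℝ] ℝ) {f : α → E} {g : ℕ → α → F} {g' : α → F}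
    (hf : MemLp f 2 μ) (hg : ∀ n, MemLp (g n) 2 μ) (hg' : MemLp g' 2 μ)
    (h : Tendsto (fun n => eLpNorm (g n - g') 2 μ) atTop (𝓝 0)) :
    Tendsto (fun n => ∫ x, B (f x) (g n x) ∂μ) atTop (𝓝 (∫ x, B (f x) (g' x) ∂μ)) := by
  refine tendsto_integral_of_L1' _ (integrable_bilin B hf hg').1
    (Eventually.of_forall fun n => integrable_bilin B hf (hg n)) ?_
  have hle : ∀ n, eLpNorm ((fun x => B (f x) (g n x)) - fun x => B (f x) (g' x)) 1 μ ≤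
      ‖B‖₊ * eLpNorm f 2 μ * eLpNorm (g n - g') 2 μ := by
    intro n
    have : ((fun x => B (f x) (g n x)) - fun x => B (f x) (g' x)) =
        fun x => B (f x) ((g n - g') x) := by ext x; simp
    rw [this]
    exact eLpNorm_bilin_le B hf.1 ((hg n).1.sub hg'.1)
  refine tendsto_of_tendsto_of_tendsto_of_le_of_le tendsto_const_nhds ?_ (fun _ => zero_le) hle
  have := ENNReal.Tendsto.const_mul (a := (‖B‖₊ * eLpNorm f 2 μ : ENNReal)) h
    (Or.inr (ENNReal.mul_ne_top ENNReal.coe_ne_top hf.2.ne))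
  simpa using this

end Bilinear

/-! ### Green's formula and the trace inequality -/

section Green

variable {U : Set Plane}

lemma ae_mem_closure (U : Set Plane) : ∀ᵐ y ∂(volume.restrict U), y ∈ closure U :=
  ae_mono (Measure.restrict_mono_set _ subset_closure)
    (ae_restrict_mem isClosed_closure.measurableSet)

lemma memLp_of_continuous {F : Type*} [NormedAddCommGroup F] (hb : Bornology.IsBounded U)
    {f : Plane → F} (hf : Continuous f) (p : ENNReal) : MemLp f p (volume.restrict U) := by
  have : IsFiniteMeasure (volume.restrict U) := ⟨by simpa using hb.measure_lt_top⟩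
  obtain ⟨C, hC⟩ := hb.isCompact_closure.exists_bound_of_continuousOn hf.continuousOn
  refine MemLp.of_bound hf.aestronglyMeasurable C ?_
  filter_upwards [ae_mem_closure U] with y hy using hC y hy

lemma memLp_arcLength_of_continuous {F : Type*} [NormedAddCommGroup F]
    (hb : Bornology.IsBounded U) (hL : HasLipschitzBoundary U) {f : Plane → F} (hf : Continuous f)
    (p : ENNReal) : MemLp f p (arcLength U) := by
  have := isFiniteMeasure_arcLength hb hL
  obtain ⟨C, hC⟩ := (isCompact_frontier hb).exists_bound_of_continuousOn hf.continuousOn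
  refine MemLp.of_bound hf.aestronglyMeasurable C ?_
  filter_upwards [ae_mem_frontier U] with y hy using hC y hy

lemma laplacian_eq_sum {v : Plane → ℝ} (hv : ContDiff ℝ 2 v) (y : Plane) :
    Laplacian.laplacian v y =
      ∑ i, fderiv ℝ (fun z => fderiv ℝ v z (stdBasis i)) y (stdBasis i) := by
  rw [InnerProductSpace.laplacian_eq_iteratedFDeriv_orthonormalBasis v stdBasis]
  simp only [iteratedFDeriv_two_apply]
  refine Finset.sum_congr rfl fun i _ => ?_
  have h1 : DifferentiableAt ℝ (fderiv ℝ v) y :=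
    (hv.fderiv_right (m := 1) (by norm_num)).differentiable one_ne_zero y
  rw [fderiv_clm_apply h1 (differentiableAt_const _)]
  simp

/-- The divergence theorem for φ ∂ᵢv in the direction of the i-th basis vector, summed over i. -/
theorem green (hb : Bornology.IsBounded U) (hL : HasLipschitzBoundary U)
    {φ v : Plane → ℝ} (hφ : ContDiff ℝ 1 φ) (hv : ContDiff ℝ 2 v) :
    (∫ y in U, pair (fderiv ℝ v y) (fderiv ℝ φ y)) + ∫ y in U, φ y * Laplacian.laplacian v y =
      ∫ y, φ y * fderiv ℝ v y (outerNormal U y) ∂arcLength U := by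
  have hvi : ∀ i, ContDiff ℝ 1 (fun z => fderiv ℝ v z (stdBasis i)) := fun i =>
    (hv.fderiv_right (m := 1) (by norm_num)).clm_apply contDiff_const
  have hdiv := fun i => divergence hb hL (hφ.mul (hvi i)) (stdBasis i)
  have hint := fun i => integrableOn_fderiv hb (hφ.mul (hvi i)) (stdBasis i)
  have hint2 := fun i => integrable_mul_inner_outerNormal hb hL
    (integrable_arcLength_of_continuousOn hb hL (hφ.mul (hvi i)).continuous.continuousOn)
    (stdBasis i)
  have hsum := Finset.sum_congr (rfl : (Finset.univ : Finset (Fin 2)) = Finset.univ)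
    fun i _ => hdiv i
  rw [← integral_finsetSum _ fun i _ => hint i, ← integral_finsetSum _ fun i _ => hint2 i] at hsum
  have hφ' : Continuous (fderiv ℝ φ) := hφ.continuous_fderiv one_ne_zero
  have hv' : Continuous (fderiv ℝ v) := hv.continuous_fderiv two_ne_zero
  have hlap : Continuous (fun y => Laplacian.laplacian v y) := by
    simp only [laplacian_eq_sum hv]
    exact continuous_finsetSum _ fun i _ =>
      ((hvi i).continuous_fderiv one_ne_zero).clm_apply continuous_const
  rw [← integral_add]
  · calc _ = ∫ y in U, ∑ i, fderiv ℝ (fun y => φ y * fderiv ℝ v y (stdBasis i)) y (stdBasis i) := by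
          refine integral_congr_ae (ae_of_all _ fun y => ?_)
          simp only
          rw [pair_eq_sum, laplacian_eq_sum hv, Finset.mul_sum, ← Finset.sum_add_distrib]
          refine Finset.sum_congr rfl fun i _ => ?_
          rw [fderiv_fun_mul (hφ.differentiable one_ne_zero y)
            ((hvi i).differentiable one_ne_zero y)]
          simp only [add_apply, smul_apply, smul_eq_mul]
          ring
      _ = _ := hsum
      _ = _ := by
          refine integral_congr_ae (ae_of_all _ fun y => ?_)
          simp only
          rw [apply_eq_sum (fderiv ℝ v y), Finset.mul_sum]
          refine Finset.sum_congr rfl fun i _ => ?_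
          ring
  · exact memLp_one_iff_integrable.1 (memLp_of_continuous hb (by fun_prop) 1)
  · exact memLp_one_iff_integrable.1 (memLp_of_continuous hb (hφ.continuous.mul hlap) 1)

lemma integrable_sq_add_sq (hb : Bornology.IsBounded U) {φ : Plane → ℝ} (hφ : ContDiff ℝ 1 φ) :
    IntegrableOn (fun y => φ y ^ 2 + ‖fderiv ℝ φ y‖ ^ 2) U := by
  have h1 := hφ.continuous
  have h2 := hφ.continuous_fderiv one_ne_zero
  exact memLp_one_iff_integrable.1 (memLp_of_continuous hb (by fun_prop) 1)

/-- Near a boundary point some fixed vector e satisfies ⟪ν, e⟫ ≥ r > 0. The divergence theorem for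
(χφ)² in the direction e then bounds the boundary integral by an interior integral of φ² and |φ|
|∇φ|. -/
theorem exists_trace_bound (hb : Bornology.IsBounded U) (hL : HasLipschitzBoundary U) :
    ∃ C : ℝ, 0 ≤ C ∧ ∀ φ : Plane → ℝ, ContDiff ℝ 1 φ →
      ∫ y, φ y ^ 2 ∂arcLength U ≤ C * ∫ y in U, (φ y ^ 2 + ‖fderiv ℝ φ y‖ ^ 2) := by
  obtain ⟨χ, hχ, hc, h1⟩ := exists_cutoff_closure hb
  have key : Continuous χ ∧ ∃ C : ℝ, 0 ≤ C ∧ ∀ φ : Plane → ℝ, ContDiff ℝ 1 φ →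
      ∫ y, (χ y * φ y) ^ 2 ∂arcLength U ≤ C * ∫ y in U, (φ y ^ 2 + ‖fderiv ℝ φ y‖ ^ 2) := by
    refine localization (p := fun χ => Continuous χ ∧ ∃ C : ℝ, 0 ≤ C ∧ ∀ φ : Plane → ℝ,
      ContDiff ℝ 1 φ → ∫ y, (χ y * φ y) ^ 2 ∂arcLength U ≤
        C * ∫ y in U, (φ y ^ 2 + ‖fderiv ℝ φ y‖ ^ 2))
      ⟨continuous_const, 0, le_rfl, by simp⟩ ?_ (fun x => ?_) hχ hc
    · rintro f g ⟨hfc, Cf, hCf, hf⟩ ⟨hgc, Cg, hCg, hg⟩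
      -- The constant comes from (a + b)² ≤ 2a² + 2b².
      refine ⟨hfc.add hgc, 2 * Cf + 2 * Cg, by positivity, fun φ hφ => ?_⟩
      have hφc := hφ.continuous
      have i1 : Integrable (fun y => (f y * φ y) ^ 2) (arcLength U) :=
        integrable_arcLength_of_continuousOn hb hL (by fun_prop)
      have i2 : Integrable (fun y => (g y * φ y) ^ 2) (arcLength U) :=
        integrable_arcLength_of_continuousOn hb hL (by fun_prop)
      have i3 : Integrable (fun y => ((f + g) y * φ y) ^ 2) (arcLength U) :=
        integrable_arcLength_of_continuousOn hb hL (by fun_prop)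
      have h2 : ∫ y, ((f + g) y * φ y) ^ 2 ∂arcLength U ≤
          ∫ y, (2 * (f y * φ y) ^ 2 + 2 * (g y * φ y) ^ 2) ∂arcLength U := by
        refine integral_mono i3 ((i1.const_mul 2).add (i2.const_mul 2)) fun y => ?_
        simp only [Pi.add_apply]
        nlinarith [sq_nonneg (f y * φ y - g y * φ y)]
      rw [integral_add (i1.const_mul 2) (i2.const_mul 2), integral_const_mul,
        integral_const_mul] at h2
      have := hf φ hφ
      have := hg φ hφ
      linarith
    · obtain ⟨S, W, hS, hWo, hx, hUS⟩ := hL.exists_agree x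
      refine ⟨W, hWo.mem_nhds hx, fun χ hχ hc hs => ⟨hχ.continuous, ?_⟩⟩
      have hχ1 : ContDiff ℝ 1 χ := hχ.of_le (by exact_mod_cast le_top)
      obtain ⟨e, r, hr, hn⟩ := hS.transversal
      have hn' : ∀ᵐ y ∂arcLength U, y ∈ W → r ≤ inner ℝ (outerNormal U y) e := by
        rw [← ae_restrict_iff' hWo.measurableSet]
        have h2 := ae_restrict_of_ae (s := W) hn
        rw [← arcLength_restrict_of_agree hWo hUS] at h2
        filter_upwards [h2, ae_restrict_mem hWo.measurableSet] with y hy hyW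
        rwa [outerNormal_of_agree hWo hUS hyW]
      obtain ⟨M1, hM1⟩ := hc.exists_bound_of_continuous hχ.continuous
      obtain ⟨M2, hM2⟩ := (hc.fderiv (𝕜 := ℝ)).exists_bound_of_continuous
        (hχ1.continuous_fderiv one_ne_zero)
      set M := max M1 M2
      have hM0 : 0 ≤ M := (norm_nonneg _).trans ((hM1 0).trans (le_max_left _ _))
      -- `M` bounds both `χ` and its derivative; r⁻¹ comes from transversality.
      refine ⟨r⁻¹ * (4 * M ^ 2 * ‖e‖), by positivity, fun φ hφ => ?_⟩
      have hφc := hφ.continuous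
      have hχc := hχ.continuous
      have i1 : Integrable (fun y => (χ y * φ y) ^ 2) (arcLength U) :=
        integrable_arcLength_of_continuousOn hb hL (by fun_prop)
      have hdiv := divergence hb hL ((hχ1.mul hφ).pow 2) e
      have h3 : r * ∫ y, (χ y * φ y) ^ 2 ∂arcLength U ≤
          ∫ y, (χ y * φ y) ^ 2 * inner ℝ (outerNormal U y) e ∂arcLength U := by
        rw [← integral_const_mul]
        refine integral_mono_ae (i1.const_mul r) (integrable_mul_inner_outerNormal hb hL i1 e) ?_
        filter_upwards [hn'] with y hy
        by_cases h0 : χ y = 0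
        · simp [h0]
        · have := hy (hs (subset_tsupport _ h0))
          rw [mul_comm]
          exact mul_le_mul_of_nonneg_left this (sq_nonneg _)
      have h4 : ∫ y in U, fderiv ℝ (fun y => (χ y * φ y) ^ 2) y e ≤
          4 * M ^ 2 * ‖e‖ * ∫ y in U, (φ y ^ 2 + ‖fderiv ℝ φ y‖ ^ 2) := by
        rw [← integral_const_mul]
        refine integral_mono (integrableOn_fderiv hb ((hχ1.mul hφ).pow 2) e)
          ((integrable_sq_add_sq hb hφ).const_mul _) fun y => ?_
        simp only
        have hd := ((hχ1.differentiable one_ne_zero y).hasFDerivAt.mul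
          (hφ.differentiable one_ne_zero y).hasFDerivAt).pow 2
        have hd' : fderiv ℝ (fun y => (χ y * φ y) ^ 2) y e =
            2 * (χ y * φ y) * (χ y * fderiv ℝ φ y e + φ y * fderiv ℝ χ y e) := by
          have := hd.fderiv
          rw [show (fun y => (χ y * φ y) ^ 2) = fun y => (χ * φ) y ^ 2 from rfl, this]
          simp
          ring
        rw [hd']
        have b1 : |χ y| ≤ M := (hM1 y).trans (le_max_left _ _)
        have b2 : |fderiv ℝ χ y e| ≤ M * ‖e‖ := ((fderiv ℝ χ y).le_opNorm e).trans
          (by gcongr; exact (hM2 y).trans (le_max_right _ _))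
        have b3 : |fderiv ℝ φ y e| ≤ ‖fderiv ℝ φ y‖ * ‖e‖ := (fderiv ℝ φ y).le_opNorm e
        calc 2 * (χ y * φ y) * (χ y * fderiv ℝ φ y e + φ y * fderiv ℝ χ y e)
            ≤ |2 * (χ y * φ y) * (χ y * fderiv ℝ φ y e + φ y * fderiv ℝ χ y e)| := le_abs_self _
          _ ≤ 2 * (|χ y| * |φ y|) * (|χ y| * |fderiv ℝ φ y e| + |φ y| * |fderiv ℝ χ y e|) := by
              rw [abs_mul, abs_mul, abs_mul, abs_two]
              gcongr
              refine (abs_add_le _ _).trans ?_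
              rw [abs_mul, abs_mul]
          _ ≤ 2 * (M * |φ y|) * (M * (‖fderiv ℝ φ y‖ * ‖e‖) + |φ y| * (M * ‖e‖)) := by gcongr
          _ = 2 * M ^ 2 * ‖e‖ * (|φ y| * ‖fderiv ℝ φ y‖ + |φ y| ^ 2) := by ring
          _ ≤ 2 * M ^ 2 * ‖e‖ * (2 * (φ y ^ 2 + ‖fderiv ℝ φ y‖ ^ 2)) := by
              gcongr
              rw [← sq_abs (φ y)]
              nlinarith [sq_nonneg (|φ y| - ‖fderiv ℝ φ y‖), sq_nonneg (‖fderiv ℝ φ y‖),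
                sq_nonneg (|φ y|)]
          _ = _ := by ring
      rw [← hdiv] at h3
      rw [mul_assoc, ← div_eq_inv_mul, le_div_iff₀' hr]
      exact h3.trans h4
  obtain ⟨-, C, hC, h2⟩ := key
  refine ⟨C, hC, fun φ hφ => ?_⟩
  rw [← show ∫ y, (χ y * φ y) ^ 2 ∂arcLength U = ∫ y, φ y ^ 2 ∂arcLength U from ?_]
  · exact h2 φ hφ
  · refine integral_congr_ae ?_
    filter_upwards [ae_mem_frontier U] with y hy
    rw [h1.self_of_nhdsSet y (frontier_subset_closure hy), one_mul]

end Green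

/-! ### Mollification in `L²` -/

section Mollify

variable {F : Type*} [NormedAddCommGroup F] [NormedSpace ℝ F]

lemma eLpNorm_two_sq {α : Type*} [MeasurableSpace α] {μ : Measure α} {E : Type*} [ENorm E]
    (f : α → E) : eLpNorm f 2 μ ^ 2 = ∫⁻ x, ‖f x‖ₑ ^ 2 ∂μ := by
  have := eLpNorm_nnreal_pow_eq_lintegral (f := f) (μ := μ) (p := 2) two_ne_zero
  norm_num at this
  exact this

/-- Jensen's inequality for the square and a weight of total mass one. -/
lemma sq_lintegral_mul_le {α : Type*} [MeasurableSpace α] {μ : Measure α} {w g : α → ENNReal}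
    (hw : Measurable w) (hg : Measurable g) (h1 : ∫⁻ x, w x ∂μ = 1) :
    (∫⁻ x, w x * g x ∂μ) ^ 2 ≤ ∫⁻ x, w x * g x ^ 2 ∂μ := by
  have hP : IsProbabilityMeasure (μ.withDensity w) := ⟨by simpa using h1⟩
  have e1 : ∫⁻ x, w x * g x ∂μ = eLpNorm g 1 (μ.withDensity w) := by
    rw [eLpNorm_one_eq_lintegral_enorm, lintegral_withDensity_eq_lintegral_mul _ hw (by simpa using hg)]
    simp
  have e2 : ∫⁻ x, w x * g x ^ 2 ∂μ = eLpNorm g 2 (μ.withDensity w) ^ 2 := by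
    rw [eLpNorm_two_sq, lintegral_withDensity_eq_lintegral_mul _ hw (by simpa using hg.pow_const 2)]
    simp
  rw [e1, e2]
  gcongr
  exact eLpNorm_le_eLpNorm_of_exponent_le (by norm_num) hg.aestronglyMeasurable

/-- Continuity of translation in L², read off from continuity of composition with measure preserving
maps. -/
lemma exists_eLpNorm_translate_le {F : Type*} [NormedAddCommGroup F] {f : Plane → F} (hf : MemLp f 2 volume) {ε : ENNReal}
    (hε : 0 < ε) : ∃ δ > 0, ∀ z : Plane, ‖z‖ < δ →
      eLpNorm ((fun x => f (x - z)) - f) 2 volume ≤ ε := by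
  let g : Plane → C(Plane, Plane) := fun z => ⟨fun x => x - z, by fun_prop⟩
  have hg : Continuous g := by
    refine ContinuousMap.continuous_of_continuous_uncurry _ ?_
    show Continuous fun p : Plane × Plane => p.2 - p.1
    fun_prop
  have hgm : ∀ z, MeasurePreserving (g z) (volume : Measure Plane) volume := fun z =>
    measurePreserving_sub_right volume z
  have hc := (continuous_const (y := hf.toLp)).compMeasurePreservingLp hg hgm (by norm_num)
  have ht := (hc.tendsto 0).eventually (Metric.eball_mem_nhds _ hε)
  obtain ⟨δ, hδ, hball⟩ := Metric.eventually_nhds_iff.1 ht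
  refine ⟨δ, hδ, fun z hz => ?_⟩
  have h1 := hball (by rwa [dist_zero_right] : dist z 0 < δ)
  rw [Lp.toLp_compMeasurePreserving, Lp.toLp_compMeasurePreserving,
    Lp.edist_toLp_toLp] at h1
  have e : f ∘ (g 0) = f := by ext x; simp [g]
  rw [e] at h1
  exact h1.le

/-- The convolution of a scalar kernel with a function. -/
def mollify (ρ : Plane → ℝ) (f : Plane → F) : Plane → F :=
  convolution ρ f (ContinuousLinearMap.lsmul ℝ ℝ) volume

lemma mollify_apply (ρ : Plane → ℝ) (f : Plane → F) (x : Plane) :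
    mollify ρ f x = ∫ t, ρ t • f (x - t) := by
  simp [mollify, convolution_def]

/-- A probability density supported in the ball of radius `δ` about the origin. -/
structure IsKernel (ρ : Plane → ℝ) (δ : ℝ) : Prop where
  smooth : ContDiff ℝ (⊤ : ℕ∞) ρ
  compact : HasCompactSupport ρ
  nonneg : ∀ x, 0 ≤ ρ x
  integral : ∫ x, ρ x = 1
  support : tsupport ρ ⊆ Metric.ball 0 δ

/-- The error is a ρ-average of translation errors. Jensen's inequality moves the square inside the
average and Tonelli exchanges the integrals. -/
lemma IsKernel.eLpNorm_mollify_sub_le [CompleteSpace F] {f : Plane → F} (hf : MemLp f 2 volume)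
    {ρ : Plane → ℝ} {δ : ℝ} (hρ : IsKernel ρ δ) {ε : ENNReal}
    (hε : ∀ z : Plane, ‖z‖ < δ → eLpNorm ((fun x => f (x - z)) - f) 2 volume ≤ ε) :
    eLpNorm (mollify ρ f - f) 2 volume ≤ ε := by
  -- Tonelli requires joint measurability; changing `f` on a null set alters neither the
  -- mollification nor the translation norms.
  wlog hm : StronglyMeasurable f generalizing f
  · obtain ⟨f', hf', hff'⟩ := hf.1
    have htr : ∀ z : Plane, (fun x => f (x - z)) =ᵐ[volume] fun x => f' (x - z) := fun z =>
      (measurePreserving_sub_right volume z).quasiMeasurePreserving.ae_eq_comp hff'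
    have := this (hf.ae_eq hff') (fun z hz => ?_) hf'
    · refine le_of_eq_of_le (eLpNorm_congr_ae ?_) this
      refine EventuallyEq.sub (ae_of_all _ fun x => ?_) hff'
      rw [mollify_apply, mollify_apply]
      refine integral_congr_ae ?_
      filter_upwards [(Measure.measurePreserving_sub_left volume
        x).quasiMeasurePreserving.ae_eq_comp hff'] with t ht
      simp only [Function.comp] at ht
      rw [ht]
    · refine le_of_eq_of_le (eLpNorm_congr_ae ?_) (hε z hz)
      exact ((htr z).sub hff').symm
  have hρm : Measurable fun t => ENNReal.ofReal (ρ t) :=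
    hρ.smooth.continuous.measurable.ennreal_ofReal
  have hρ1 : ∫⁻ t, ENNReal.ofReal (ρ t) = 1 := by
    rw [← ofReal_integral_eq_lintegral_ofReal
      (hρ.smooth.continuous.integrable_of_hasCompactSupport hρ.compact)
      (ae_of_all _ hρ.nonneg), hρ.integral, ENNReal.ofReal_one]
  have hloc : LocallyIntegrable f volume := hf.locallyIntegrable (by norm_num)
  have hpt : ∀ x, ‖(mollify ρ f - f) x‖ₑ ≤ ∫⁻ t, ENNReal.ofReal (ρ t) * ‖f (x - t) - f x‖ₑ := by
    intro x
    have i1 : Integrable (fun t => ρ t • f (x - t)) := by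
      have := hρ.compact.convolutionExists_left (ContinuousLinearMap.lsmul ℝ ℝ)
        hρ.smooth.continuous hloc x
      simpa [ConvolutionExistsAt] using this
    have i2 : Integrable (fun t => ρ t • f x) :=
      (hρ.smooth.continuous.integrable_of_hasCompactSupport hρ.compact).smul_const _
    have : (mollify ρ f - f) x = ∫ t, ρ t • (f (x - t) - f x) := by
      simp only [smul_sub]
      rw [integral_sub i1 i2, integral_smul_const, hρ.integral, one_smul, Pi.sub_apply,
        mollify_apply]
    rw [this]
    refine (enorm_integral_le_lintegral_enorm _).trans_eq (lintegral_congr fun t => ?_)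
    rw [enorm_smul, Real.enorm_eq_ofReal (hρ.nonneg t)]
  have hmeas : Measurable fun p : Plane × Plane => ‖f (p.1 - p.2) - f p.1‖ₑ :=
    ((hm.comp_measurable (measurable_fst.sub measurable_snd)).sub
      (hm.comp_measurable measurable_fst)).enorm
  rw [← ENNReal.pow_le_pow_left_iff two_ne_zero, eLpNorm_two_sq]
  calc ∫⁻ x, ‖(mollify ρ f - f) x‖ₑ ^ 2
      ≤ ∫⁻ x, ∫⁻ t, ENNReal.ofReal (ρ t) * ‖f (x - t) - f x‖ₑ ^ 2 := by
        refine lintegral_mono fun x => ?_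
        refine (pow_le_pow_left₀ zero_le (hpt x) 2).trans ?_
        exact sq_lintegral_mul_le hρm (hmeas.comp measurable_prodMk_left) hρ1
    _ = ∫⁻ t, ∫⁻ x, ENNReal.ofReal (ρ t) * ‖f (x - t) - f x‖ₑ ^ 2 := by
        refine lintegral_lintegral_swap ?_
        exact ((hρm.comp measurable_snd).mul (hmeas.pow_const 2)).aemeasurable
    _ ≤ ∫⁻ t, ENNReal.ofReal (ρ t) * ε ^ 2 := by
        refine lintegral_mono fun t => ?_
        have hmt : Measurable fun x => ‖f (x - t) - f x‖ₑ := hmeas.comp measurable_prodMk_right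
        rw [lintegral_const_mul _ (hmt.pow_const 2)]
        by_cases h0 : ρ t = 0
        · simp [h0]
        · have ht : ‖t‖ < δ := by
            have := hρ.support (subset_tsupport _ h0)
            rwa [mem_ball_zero_iff] at this
          gcongr
          have := hε t ht
          rw [← ENNReal.pow_le_pow_left_iff two_ne_zero, eLpNorm_two_sq] at this
          exact this
    _ = ε ^ 2 := by rw [lintegral_mul_const _ hρm, hρ1, one_mul]

/-- Mollification converges in `L²`. -/
lemma exists_mollify_close [CompleteSpace F] {f : Plane → F} (hf : MemLp f 2 volume) {ε : ENNReal}
    (hε : 0 < ε) : ∃ δ > 0, ∀ ρ, IsKernel ρ δ → eLpNorm (mollify ρ f - f) 2 volume ≤ ε := by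
  obtain ⟨δ, hδ, h⟩ := exists_eLpNorm_translate_le hf hε
  exact ⟨δ, hδ, fun ρ hρ => hρ.eLpNorm_mollify_sub_le hf h⟩

lemma IsKernel.mono {ρ : Plane → ℝ} {δ δ' : ℝ} (h : IsKernel ρ δ) (hδ : δ ≤ δ') : IsKernel ρ δ' :=
  ⟨h.smooth, h.compact, h.nonneg, h.integral, h.support.trans (Metric.ball_subset_ball hδ)⟩

lemma exists_kernel {z : Plane} {r δ : ℝ} (hr : 0 < r) (hδ : ‖z‖ + r < δ) :
    ∃ ρ, IsKernel ρ δ ∧ tsupport ρ ⊆ Metric.ball z r := by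
  let b : ContDiffBump z := ⟨r / 4, r / 2, by positivity, by linarith⟩
  have hts : tsupport (b.normed volume) ⊆ Metric.ball z r := by
    rw [b.tsupport_normed_eq]
    exact Metric.closedBall_subset_ball (show r / 2 < r by linarith)
  refine ⟨b.normed volume, ⟨b.contDiff_normed, b.hasCompactSupport_normed, b.nonneg_normed,
    b.integral_normed, hts.trans ?_⟩, hts⟩
  intro y hy
  rw [mem_ball_zero_iff]
  rw [mem_ball_iff_norm] at hy
  have := norm_le_norm_sub_add y z
  linarith

lemma contDiff_mollify {ρ : Plane → ℝ} {δ : ℝ} (hρ : IsKernel ρ δ) {f : Plane → ℝ}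
    (hf : MemLp f 2 volume) : ContDiff ℝ (⊤ : ℕ∞) (mollify ρ f) :=
  hρ.compact.contDiff_convolution_left _ hρ.smooth (hf.locallyIntegrable (by norm_num))

lemma fderiv_mollify_apply {ρ : Plane → ℝ} {δ : ℝ} (hρ : IsKernel ρ δ) {f : Plane → ℝ}
    (hf : MemLp f 2 volume) (x e : Plane) :
    fderiv ℝ (mollify ρ f) x e = ∫ t, fderiv ℝ ρ t e * f (x - t) := by
  have hloc : LocallyIntegrable f volume := hf.locallyIntegrable (by norm_num)
  have h1 : ContDiff ℝ 1 ρ := hρ.smooth.of_le (by exact_mod_cast le_top)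
  have h := (hρ.compact.hasFDerivAt_convolution_left (ContinuousLinearMap.lsmul ℝ ℝ) h1 hloc x)
  have h' := h.fderiv
  rw [show mollify ρ f = convolution ρ f (ContinuousLinearMap.lsmul ℝ ℝ) volume from rfl, h',
    convolution_def, ContinuousLinearMap.integral_apply]
  · rfl
  · exact (hρ.compact.fderiv (𝕜 := ℝ)).convolutionExists_left _
      (h1.continuous_fderiv one_ne_zero) hloc x

end Mollify

/-! ### Functions in `H¹` -/

section H1

variable {U : Set Plane} {u u' : Plane → ℝ} {G G' : Plane → Plane →L[ℝ] ℝ}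

lemma setIntegral_eq_integral_of_tsupport {F : Type*} [NormedAddCommGroup F] [NormedSpace ℝ F]
    {f : Plane → F} (hf : Function.support f ⊆ U) : ∫ x in U, f x = ∫ x, f x :=
  setIntegral_eq_integral_of_forall_compl_eq_zero fun _ hx =>
    Function.notMem_support.1 fun h => hx (hf h)

lemma support_smul_subset {F : Type*} [NormedAddCommGroup F] [NormedSpace ℝ F] {φ : Plane → ℝ}
    {f : Plane → F} (h : tsupport φ ⊆ U) : Function.support (fun x => φ x • f x) ⊆ U := by
  intro x hx
  refine h (subset_tsupport _ fun h0 => hx ?_)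
  simp [h0]

lemma IsH1.mono {F : Type*} [NormedAddCommGroup F] [NormedSpace ℝ F] {V : Set Plane}
    {u : Plane → F} {G : Plane → Plane →L[ℝ] F} (h : IsH1 U u G) (hVU : V ⊆ U) : IsH1 V u G where
  memLp := h.memLp.mono_measure (Measure.restrict_mono_set _ hVU)
  memLp_deriv := h.memLp_deriv.mono_measure (Measure.restrict_mono_set _ hVU)
  weak_deriv φ hφ hc hs e := by
    have h1 : Function.support (fun x => fderiv ℝ φ x e • u x) ⊆ V :=
      support_smul_subset ((tsupport_fderiv_apply_subset ℝ e).trans hs)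
    have h2 : Function.support (fun x => φ x • G x e) ⊆ V :=
      support_smul_subset hs
    rw [setIntegral_eq_integral_of_tsupport h1, setIntegral_eq_integral_of_tsupport h2,
      ← setIntegral_eq_integral_of_tsupport (h1.trans hVU),
      ← setIntegral_eq_integral_of_tsupport (h2.trans hVU)]
    exact h.weak_deriv φ hφ hc (hs.trans hVU) e

lemma IsH1.congr {F : Type*} [NormedAddCommGroup F] [NormedSpace ℝ F]
    {u u' : Plane → F} {G : Plane → Plane →L[ℝ] F} (h : IsH1 U u G)
    (huu : u =ᵐ[volume.restrict U] u') : IsH1 U u' G where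
  memLp := h.memLp.ae_eq huu
  memLp_deriv := h.memLp_deriv
  weak_deriv φ hφ hc hs e := by
    rw [← h.weak_deriv φ hφ hc hs e]
    refine integral_congr_ae ?_
    filter_upwards [huu] with x hx
    rw [hx]

lemma integrable_smul_of_memLp {F : Type*} [NormedAddCommGroup F] [NormedSpace ℝ F]
    {μ : Measure Plane} [IsFiniteMeasure μ] {f : Plane → F}
    (hf : MemLp f 2 μ) {φ : Plane → ℝ} (hφ : Continuous φ) (hc : HasCompactSupport φ) :
    Integrable (fun x => φ x • f x) μ := by
  obtain ⟨C, hC⟩ := hc.exists_bound_of_continuous hφ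
  exact (hf.integrable (by norm_num)).bdd_smul C hφ.aestronglyMeasurable (ae_of_all _ hC)

lemma integrable_smul_apply_of_memLp {μ : Measure Plane} [IsFiniteMeasure μ]
    (hG : MemLp G 2 μ) {φ : Plane → ℝ} (hφ : Continuous φ) (hc : HasCompactSupport φ) (e : Plane) :
    Integrable (fun x => φ x • G x e) μ :=
  (integrable_smul_of_memLp hG hφ hc).apply_continuousLinearMap e

lemma isFiniteMeasure_restrict (hb : Bornology.IsBounded U) :
    IsFiniteMeasure ((volume : Measure Plane).restrict U) := ⟨by simpa using hb.measure_lt_top⟩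

/-- The fundamental lemma of the calculus of variations applied to G - G'. It identifies the weak
gradients that the definitions hide under existential quantifiers. -/
lemma IsH1.ae_eq_deriv (hU : IsOpen U) (hb : Bornology.IsBounded U) (h : IsH1 U u G)
    (h' : IsH1 U u' G') (huu : u =ᵐ[volume.restrict U] u') : G =ᵐ[volume.restrict U] G' := by
  have := isFiniteMeasure_restrict hb
  have h := h.congr huu
  have hmem : MemLp (G - G') 2 (volume.restrict U) := h.memLp_deriv.sub h'.memLp_deriv
  have hint : IntegrableOn (G - G') U := hmem.integrable (by norm_num)
  have key := hU.ae_eq_zero_of_integral_contDiff_smul_eq_zero (f := G - G') (μ := volume)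
    hint.locallyIntegrableOn (fun φ hφ hc hs => ?_)
  · rw [EventuallyEq, ae_restrict_iff' hU.measurableSet]
    filter_upwards [key] with x hx hxU
    exact sub_eq_zero.1 (hx hxU)
  · have hs' : Function.support (fun x => φ x • (G - G') x) ⊆ U :=
      support_smul_subset (φ := φ) (f := G - G') hs
    rw [← setIntegral_eq_integral_of_tsupport hs']
    ext e
    rw [ContinuousLinearMap.integral_apply (integrable_smul_of_memLp hmem hφ.continuous hc)]
    have e1 := h.weak_deriv φ hφ hc hs e
    have e2 := h'.weak_deriv φ hφ hc hs e
    rw [e1, neg_inj] at e2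
    have : ∀ x, (φ x • (G - G') x) e = φ x • G x e - φ x • G' x e := fun x => by
      simp [mul_sub]
    simp only [this]
    rw [integral_sub (integrable_smul_apply_of_memLp h.memLp_deriv hφ.continuous hc e)
      (integrable_smul_apply_of_memLp h'.memLp_deriv hφ.continuous hc e), e2, sub_self]
    rfl

lemma IsH1.add (hb : Bornology.IsBounded U) (h : IsH1 U u G) (h' : IsH1 U u' G') :
    IsH1 U (u + u') (G + G') := by
  have := isFiniteMeasure_restrict hb
  have hG : MemLp (G + G') 2 (volume.restrict U) := by
    rw [← sub_neg_eq_add]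
    exact h.memLp_deriv.sub h'.memLp_deriv.neg
  refine ⟨h.memLp.add h'.memLp, hG, fun φ hφ hc hs e => ?_⟩
  have c1 : Continuous fun x => fderiv ℝ φ x e :=
    (hφ.continuous_fderiv (by simp)).clm_apply continuous_const
  have i1 : Integrable (fun x => fderiv ℝ φ x e • u x) (volume.restrict U) :=
    integrable_smul_of_memLp h.memLp c1 (hc.fderiv_apply (𝕜 := ℝ) e)
  have i2 : Integrable (fun x => fderiv ℝ φ x e • u' x) (volume.restrict U) :=
    integrable_smul_of_memLp h'.memLp c1 (hc.fderiv_apply (𝕜 := ℝ) e)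
  have j1 := integrable_smul_apply_of_memLp h.memLp_deriv hφ.continuous hc e
  have j2 := integrable_smul_apply_of_memLp h'.memLp_deriv hφ.continuous hc e
  have e1 : ∀ x, fderiv ℝ φ x e • (u + u') x = fderiv ℝ φ x e • u x + fderiv ℝ φ x e • u' x :=
    fun x => smul_add _ _ _
  have e2 : ∀ x, φ x • (G + G') x e = φ x • G x e + φ x • G' x e := fun x => smul_add _ _ _
  simp only [e1, e2]
  rw [integral_add i1 i2, integral_add j1 j2, h.weak_deriv φ hφ hc hs e,
    h'.weak_deriv φ hφ hc hs e, ← neg_add]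

lemma IsH1.neg (h : IsH1 U u G) : IsH1 U (-u) (-G) where
  memLp := h.memLp.neg
  memLp_deriv := h.memLp_deriv.neg
  weak_deriv φ hφ hc hs e := by
    simp only [Pi.neg_apply, smul_neg, neg_apply, integral_neg, h.weak_deriv φ hφ hc hs e]

lemma IsH1.sub (hb : Bornology.IsBounded U) (h : IsH1 U u G) (h' : IsH1 U u' G') :
    IsH1 U (u - u') (G - G') := by
  rw [sub_eq_add_neg, sub_eq_add_neg]
  exact h.add hb h'.neg

lemma isH1_of_contDiff (hb : Bornology.IsBounded U) {f : Plane → ℝ} (hf : ContDiff ℝ 1 f) :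
    IsH1 U f (fderiv ℝ f) where
  memLp := memLp_of_continuous hb hf.continuous 2
  memLp_deriv := memLp_of_continuous hb (hf.continuous_fderiv one_ne_zero) 2
  weak_deriv φ hφ hc hs e := by
    have hφ1 : ContDiff ℝ 1 φ := hφ.of_le (by exact_mod_cast le_top)
    have h1 : Function.support (fun x => fderiv ℝ φ x e • f x) ⊆ U :=
      support_smul_subset ((tsupport_fderiv_apply_subset ℝ e).trans hs)
    have h2 : Function.support (fun x => φ x • fderiv ℝ f x e) ⊆ U :=
      support_smul_subset hs
    rw [setIntegral_eq_integral_of_tsupport h1, setIntegral_eq_integral_of_tsupport h2]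
    have c1 : Continuous fun x => fderiv ℝ φ x e :=
      (hφ1.continuous_fderiv one_ne_zero).clm_apply continuous_const
    have c2 : Continuous fun x => fderiv ℝ f x e :=
      (hf.continuous_fderiv one_ne_zero).clm_apply continuous_const
    have k1 : HasCompactSupport fun x => fderiv ℝ φ x e := hc.fderiv_apply (𝕜 := ℝ) e
    have := integral_mul_fderiv_eq_neg_fderiv_mul_of_integrable (μ := (volume : Measure Plane))
      (f := φ) (g := f) (v := e)
      ((c1.mul hf.continuous).integrable_of_hasCompactSupport k1.mul_right)
      ((hφ.continuous.mul c2).integrable_of_hasCompactSupport hc.mul_right)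
      ((hφ.continuous.mul hf.continuous).integrable_of_hasCompactSupport hc.mul_right)
      (fun x _ => hφ1.differentiable one_ne_zero x) (fun x _ => hf.differentiable one_ne_zero x)
    simp only [smul_eq_mul]
    linarith

end H1

/-! ### Density of smooth functions in `H¹` of a Lipschitz domain -/

section Density

variable {U S W : Set Plane} {u χ : Plane → ℝ} {G : Plane → Plane →L[ℝ] ℝ}

/-- The weak derivative of `χ u`. -/
def mulDeriv (χ u : Plane → ℝ) (G : Plane → Plane →L[ℝ] ℝ) (x : Plane) : Plane →L[ℝ] ℝ :=
  χ x • G x + u x • fderiv ℝ χ x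

lemma memLp_bdd_smul {E : Type*} [NormedAddCommGroup E] [NormedSpace ℝ E] {f : Plane → E}
    {μ : Measure Plane} (hf : MemLp f 2 μ) (hχ : Continuous χ) (hc : HasCompactSupport χ) :
    MemLp (fun x => χ x • f x) 2 μ := by
  obtain ⟨C, hC⟩ := hc.exists_bound_of_continuous hχ
  refine hf.of_le_mul (c := C) (hχ.aestronglyMeasurable.smul hf.1) (ae_of_all _ fun x => ?_)
  rw [norm_smul]
  exact mul_le_mul_of_nonneg_right (hC x) (norm_nonneg _)

lemma eLpNorm_two_add_le {E : Type*} [NormedAddCommGroup E] {μ : Measure Plane}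
    {f g : Plane → E} (hf : AEStronglyMeasurable f μ) (hg : AEStronglyMeasurable g μ) :
    eLpNorm (f + g) 2 μ ≤ eLpNorm f 2 μ + eLpNorm g 2 μ := eLpNorm_add_le hf hg (by norm_num)

lemma eLpNorm_two_const_zero {E : Type*} [NormedAddCommGroup E] (μ : Measure Plane) :
    eLpNorm (fun _ => (0 : E)) 2 μ = 0 := eLpNorm_zero

lemma memLp_indicator_of_restrict {E : Type*} [NormedAddCommGroup E] {f : Plane → E}
    (hU : IsOpen U) (hf : MemLp f 2 (volume.restrict U)) : MemLp (U.indicator f) 2 volume :=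
  (memLp_indicator_iff_restrict hU.measurableSet).2 hf

lemma memLp_mulDeriv (h : IsH1 U u G) (hχ : ContDiff ℝ 1 χ) (hc : HasCompactSupport χ) :
    MemLp (mulDeriv χ u G) 2 (volume.restrict U) := by
  have h1 : MemLp (fun x => χ x • G x) 2 (volume.restrict U) :=
    memLp_bdd_smul h.memLp_deriv hχ.continuous hc
  obtain ⟨C, hC⟩ := (hc.fderiv (𝕜 := ℝ)).exists_bound_of_continuous
    (hχ.continuous_fderiv one_ne_zero)
  have h2 : MemLp (fun x => -(u x • fderiv ℝ χ x)) 2 (volume.restrict U) := by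
    refine MemLp.neg (h.memLp.of_le_mul (c := C) (h.memLp.1.smul
      (hχ.continuous_fderiv one_ne_zero).aestronglyMeasurable) (ae_of_all _ fun x => ?_))
    rw [norm_smul, mul_comm]
    exact mul_le_mul_of_nonneg_right (hC x) (norm_nonneg _)
  have h3 : mulDeriv χ u G = (fun x => χ x • G x) - fun x => -(u x • fderiv ℝ χ x) := by
    ext1 x; simp [mulDeriv]
  rw [h3]
  exact h1.sub h2

/-- Extended by zero, χu acquires a weak gradient on the whole model `S`, although in general not
across the boundary of `S`. The product χφ is an admissible test function for `u`. -/
lemma integral_fderiv_mul_localized (hb : Bornology.IsBounded U) (hU : IsOpen U) (h : IsH1 U u G)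
    (hχ : ContDiff ℝ (⊤ : ℕ∞) χ) (hc : HasCompactSupport χ) (hs : tsupport χ ⊆ W)
    (hUS : U ∩ W = S ∩ W) {φ : Plane → ℝ} (hφ : ContDiff ℝ (⊤ : ℕ∞) φ)
    (hcφ : HasCompactSupport φ) (hsφ : tsupport φ ⊆ S) (e : Plane) :
    ∫ x, fderiv ℝ φ x e * U.indicator (fun x => χ x * u x) x =
      -∫ x, φ x * U.indicator (mulDeriv χ u G) x e := by
  have := isFiniteMeasure_restrict hb
  -- The support lies in S ∩ W, which is U ∩ W.
  have hψs : tsupport (fun x => χ x * φ x) ⊆ U := by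
    intro x hx
    have h1 : x ∈ W := hs (tsupport_mul_subset_left hx)
    have h2 : x ∈ S := hsφ (tsupport_mul_subset_right hx)
    have : x ∈ U ∩ W := by rw [hUS]; exact ⟨h2, h1⟩
    exact this.1
  have hw := h.weak_deriv (fun x => χ x * φ x) (hχ.mul hφ) hc.mul_right hψs e
  have e1 : ∀ x, fderiv ℝ φ x e * U.indicator (fun x => χ x * u x) x =
      U.indicator (fun x => fderiv ℝ φ x e * (χ x * u x)) x := fun x => by
    by_cases hx : x ∈ U <;> simp [hx]
  have e2 : ∀ x, φ x * U.indicator (mulDeriv χ u G) x e =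
      U.indicator (fun x => φ x * (mulDeriv χ u G x e)) x := fun x => by
    by_cases hx : x ∈ U <;> simp [hx]
  simp only [e1, e2]
  rw [integral_indicator hU.measurableSet, integral_indicator hU.measurableSet]
  have dφ : Differentiable ℝ φ := hφ.differentiable (by simp)
  have dχ : Differentiable ℝ χ := hχ.differentiable (by simp)
  have cφ : Continuous fun x => fderiv ℝ φ x e :=
    (hφ.continuous_fderiv (by simp)).clm_apply continuous_const
  have cχ : Continuous fun x => fderiv ℝ χ x e :=
    (hχ.continuous_fderiv (by simp)).clm_apply continuous_const
  have i1 : Integrable (fun x => (fderiv ℝ φ x e * χ x) • u x) (volume.restrict U) :=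
    integrable_smul_of_memLp h.memLp (cφ.mul hχ.continuous) hc.mul_left
  have i2 : Integrable (fun x => (φ x * fderiv ℝ χ x e) • u x) (volume.restrict U) :=
    integrable_smul_of_memLp h.memLp (hφ.continuous.mul cχ) hcφ.mul_right
  have i3 : Integrable (fun x => (χ x * φ x) • G x e) (volume.restrict U) :=
    integrable_smul_apply_of_memLp h.memLp_deriv (hχ.continuous.mul hφ.continuous) hc.mul_right e
  have e3 : ∀ x, fderiv ℝ (fun x => χ x * φ x) x e • u x =
      (fderiv ℝ φ x e * χ x) • u x + (φ x * fderiv ℝ χ x e) • u x := fun x => by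
    rw [fderiv_fun_mul (dχ x) (dφ x)]
    simp only [add_apply, smul_apply, smul_eq_mul]
    ring
  simp only [e3] at hw
  rw [integral_add i1 i2] at hw
  have e4 : ∀ x, φ x * mulDeriv χ u G x e =
      (χ x * φ x) • G x e + (φ x * fderiv ℝ χ x e) • u x := fun x => by
    simp only [mulDeriv, add_apply, smul_apply, smul_eq_mul]
    ring
  simp only [e4]
  rw [integral_add i3 i2]
  have e5 : ∀ x, fderiv ℝ φ x e * (χ x * u x) = (fderiv ℝ φ x e * χ x) • u x := fun x => by
    simp only [smul_eq_mul]; ring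
  simp only [e5]
  linarith

/-- A smooth function which is `ε`-close to `χ u` in `H¹(U)`, and uniformly on the closure of `U`
if `u` is continuous there. -/
def HasApprox (U : Set Plane) (u : Plane → ℝ) (G : Plane → Plane →L[ℝ] ℝ) (χ : Plane → ℝ) : Prop :=
  ∀ ε : ℝ, 0 < ε → ∃ φ : Plane → ℝ, ContDiff ℝ (⊤ : ℕ∞) φ ∧
    eLpNorm (fun x => φ x - χ x * u x) 2 (volume.restrict U) ≤ ENNReal.ofReal ε ∧
    eLpNorm (fderiv ℝ φ - mulDeriv χ u G) 2 (volume.restrict U) ≤ ENNReal.ofReal ε ∧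
    (ContinuousOn u (closure U) → ∀ x ∈ closure U, |φ x - χ x * u x| ≤ ε)

/-- The zero extension of χu is mollified with a kernel whose support is displaced so that x - t
lies in `S` for every x in the closure of `S`. Each translated kernel is then supported in `S`, so
mollification commutes with the gradient on all of `U` up to the boundary. -/
lemma hasApprox_local (hb : Bornology.IsBounded U) (hU : IsOpen U) (h : IsH1 U u G)
    (hχ : ContDiff ℝ (⊤ : ℕ∞) χ) (hc : HasCompactSupport χ) (hW : IsOpen W) (hs : tsupport χ ⊆ W)
    (hUS : U ∩ W = S ∩ W) (hS : IsModel S) : HasApprox U u G χ := by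
  intro ε hε
  have hε' : 0 < ENNReal.ofReal ε := ENNReal.ofReal_pos.2 hε
  have hχ1 : ContDiff ℝ 1 χ := hχ.of_le (by exact_mod_cast le_top)
  set f : Plane → ℝ := U.indicator (fun x => χ x * u x) with hfdef
  set K : Plane → Plane →L[ℝ] ℝ := U.indicator (mulDeriv χ u G) with hKdef
  have hf : MemLp f 2 volume := by
    exact memLp_indicator_of_restrict hU <| memLp_bdd_smul h.memLp hχ.continuous hc
  have hK : MemLp K 2 volume := by
    exact memLp_indicator_of_restrict hU (memLp_mulDeriv h hχ1 hc)
  have hf0 : ∀ y, y ∉ tsupport χ → f y = 0 := fun y hy => by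
    rw [hfdef, Set.indicator_apply_eq_zero]
    intro _; rw [image_eq_zero_of_notMem_tsupport hy, zero_mul]
  have hK0 : ∀ y, y ∉ tsupport χ → K y = 0 := fun y hy => by
    rw [hKdef, Set.indicator_apply_eq_zero]
    intro _
    have h1 : fderiv ℝ χ y = 0 := by
      by_contra hne
      exact hy (support_fderiv_subset ℝ hne)
    rw [mulDeriv, h1, image_eq_zero_of_notMem_tsupport hy, zero_smul, smul_zero, add_zero]
  obtain ⟨δ1, hδ1, h1⟩ := exists_mollify_close hf hε'
  obtain ⟨δ2, hδ2, h2⟩ := exists_mollify_close hK hε'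
  obtain ⟨δ3, hδ3, h3⟩ := hc.isCompact.exists_thickening_subset_open hW hs
  -- For the uniform estimate χu is replaced by χũ, with ũ a Tietze extension, which is uniformly
  -- continuous. If `u` is not continuous there is nothing to estimate and δ4 = 1 is a dummy.
  have h4 : ∃ δ4 > 0, ContinuousOn u (closure U) → ∃ ũ : Plane → ℝ, Continuous ũ ∧
      (∀ x ∈ closure U, ũ x = u x) ∧
      ∀ x y, dist x y < δ4 → dist (χ x * ũ x) (χ y * ũ y) < ε := by
    by_cases hu : ContinuousOn u (closure U)
    · obtain ⟨ũ, hũ⟩ := ContinuousMap.exists_restrict_eq isClosed_closure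
        (⟨(closure U).domRestrict u, hu.domRestrict⟩ : C(closure U, ℝ))
      have huc : UniformContinuous fun x => χ x * ũ x :=
        (hc.mul_right).uniformContinuous_of_continuous (hχ.continuous.mul ũ.continuous)
      obtain ⟨δ4, hδ4, h4⟩ := Metric.uniformContinuous_iff.1 huc ε hε
      refine ⟨δ4, hδ4, fun _ => ⟨ũ, ũ.continuous, fun x hx => ?_, fun x y hxy => h4 hxy⟩⟩
      exact congrArg (fun g : C(closure U, ℝ) => g ⟨x, hx⟩) hũ
    · exact ⟨1, one_pos, fun h => absurd h hu⟩
  obtain ⟨δ4, hδ4, h4⟩ := h4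
  -- One kernel serves four purposes: L² closeness of the function and of its gradient, staying
  -- inside `W`, and the modulus of continuity.
  obtain ⟨z, r, hr, hzr, hshift⟩ := hS.shift (min (min δ1 δ2) (min δ3 δ4)) (by positivity)
  obtain ⟨ρ, hρ, hρs⟩ := exists_kernel hr hzr
  have hρ1 := hρ.mono ((min_le_left _ _).trans (min_le_left _ _))
  have hρ2 := hρ.mono ((min_le_left _ _).trans (min_le_right _ _))
  have hρ3 := hρ.mono ((min_le_right _ _).trans (min_le_left _ _))
  have hρ4 := hρ.mono ((min_le_right _ _).trans (min_le_right _ _))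
  -- Outside `W` the kernel does not reach the support of `χ`, so both mollifications vanish there.
  have hfar : ∀ x, x ∉ W → ∀ t ∈ tsupport ρ, x - t ∉ tsupport χ := by
    intro x hx t ht hmem
    refine hx (h3 (Metric.mem_thickening_iff.2 ⟨x - t, hmem, ?_⟩))
    have := hρ3.support ht
    rw [dist_eq_norm, sub_sub_cancel]
    rwa [mem_ball_zero_iff] at this
  have hfderiv : ∀ x ∈ U, fderiv ℝ (mollify ρ f) x = mollify ρ K x := by
    intro x hx
    ext e
    have hloc : LocallyIntegrable K volume := hK.locallyIntegrable (by norm_num)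
    have hex : Integrable (fun t => ρ t • K (x - t)) := by
      have := hρ.compact.convolutionExists_left (ContinuousLinearMap.lsmul ℝ ℝ)
        hρ.smooth.continuous hloc x
      simpa [ConvolutionExistsAt] using this
    rw [fderiv_mollify_apply hρ hf, mollify_apply, ContinuousLinearMap.integral_apply hex]
    by_cases hxW : x ∈ W
    · have hxS : x ∈ S := by
        have : x ∈ S ∩ W := by rw [← hUS]; exact ⟨hx, hxW⟩
        exact this.1
      have hφ : ContDiff ℝ (⊤ : ℕ∞) (fun y => ρ (x - y)) :=
        hρ.smooth.comp (contDiff_const.sub contDiff_id)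
      have hφc : HasCompactSupport (fun y => ρ (x - y)) :=
        hρ.compact.comp_isClosedEmbedding (Homeomorph.subLeft x).isClosedEmbedding
      have hφs : tsupport (fun y => ρ (x - y)) ⊆ S := by
        intro y hy
        have hy' : x - y ∈ tsupport ρ := by
          have := tsupport_comp_subset_preimage ρ (f := fun y => x - y) (by fun_prop) hy
          exact this
        have := hshift x (subset_closure hxS) (x - y) (hρs hy')
        rwa [sub_sub_cancel] at this
      have key := integral_fderiv_mul_localized hb hU h hχ hc hs hUS hφ hφc hφs e
      have hd : ∀ y, fderiv ℝ (fun y => ρ (x - y)) y e = -(fderiv ℝ ρ (x - y) e) := by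
        intro y
        have hρd : HasFDerivAt ρ (fderiv ℝ ρ (x - y)) (x - y) :=
          (hρ.smooth.differentiable (by simp) _).hasFDerivAt
        have := hρd.comp y ((hasFDerivAt_id y).const_sub x)
        have h5 := this.fderiv
        exact (congrArg (fun ℓ : Plane →L[ℝ] ℝ => ℓ e) h5).trans (by simp)
      simp only [hd, neg_mul, integral_neg, neg_inj] at key
      rw [← integral_sub_left_eq_self (fun t => fderiv ℝ ρ t e * f (x - t)) volume x,
        ← integral_sub_left_eq_self (fun t => (ρ t • K (x - t)) e) volume x]
      simp only [sub_sub_cancel, smul_apply, smul_eq_mul]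
      exact key
    · have z1 : ∀ t, fderiv ℝ ρ t e * f (x - t) = 0 := fun t => by
        by_cases ht : t ∈ tsupport ρ
        · rw [hf0 _ (hfar x hxW t ht), mul_zero]
        · have : fderiv ℝ ρ t = 0 := by
            by_contra hne; exact ht (support_fderiv_subset ℝ hne)
          simp [this]
      have z2 : ∀ t, (ρ t • K (x - t)) e = 0 := fun t => by
        by_cases ht : t ∈ tsupport ρ
        · rw [hK0 _ (hfar x hxW t ht)]; simp
        · rw [image_eq_zero_of_notMem_tsupport ht]; simp
      simp only [z1, z2]
  refine ⟨mollify ρ f, contDiff_mollify hρ hf, ?_, ?_, ?_⟩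
  · refine le_trans ?_ (h1 ρ hρ1)
    refine le_trans (le_of_eq ?_) (eLpNorm_mono_measure _ (Measure.restrict_le_self (s := U)))
    refine eLpNorm_congr_ae ?_
    filter_upwards [ae_restrict_mem hU.measurableSet] with x hx
    simp [hfdef, hx]
  · refine le_trans ?_ (h2 ρ hρ2)
    refine le_trans (le_of_eq ?_) (eLpNorm_mono_measure _ (Measure.restrict_le_self (s := U)))
    refine eLpNorm_congr_ae ?_
    filter_upwards [ae_restrict_mem hU.measurableSet] with x hx
    simp only [Pi.sub_apply, hfderiv x hx, hKdef, Set.indicator_of_mem hx]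
  · intro hu x hx
    obtain ⟨ũ, hũc, hũ, h5⟩ := h4 hu
    -- Seen from a point of the closure of `U`, the kernel meets the support of `χ` only inside `U`,
    -- where zero extension and Tietze extension coincide.
    have heq : mollify ρ f x = mollify ρ (fun y => χ y * ũ y) x := by
      rw [mollify_apply, mollify_apply]
      refine integral_congr_ae (ae_of_all _ fun t => ?_)
      simp only
      by_cases ht : t ∈ tsupport ρ
      · congr 1
        by_cases hy : x - t ∈ tsupport χ
        · have hxW : x ∈ W := by
            by_contra hxW; exact hfar x hxW t ht hy
          have hxS : x ∈ closure S := by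
            have h6 : x ∈ closure (U ∩ W) := hW.closure_inter ⟨hx, hxW⟩
            rw [hUS] at h6
            exact closure_mono Set.inter_subset_left h6
          have hyS : x - t ∈ S := hshift x hxS t (hρs ht)
          have hyU : x - t ∈ U := by
            have : x - t ∈ U ∩ W := by rw [hUS]; exact ⟨hyS, hs hy⟩
            exact this.1
          rw [hfdef, Set.indicator_of_mem hyU, hũ _ (subset_closure hyU)]
        · rw [hf0 _ hy, image_eq_zero_of_notMem_tsupport hy, zero_mul]
      · rw [image_eq_zero_of_notMem_tsupport ht, zero_smul, zero_smul]
    rw [heq, ← hũ x hx, ← Real.dist_eq]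
    refine dist_convolution_le hε.le ((subset_tsupport _).trans hρ4.support) hρ.nonneg hρ.integral
      (hχ.continuous.mul hũc).aestronglyMeasurable fun y hy => ?_
    exact (h5 y x (Metric.mem_ball.1 hy)).le

lemma hasApprox (hb : Bornology.IsBounded U) (hU : IsOpen U) (hL : HasLipschitzBoundary U)
    (h : IsH1 U u G) (hχ : ContDiff ℝ (⊤ : ℕ∞) χ) (hc : HasCompactSupport χ) :
    HasApprox U u G χ := by
  have key : ContDiff ℝ 1 χ ∧ HasCompactSupport χ ∧ HasApprox U u G χ := by
    refine localization (p := fun χ => ContDiff ℝ 1 χ ∧ HasCompactSupport χ ∧ HasApprox U u G χ)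
      ⟨contDiff_const, HasCompactSupport.zero, fun ε hε => ⟨0, contDiff_const, by simp, ?_, by simp [hε.le]⟩⟩
      ?_ (fun x => ?_) hχ hc
    · have : fderiv ℝ (0 : Plane → ℝ) - mulDeriv 0 u G = fun _ => 0 := by
        ext1 x; simp [mulDeriv]
      rw [this]
      exact (eLpNorm_two_const_zero _).trans_le zero_le
    · rintro χ₁ χ₂ ⟨h1, c1, a1⟩ ⟨h2, c2, a2⟩
      refine ⟨h1.add h2, c1.add c2, fun ε hε => ?_⟩
      obtain ⟨φ₁, s1, p1, q1, r1⟩ := a1 (ε / 2) (by positivity)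
      obtain ⟨φ₂, s2, p2, q2, r2⟩ := a2 (ε / 2) (by positivity)
      have hsum : ENNReal.ofReal (ε / 2) + ENNReal.ofReal (ε / 2) = ENNReal.ofReal ε := by
        rw [← ENNReal.ofReal_add (by positivity) (by positivity), add_halves]
      refine ⟨φ₁ + φ₂, s1.add s2, ?_, ?_, fun hu x hx => ?_⟩
      · have e1 : (fun x => (φ₁ + φ₂) x - (χ₁ + χ₂) x * u x) =
            (fun x => φ₁ x - χ₁ x * u x) + fun x => φ₂ x - χ₂ x * u x := by
          ext x; simp only [Pi.add_apply]; ring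
        rw [e1, ← hsum]
        refine (eLpNorm_two_add_le ?_ ?_).trans (add_le_add p1 p2)
        · exact s1.continuous.aestronglyMeasurable.sub
            (h1.continuous.aestronglyMeasurable.mul h.memLp.1)
        · exact s2.continuous.aestronglyMeasurable.sub
            (h2.continuous.aestronglyMeasurable.mul h.memLp.1)
      · have e1 : fderiv ℝ (φ₁ + φ₂) - mulDeriv (χ₁ + χ₂) u G =
            (fderiv ℝ φ₁ - mulDeriv χ₁ u G) + (fderiv ℝ φ₂ - mulDeriv χ₂ u G) := by
          ext1 x
          simp only [Pi.sub_apply, Pi.add_apply, mulDeriv]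
          rw [fderiv_add (s1.differentiable (by simp) x) (s2.differentiable (by simp) x),
            fderiv_add (h1.differentiable one_ne_zero x) (h2.differentiable one_ne_zero x)]
          module
        rw [e1, ← hsum]
        refine (eLpNorm_two_add_le ?_ ?_).trans (add_le_add q1 q2)
        · exact (s1.continuous_fderiv (by simp)).aestronglyMeasurable.sub
            (memLp_mulDeriv h h1 c1).1
        · exact (s2.continuous_fderiv (by simp)).aestronglyMeasurable.sub
            (memLp_mulDeriv h h2 c2).1
      · have e1 : (φ₁ + φ₂) x - (χ₁ + χ₂) x * u x =
            (φ₁ x - χ₁ x * u x) + (φ₂ x - χ₂ x * u x) := by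
          simp only [Pi.add_apply]; ring
        rw [e1]
        exact (abs_add_le _ _).trans ((add_le_add (r1 hu x hx) (r2 hu x hx)).trans_eq
          (add_halves ε))
    · obtain ⟨S, W, hS, hWo, hx, hUS⟩ := hL.exists_agree x
      exact ⟨W, hWo.mem_nhds hx, fun χ hχ hc hs => ⟨hχ.of_le (by exact_mod_cast le_top), hc,
        hasApprox_local hb hU h hχ hc hWo hs hUS hS⟩⟩
  exact key.2.2

/-- Smooth functions are dense in `H¹` of a bounded Lipschitz domain, and the approximations
converge uniformly on the closure if the function is continuous there. -/
theorem exists_smooth_approx (hb : Bornology.IsBounded U) (hU : IsOpen U)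
    (hL : HasLipschitzBoundary U) (h : IsH1 U u G) :
    ∃ φ : ℕ → Plane → ℝ, (∀ n, ContDiff ℝ (⊤ : ℕ∞) (φ n)) ∧
      Tendsto (fun n => eLpNorm (φ n - u) 2 (volume.restrict U)) atTop (𝓝 0) ∧
      Tendsto (fun n => eLpNorm (fderiv ℝ (φ n) - G) 2 (volume.restrict U)) atTop (𝓝 0) ∧
      (ContinuousOn u (closure U) → TendstoUniformlyOn φ u atTop (closure U)) := by
  obtain ⟨χ, hχ, hc, h1⟩ := exists_cutoff_closure hb
  have hε : ∀ n : ℕ, 0 < 1 / ((n : ℝ) + 1) := fun n => by positivity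
  choose φ hφ p q r using fun n : ℕ => hasApprox hb hU hL h hχ hc (1 / ((n : ℝ) + 1)) (hε n)
  have hlim : Tendsto (fun n : ℕ => ENNReal.ofReal (1 / ((n : ℝ) + 1))) atTop (𝓝 0) := by
    rw [← ENNReal.ofReal_zero]
    exact (ENNReal.continuous_ofReal.tendsto 0).comp tendsto_one_div_add_atTop_nhds_zero_nat
  refine ⟨φ, hφ, ?_, ?_, fun hu => ?_⟩
  · refine tendsto_of_tendsto_of_tendsto_of_le_of_le tendsto_const_nhds hlim (fun _ => zero_le)
      fun n => le_of_eq_of_le (eLpNorm_congr_ae ?_) (p n)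
    filter_upwards [ae_mem_closure U] with x hx
    rw [h1.self_of_nhdsSet x hx, one_mul, Pi.sub_apply]
  · refine tendsto_of_tendsto_of_tendsto_of_le_of_le tendsto_const_nhds hlim (fun _ => zero_le)
      fun n => le_of_eq_of_le (eLpNorm_congr_ae ?_) (q n)
    filter_upwards [ae_mem_closure U] with x hx
    have h2 : χ =ᶠ[𝓝 x] fun _ => 1 := eventually_nhdsSet_iff_forall.1 h1 x hx
    rw [Pi.sub_apply, Pi.sub_apply, mulDeriv, h2.fderiv_eq, h2.eq_of_nhds]
    simp
  · rw [Metric.tendstoUniformlyOn_iff]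
    intro ε hε
    filter_upwards [tendsto_one_div_add_atTop_nhds_zero_nat.eventually (gt_mem_nhds hε)] with n hn
      x hx
    have := r n hu x hx
    rw [h1.self_of_nhdsSet x hx, one_mul] at this
    rw [dist_comm, Real.dist_eq]
    exact this.trans_lt hn

end Density

/-! ### Traces -/

section Trace

variable {U : Set Plane} {f T : Plane → ℝ} {G : Plane → Plane →L[ℝ] ℝ}

lemma eLpNorm_two_sq_eq_ofReal {α E : Type*} [MeasurableSpace α] {μ : Measure α}
    [NormedAddCommGroup E] {f : α → E} (hf : MemLp f 2 μ) :
    eLpNorm f 2 μ ^ 2 = ENNReal.ofReal (∫ x, ‖f x‖ ^ 2 ∂μ) := by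
  rw [eLpNorm_two_sq, ofReal_integral_eq_lintegral_ofReal]
  · refine lintegral_congr fun x => ?_
    rw [ENNReal.ofReal_pow (norm_nonneg _), ofReal_norm]
  · exact hf.norm.integrable_sq
  · exact ae_of_all _ fun x => sq_nonneg _

theorem exists_eLpNorm_trace_bound (hb : Bornology.IsBounded U) (hL : HasLipschitzBoundary U) :
    ∃ C : ENNReal, C ≠ ⊤ ∧ ∀ φ : Plane → ℝ, ContDiff ℝ 1 φ →
      eLpNorm φ 2 (arcLength U) ≤ C * (eLpNorm φ 2 (volume.restrict U) +
        eLpNorm (fderiv ℝ φ) 2 (volume.restrict U)) := by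
  obtain ⟨C, hC, h⟩ := exists_trace_bound hb hL
  -- C + 1 avoids a square root, since C ≤ (C + 1)².
  refine ⟨ENNReal.ofReal (C + 1), ENNReal.ofReal_ne_top, fun φ hφ => ?_⟩
  have m1 := memLp_arcLength_of_continuous hb hL hφ.continuous 2
  have m2 := memLp_of_continuous hb hφ.continuous 2
  have m3 := memLp_of_continuous hb (hφ.continuous_fderiv one_ne_zero) 2
  have i2 : Integrable (fun x => φ x ^ 2) (volume.restrict U) := m2.integrable_sq
  have i3 : Integrable (fun x => ‖fderiv ℝ φ x‖ ^ 2) (volume.restrict U) := m3.norm.integrable_sq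
  rw [← ENNReal.pow_le_pow_left_iff two_ne_zero, mul_pow, eLpNorm_two_sq_eq_ofReal m1]
  simp only [Real.norm_eq_abs, sq_abs]
  have h1 : ENNReal.ofReal (∫ y, φ y ^ 2 ∂arcLength U) ≤ ENNReal.ofReal C *
      (eLpNorm φ 2 (volume.restrict U) ^ 2 + eLpNorm (fderiv ℝ φ) 2 (volume.restrict U) ^ 2) := by
    rw [eLpNorm_two_sq_eq_ofReal m2, eLpNorm_two_sq_eq_ofReal m3,
      ← ENNReal.ofReal_add (integral_nonneg fun _ => sq_nonneg _)
        (integral_nonneg fun _ => sq_nonneg _), ← ENNReal.ofReal_mul hC]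
    simp only [Real.norm_eq_abs, sq_abs]
    rw [← integral_add i2 i3]
    exact ENNReal.ofReal_le_ofReal (h φ hφ)
  refine h1.trans ?_
  gcongr
  · rw [← ENNReal.ofReal_pow (by linarith)]
    exact ENNReal.ofReal_le_ofReal (by nlinarith)
  · rw [add_sq]
    gcongr
    exact le_self_add

lemma eLpNorm_two_sub_le {E : Type*} [NormedAddCommGroup E] {μ : Measure Plane}
    {f g k : Plane → E} (hf : AEStronglyMeasurable f μ) (hg : AEStronglyMeasurable g μ)
    (hk : AEStronglyMeasurable k μ) :
    eLpNorm (f - g) 2 μ ≤ eLpNorm (f - k) 2 μ + eLpNorm (g - k) 2 μ := by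
  have : f - g = (f - k) - (g - k) := by abel
  rw [this]
  exact eLpNorm_sub_le (hf.sub hk) (hg.sub hk) (by norm_num)

/-- By the trace bound, smooth functions that converge in H¹(U) have restrictions that are Cauchy in
L²(∂U); completeness gives the trace. -/
theorem exists_isTrace (hb : Bornology.IsBounded U) (hL : HasLipschitzBoundary U) (h : IsH1 U f G)
    {φ : ℕ → Plane → ℝ} (hφ : ∀ n, ContDiff ℝ (⊤ : ℕ∞) (φ n))
    (h0 : Tendsto (fun n => eLpNorm (φ n - f) 2 (volume.restrict U)) atTop (𝓝 0))
    (h1 : Tendsto (fun n => eLpNorm (fderiv ℝ (φ n) - G) 2 (volume.restrict U)) atTop (𝓝 0)) :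
    ∃ T, IsTrace U f T := by
  obtain ⟨C, hC, hbound⟩ := exists_eLpNorm_trace_bound hb hL
  have hm : ∀ n, MemLp (φ n) 2 (arcLength U) := fun n =>
    memLp_arcLength_of_continuous hb hL (hφ n).continuous 2
  set s : ℕ → ENNReal := fun n => C * (eLpNorm (φ n - f) 2 (volume.restrict U) +
    eLpNorm (fderiv ℝ (φ n) - G) 2 (volume.restrict U)) with hs
  have hs0 : Tendsto s atTop (𝓝 0) := by
    have := ENNReal.Tendsto.const_mul (a := C) (h0.add h1) (Or.inr hC)
    simpa using this
  have hle : ∀ n m, eLpNorm (φ n - φ m) 2 (arcLength U) ≤ s n + s m := by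
    intro n m
    have hφ1 : ∀ n, ContDiff ℝ 1 (φ n) := fun n => (hφ n).of_le (by exact_mod_cast le_top)
    refine (hbound (φ n - φ m) ((hφ1 n).sub (hφ1 m))).trans ?_
    have hd : fderiv ℝ (φ n - φ m) = fderiv ℝ (φ n) - fderiv ℝ (φ m) := by
      ext1 x
      exact fderiv_sub ((hφ1 n).differentiable one_ne_zero x)
        ((hφ1 m).differentiable one_ne_zero x)
    rw [hd, hs, ← mul_add]
    refine mul_le_mul' le_rfl ((add_le_add
      (eLpNorm_two_sub_le (hφ n).continuous.aestronglyMeasurable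
        (hφ m).continuous.aestronglyMeasurable h.memLp.1)
      (eLpNorm_two_sub_le ((hφ1 n).continuous_fderiv one_ne_zero).aestronglyMeasurable
        ((hφ1 m).continuous_fderiv one_ne_zero).aestronglyMeasurable h.memLp_deriv.1)).trans_eq ?_)
    ring
  have hcau : CauchySeq fun n => (hm n).toLp (φ n) := by
    rw [EMetric.cauchySeq_iff]
    intro ε hε
    obtain ⟨N, hN⟩ := eventually_atTop.1 (hs0.eventually (gt_mem_nhds (ENNReal.half_pos hε.ne')))
    refine ⟨N, fun n hn m hmN => ?_⟩
    rw [Lp.edist_toLp_toLp]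
    exact (hle n m).trans_lt ((ENNReal.add_lt_add (hN n hn) (hN m hmN)).trans_eq
      (ENNReal.add_halves ε))
  obtain ⟨T, hT⟩ := cauchySeq_tendsto_of_complete hcau
  refine ⟨T, Lp.memLp T, G, h, φ, hφ, h0, h1, ?_⟩
  rw [← Lp.tendsto_Lp_iff_tendsto_eLpNorm'' φ hm T (Lp.memLp T)]
  simpa using hT

lemma isTrace_boundaryTrace (h : ∃ T, IsTrace U f T) : IsTrace U f (boundaryTrace U f) := by
  rw [boundaryTrace, dif_pos h]
  exact h.choose_spec

/-! ### Green's formula for functions with a trace -/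

lemma memLp_fderiv_outerNormal (hb : Bornology.IsBounded U) (hL : HasLipschitzBoundary U)
    {v : Plane → ℝ} (hv : Continuous (fderiv ℝ v)) :
    MemLp (fun y => fderiv ℝ v y (outerNormal U y)) 2 (arcLength U) := by
  refine (memLp_arcLength_of_continuous hb hL hv 2).of_le ?_ (ae_of_all _ fun y => ?_)
  · exact (ContinuousLinearMap.apply ℝ ℝ).aestronglyMeasurable_comp₂
      (aestronglyMeasurable_outerNormal hb hL) hv.aestronglyMeasurable
  · refine ((fderiv ℝ v y).le_opNorm _).trans ?_
    exact mul_le_of_le_one_right (norm_nonneg _) (norm_outerNormal_le U y)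

/-- Green's formula for a function in `H¹` with a trace and a smooth harmonic function. -/
theorem green_trace (hU : IsOpen U) (hb : Bornology.IsBounded U) (hL : HasLipschitzBoundary U)
    (hf : IsH1 U f G) (hT : IsTrace U f T) {v : Plane → ℝ} (hv : ContDiff ℝ 2 v)
    (hΔ : ∀ x ∈ U, Laplacian.laplacian v x = 0) :
    ∫ y in U, pair (fderiv ℝ v y) (G y) =
      ∫ y, T y * fderiv ℝ v y (outerNormal U y) ∂arcLength U := by
  obtain ⟨hTm, G', hG', φ, hφ, h0, h1, h2⟩ := hT
  -- The trace comes with its own weak gradient, which agrees with `G` almost everywhere.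
  have hGG : G' =ᵐ[volume.restrict U] G := hG'.ae_eq_deriv hU hb hf (ae_eq_refl f)
  have hφ1 : ∀ n, ContDiff ℝ 1 (φ n) := fun n => (hφ n).of_le (by exact_mod_cast le_top)
  have hv' : Continuous (fderiv ℝ v) := hv.continuous_fderiv two_ne_zero
  have hgr : ∀ n, ∫ y in U, pair (fderiv ℝ v y) (fderiv ℝ (φ n) y) =
      ∫ y, fderiv ℝ v y (outerNormal U y) * φ n y ∂arcLength U := by
    intro n
    have := green hb hL (hφ1 n) hv
    have hz : ∫ y in U, φ n y * Laplacian.laplacian v y = 0 := by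
      rw [setIntegral_congr_fun hU.measurableSet (g := fun _ => 0)]
      · simp
      · intro y hy; simp [hΔ y hy]
    rw [hz, add_zero] at this
    rw [this]
    simp only [mul_comm]
  have l1 := tendsto_integral_bilin pair (memLp_of_continuous hb hv' 2)
    (fun n => memLp_of_continuous hb ((hφ1 n).continuous_fderiv one_ne_zero) 2) hG'.memLp_deriv h1
  have l2 := tendsto_integral_bilin (ContinuousLinearMap.mul ℝ ℝ)
    (memLp_fderiv_outerNormal hb hL hv')
    (fun n => memLp_arcLength_of_continuous hb hL (hφ n).continuous 2) hTm h2
  simp only [ContinuousLinearMap.mul_apply'] at l2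
  simp only [hgr] at l1
  have h3 := tendsto_nhds_unique l1 l2
  have h4 : ∫ y in U, pair (fderiv ℝ v y) (G' y) = ∫ y in U, pair (fderiv ℝ v y) (G y) := by
    refine integral_congr_ae ?_
    filter_upwards [hGG] with y hy
    rw [hy]
  rw [← h4, h3]
  simp only [mul_comm]

/-- A function which is twice differentiable near a compact set agrees near it with a function
which is twice differentiable everywhere. -/
lemma exists_contDiff_extension {n : ℕ∞} {B O : Set Plane} (hB : IsCompact B) (hO : IsOpen O)
    (hBO : B ⊆ O) {v : Plane → ℝ} (hv : ∀ x ∈ O, ContDiffAt ℝ n v x) :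
    ∃ v' : Plane → ℝ, ContDiff ℝ n v' ∧ ∀ x ∈ B, v' =ᶠ[𝓝 x] v := by
  obtain ⟨χ, hχ, hc, hs, h1, -⟩ := exists_cutoff hB hO hBO
  refine ⟨fun x => χ x * v x, contDiff_iff_contDiffAt.2 fun x => ?_, fun x hx => ?_⟩
  · have hχn : ContDiff ℝ n χ := hχ.of_le (by exact_mod_cast le_top)
    by_cases hx : x ∈ tsupport χ
    · exact hχn.contDiffAt.mul (hv x (hs hx))
    · refine (contDiffAt_const (c := (0 : ℝ))).congr_of_eventuallyEq ?_
      filter_upwards [notMem_tsupport_iff_eventuallyEq.1 hx] with y hy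
      rw [hy]; simp
  · filter_upwards [eventually_nhdsSet_iff_forall.1 h1 x hx] with y hy
    rw [hy, one_mul]

end Trace

/-! ### Smooth boundaries -/

section Smooth

variable {U : Set Plane}

/-- A smooth function agrees near `0` with a compactly supported one. -/
lemma exists_compactSupport_eventuallyEq {h : ℝ → ℝ} (hh : ContDiff ℝ (⊤ : ℕ∞) h) :
    ∃ g : ℝ → ℝ, ContDiff ℝ (⊤ : ℕ∞) g ∧ HasCompactSupport g ∧ ∀ᶠ t in 𝓝 0, g t = h t := by
  let χ : ContDiffBump (0 : ℝ) := ⟨1, 2, one_pos, one_lt_two⟩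
  refine ⟨fun t => χ t * h t, χ.contDiff.mul hh, χ.hasCompactSupport.mul_right, ?_⟩
  filter_upwards [χ.eventuallyEq_one] with t ht
  simp [ht]

/-- Near a boundary point, a set with smooth boundary lies below the graph of a smooth function
with Lipschitz derivative. -/
lemma HasSmoothBoundary.exists_chart (hU : HasSmoothBoundary U) {x : Plane} (hx : x ∈ frontier U) :
    ∃ (c : GraphChart) (L : NNReal), c.x = x ∧ Differentiable ℝ c.h ∧ LipschitzWith L (deriv c.h) ∧
      (∃ (A : Plane ≃ₗᵢ[ℝ] Plane), ∀ y, y ∈ c.region ↔ A (y - x) 1 < c.h (A (y - x) 0)) ∧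
      ∀ᶠ y in 𝓝 x, (y ∈ U ↔ y ∈ c.region) := by
  obtain ⟨A, h, hh, hA⟩ := hU x hx
  -- A smooth graph function need not be globally Lipschitz. Only its values near 0, the coordinate
  -- of `x`, matter, so it may be cut off.
  obtain ⟨g, hg, hgc, hgh⟩ := exists_compactSupport_eventuallyEq hh
  obtain ⟨K, hK⟩ := hg.lipschitzWith_of_hasCompactSupport hgc (by simp)
  have hg' : ContDiff ℝ 1 (deriv g) :=
    (contDiff_infty_iff_deriv.1 hg).2.of_le (by exact_mod_cast le_top)
  obtain ⟨L, hL⟩ := hg'.lipschitzWith_of_hasCompactSupport hgc.deriv (by simp)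
  refine ⟨GraphChart.ofIsometry x A hK, L, rfl, hg.differentiable (by simp), hL,
    ⟨A, GraphChart.mem_region_ofIsometry x A hK⟩, ?_⟩
  have hc : Tendsto (fun y : Plane => A (y - x) 0) (𝓝 x) (𝓝 0) := by
    have : Continuous fun y : Plane => A (y - x) 0 := by fun_prop
    simpa using this.tendsto x
  filter_upwards [hA, hc.eventually hgh] with y hy hy'
  rw [hy, GraphChart.mem_region_ofIsometry, hy']

lemma HasSmoothBoundary.hasLipschitzBoundary (hU : HasSmoothBoundary U) :
    HasLipschitzBoundary U := by
  intro x hx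
  obtain ⟨c, L, -, -, -, ⟨A, hA⟩, hc⟩ := hU.exists_chart hx
  refine ⟨A, c.h, ⟨c.K, c.lip⟩, ?_⟩
  filter_upwards [hc] with y hy
  rw [hy, hA]

/-- The expansion is centred at the moving point `t`, where the normal is taken. It follows from the
mean value inequality for s ↦ h s - s h'(t). -/
lemma GraphChart.abs_taylor_le (c : GraphChart) {L : NNReal} (hd : Differentiable ℝ c.h)
    (hL : LipschitzWith L (deriv c.h)) (t : ℝ) : |c.h t - c.h 0 - t * deriv c.h t| ≤ L * t ^ 2 := by
  have hder : ∀ s ∈ Set.uIcc 0 t, HasDerivWithinAt (fun s => c.h s - s * deriv c.h t)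
      (deriv c.h s - deriv c.h t) (Set.uIcc 0 t) s := fun s _ => by
    have := ((hd s).hasDerivAt.sub ((hasDerivAt_id s).mul_const (deriv c.h t))).hasDerivWithinAt
      (s := Set.uIcc 0 t)
    rw [one_mul] at this
    exact this
  have hb : ∀ s ∈ Set.uIcc 0 t, ‖deriv c.h s - deriv c.h t‖ ≤ L * |t| := fun s hs => by
    refine (hL.norm_sub_le s t).trans (mul_le_mul_of_nonneg_left ?_ L.coe_nonneg)
    rw [Real.norm_eq_abs, abs_sub_comm]
    simpa using Set.abs_sub_right_of_mem_uIcc hs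
  have := (convex_uIcc 0 t).norm_image_sub_le_of_norm_hasDerivWithin_le hder hb
    Set.left_mem_uIcc Set.right_mem_uIcc
  simp only [zero_mul, sub_zero, Real.norm_eq_abs] at this
  rw [mul_assoc, ← pow_two, sq_abs] at this
  convert this using 2
  ring

lemma HasSmoothBoundary.exists_isOuterNormal (hU : HasSmoothBoundary U) {x : Plane}
    (hx : x ∈ frontier U) : ∃ n, IsOuterNormal U x n := by
  obtain ⟨c, L, rfl, hd, hL, -, hc⟩ := hU.exists_chart hx
  obtain ⟨W, hW, hWo, hxW⟩ := eventually_nhds_iff.1 hc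
  have hag : U ∩ W = c.region ∩ W := by
    ext z; exact and_congr_left fun hz => hW z hz
  have : c.x ∈ frontier c.region ∩ W := frontier_inter_of_agree hWo hag ▸ ⟨hx, hxW⟩
  rw [c.frontier_region] at this
  obtain ⟨t, ht⟩ := this.1
  refine ⟨c.graphNormal t, ?_⟩
  have h2 := c.isOuterNormal_curve (hd t)
  rw [ht] at h2
  exact h2.congr (hc.mono fun _ h => h.symm)

/-- The normal component of the chord is the Taylor remainder of `h` divided by the speed. -/
lemma GraphChart.abs_inner_graphNormal_le (c : GraphChart) {L : NNReal} (hd : Differentiable ℝ c.h)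
    (hL : LipschitzWith L (deriv c.h)) (h0 : c.h 0 = 0) (t : ℝ) :
    |inner ℝ (c.curve t - c.x) (c.graphNormal t)| ≤ L * ‖c.curve t - c.x‖ ^ 2 := by
  have h1 : c.curve t - c.x = t • c.a + c.h t • c.b := by simp [GraphChart.curve]
  rw [h1, GraphChart.graphNormal, inner_smul_right, c.inner_comb, c.norm_comb,
    Real.sq_sqrt (by positivity), abs_mul, abs_inv, abs_of_pos (c.speed_pos t)]
  have h2 := c.abs_taylor_le hd hL t
  have h3 : t * -deriv c.h t + c.h t * 1 = c.h t - c.h 0 - t * deriv c.h t := by rw [h0]; ring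
  rw [h3]
  calc _ ≤ 1 * |c.h t - c.h 0 - t * deriv c.h t| :=
        mul_le_mul_of_nonneg_right (inv_le_one_of_one_le₀ (c.one_le_speed t)) (abs_nonneg _)
    _ ≤ L * t ^ 2 := by rwa [one_mul]
    _ ≤ _ := mul_le_mul_of_nonneg_left (by nlinarith [sq_nonneg (c.h t)]) L.coe_nonneg

/-- On a smooth boundary, the chord from a fixed boundary point is tangent to second order. -/
theorem HasSmoothBoundary.exists_abs_inner_outerNormal_le (hU : HasSmoothBoundary U)
    {x : Plane} (hx : x ∈ frontier U) :
    ∃ C, 0 ≤ C ∧ ∀ y ∈ frontier U, |inner ℝ (y - x) (outerNormal U y)| ≤ C * ‖y - x‖ ^ 2 := by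
  obtain ⟨c, L, rfl, hd, hL, -, hc⟩ := hU.exists_chart hx
  obtain ⟨δ, hδ, hW⟩ := Metric.eventually_nhds_iff_ball.1 hc
  have hag : U ∩ Metric.ball c.x δ = c.region ∩ Metric.ball c.x δ := by
    ext z; exact and_congr_left fun hz => hW z hz
  have hfr : ∀ y ∈ frontier U, y ∈ Metric.ball c.x δ → y ∈ Set.range c.curve := fun y hy hy' => by
    have : y ∈ frontier c.region ∩ Metric.ball c.x δ :=
      frontier_inter_of_agree Metric.isOpen_ball hag ▸ ⟨hy, hy'⟩
    rw [← c.frontier_region]; exact this.1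
  have h0 : c.h 0 = 0 := by
    obtain ⟨t, ht⟩ := hfr c.x hx (Metric.mem_ball_self hδ)
    have h1 : t • c.a + c.h t • c.b = 0 := by simpa [GraphChart.curve] using ht
    have h2 := c.inner_comb_a t (c.h t)
    have h3 := c.inner_comb_b t (c.h t)
    rw [h1, inner_zero_left] at h2 h3
    rw [← h2] at h3
    exact h3.symm
  -- `L` works inside the chart; outside it ‖y - x‖ ≥ δ and the trivial bound ‖y - x‖ ≤ δ⁻¹ ‖y - x‖²
  -- suffices.
  refine ⟨max L δ⁻¹, le_max_of_le_left L.coe_nonneg, fun y hy => ?_⟩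
  by_cases hyW : y ∈ Metric.ball c.x δ
  · obtain ⟨t, rfl⟩ := hfr y hy hyW
    rw [outerNormal_of_agree Metric.isOpen_ball hag hyW, (c.isOuterNormal_curve (hd t)).outerNormal_eq]
    exact (c.abs_inner_graphNormal_le hd hL h0 t).trans
      (mul_le_mul_of_nonneg_right (le_max_left _ _) (by positivity))
  · have hδy : δ ≤ ‖y - c.x‖ := by simpa [dist_eq_norm] using hyW
    calc _ ≤ ‖y - c.x‖ * ‖outerNormal U y‖ := abs_real_inner_le_norm _ _
      _ ≤ ‖y - c.x‖ * 1 := mul_le_mul_of_nonneg_left (norm_outerNormal_le U y) (norm_nonneg _)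
      _ ≤ δ⁻¹ * ‖y - c.x‖ ^ 2 := by
        rw [inv_mul_eq_div, le_div_iff₀ hδ]; nlinarith
      _ ≤ _ := mul_le_mul_of_nonneg_right (le_max_right _ _) (by positivity)

end Smooth

/-! ### The regularized logarithmic potential -/

/-- The logarithmic potential `-(1/2π) log (|x - c|² + ε²)`. -/
def logPot (ε : ℝ) (c x : Plane) : ℝ := -(1 / (2 * Real.pi)) * Real.log (‖x - c‖ ^ 2 + ε ^ 2)

lemma hasFDerivAt_norm_sub_sq (c x : Plane) (a : ℝ) :
    HasFDerivAt (fun y : Plane => ‖y - c‖ ^ 2 + a) (2 • innerSL ℝ (x - c)) x := by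
  have := ((hasStrictFDerivAt_norm_sq (x - c)).hasFDerivAt.comp x
    ((hasFDerivAt_id x).sub_const c)).add_const a
  simpa using this

lemma hasFDerivAt_logPot {ε : ℝ} {c x : Plane} (h : ‖x - c‖ ^ 2 + ε ^ 2 ≠ 0) :
    HasFDerivAt (logPot ε c)
      ((-(1 / Real.pi) * (‖x - c‖ ^ 2 + ε ^ 2)⁻¹) • innerSL ℝ (x - c)) x := by
  have := ((hasFDerivAt_norm_sub_sq c x (ε ^ 2)).log h).const_mul (-(1 / (2 * Real.pi)))
  refine this.congr_fderiv ?_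
  ext z
  simp [-map_sub]
  field_simp

lemma fderiv_logPot_apply {ε : ℝ} {c x : Plane} (h : ‖x - c‖ ^ 2 + ε ^ 2 ≠ 0) (z : Plane) :
    fderiv ℝ (logPot ε c) x z = -(1 / Real.pi) * (inner ℝ (x - c) z / (‖x - c‖ ^ 2 + ε ^ 2)) := by
  rw [(hasFDerivAt_logPot h).fderiv]
  simp [-map_sub]
  ring

lemma norm_sub_sq_add_pos {ε : ℝ} (hε : 0 < ε) (c x : Plane) : 0 < ‖x - c‖ ^ 2 + ε ^ 2 := by
  positivity

lemma contDiffAt_logPot {ε : ℝ} {c x : Plane} (h : ‖x - c‖ ^ 2 + ε ^ 2 ≠ 0) :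
    ContDiffAt ℝ (⊤ : ℕ∞) (logPot ε c) x := by
  have h1 : ContDiffAt ℝ (⊤ : ℕ∞) (fun y : Plane => ‖y - c‖ ^ 2 + ε ^ 2) x :=
    (((contDiff_norm_sq ℝ).comp (contDiff_id.sub contDiff_const)).add contDiff_const).contDiffAt
  exact contDiffAt_const.mul (h1.log h)

lemma contDiff_logPot {ε : ℝ} (hε : 0 < ε) (c : Plane) : ContDiff ℝ (⊤ : ℕ∞) (logPot ε c) :=
  contDiff_iff_contDiffAt.2 fun x => contDiffAt_logPot (norm_sub_sq_add_pos hε c x).ne'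

/-- Minus this Laplacian is a rescaled kernel of total mass 2 over the plane, hence of mass 1 over a
half plane bounded by a line through `c`. This is why the potential is normalized by 1/π instead of
1/(2π). -/
lemma laplacian_logPot {ε : ℝ} (hε : 0 < ε) (c x : Plane) :
    Laplacian.laplacian (logPot ε c) x =
      -(2 / Real.pi * (ε ^ 2 / (‖x - c‖ ^ 2 + ε ^ 2) ^ 2)) := by
  have hp := norm_sub_sq_add_pos hε c
  rw [laplacian_eq_sum ((contDiff_logPot hε c).of_le (WithTop.coe_le_coe.2 (le_top : (2 : ℕ∞) ≤ ⊤)))]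
  have h1 : ∀ i, fderiv ℝ (fun z => fderiv ℝ (logPot ε c) z (stdBasis i)) x (stdBasis i) =
      -(1 / Real.pi) * ((‖x - c‖ ^ 2 + ε ^ 2)⁻¹ -
        2 * inner ℝ (x - c) (stdBasis i) ^ 2 / (‖x - c‖ ^ 2 + ε ^ 2) ^ 2) := fun i => by
    have h2 : (fun z => fderiv ℝ (logPot ε c) z (stdBasis i)) = fun z =>
        -(1 / Real.pi) * (inner ℝ (z - c) (stdBasis i) * (‖z - c‖ ^ 2 + ε ^ 2)⁻¹) := by
      funext z; rw [fderiv_logPot_apply (hp z).ne', ← div_eq_mul_inv]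
    have h3 : HasFDerivAt (fun z : Plane => inner ℝ (z - c) (stdBasis i))
        (innerSL ℝ (stdBasis i)) x := by
      have := (innerSL ℝ (stdBasis i)).hasFDerivAt.comp x ((hasFDerivAt_id x).sub_const c)
      have h8 : (⇑(innerSL ℝ (stdBasis i)) ∘ fun z => id z - c) =
          fun z : Plane => inner ℝ (z - c) (stdBasis i) := by
        funext z; simp [-map_sub, real_inner_comm]
      rwa [h8] at this
    have h4 := (hasDerivAt_inv (hp x).ne').comp_hasFDerivAt x (hasFDerivAt_norm_sub_sq c x (ε ^ 2))
    have h5 := (h3.mul h4).const_mul (-(1 / Real.pi))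
    rw [h2]
    have h6 := h5.fderiv
    simp only [Function.comp_def, Pi.mul_def] at h6
    rw [h6]
    simp [-map_sub]
    ring
  simp only [h1, ← Finset.mul_sum, Finset.sum_sub_distrib, ← Finset.sum_div]
  have h7 : ∑ i, inner ℝ (x - c) (stdBasis i) ^ 2 = ‖x - c‖ ^ 2 := by
    rw [← stdBasis.sum_sq_norm_inner_left (x - c)]; simp
  rw [h7]
  simp
  have := (hp x).ne'
  field_simp
  ring

/-! ### The mass of the kernel on the plane and on half planes -/

lemma integral_inv_one_add_norm_sq_sq :
    ∫ z : Plane, ((1 + ‖z‖ ^ 2) ^ 2)⁻¹ = Real.pi := by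
  rw [integral_fun_norm_addHaar (volume : Measure Plane) (fun r => ((1 + r ^ 2) ^ 2)⁻¹)]
  have h1 : ∫ y in Set.Ioi (0 : ℝ), y * ((1 + y ^ 2) ^ 2)⁻¹ = 1 / 2 := by
    have hd : ∀ y ∈ Set.Ici (0 : ℝ), HasDerivAt (fun y => -(1 / 2) * (1 + y ^ 2)⁻¹)
        (y * ((1 + y ^ 2) ^ 2)⁻¹) y := fun y _ => by
      have hp : (1 + y ^ 2) ≠ 0 := by positivity
      have := (((hasDerivAt_pow 2 y).const_add 1).inv hp).const_mul (-(1 / 2))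
      refine this.congr_deriv ?_
      simp
      field_simp
    have ht : Tendsto (fun y : ℝ => -(1 / 2) * (1 + y ^ 2)⁻¹) atTop (𝓝 (-(1 / 2) * 0)) :=
      (tendsto_inv_atTop_zero.comp (tendsto_atTop_add_const_left _ _
        (tendsto_pow_atTop two_ne_zero))).const_mul _
    rw [integral_Ioi_of_hasDerivAt_of_nonneg' hd (fun y hy => by
      have : (0 : ℝ) < y := hy
      positivity) ht]
    norm_num
  have h2 : Measure.real (volume : Measure Plane) (Metric.ball 0 1) = Real.pi := by
    simp [Measure.real, EuclideanSpace.volume_ball_fin_two, Real.pi_pos.le]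
  simp [h2, h1]
  ring

lemma integrable_inv_one_add_norm_sq_sq :
    Integrable (fun z : Plane => ((1 + ‖z‖ ^ 2) ^ 2)⁻¹) := by
  refine (integrable_rpow_neg_one_add_norm_sq (E := Plane) (r := 4) (by simp; norm_num)).congr
    (ae_of_all _ fun z => ?_)
  have : (-4 / 2 : ℝ) = -(2 : ℕ) := by norm_num
  simp only [this]
  rw [Real.rpow_neg (by positivity), Real.rpow_natCast]

lemma ae_inner_ne_zero {n : Plane} (hn : n ≠ 0) : ∀ᵐ z : Plane, inner ℝ z n ≠ 0 := by
  have h := Measure.addHaar_submodule (volume : Measure Plane) (LinearMap.ker (innerSL ℝ n).toLinearMap)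
    (fun h => hn (by
      have : n ∈ LinearMap.ker (innerSL ℝ n).toLinearMap := h ▸ Submodule.mem_top
      simpa using this))
  rw [ae_iff]
  convert h using 2
  ext z
  simp [real_inner_comm]

/-- The reflection z ↦ -z exchanges the two half planes and the separating line is a null set, so
each side carries half of the mass π. -/
lemma integral_half_plane {n : Plane} (hn : n ≠ 0) :
    ∫ z in {z : Plane | inner ℝ z n < 0}, ((1 + ‖z‖ ^ 2) ^ 2)⁻¹ = Real.pi / 2 := by
  have hm : MeasurableSet {z : Plane | inner ℝ z n < 0} :=
    measurableSet_lt (by fun_prop) measurable_const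
  have hm' : MeasurableSet {z : Plane | 0 < inner ℝ z n} :=
    measurableSet_lt measurable_const (by fun_prop)
  have hi := integrable_inv_one_add_norm_sq_sq
  have h1 : ∫ z in {z : Plane | inner ℝ z n < 0}, ((1 + ‖z‖ ^ 2) ^ 2)⁻¹ =
      ∫ z in {z : Plane | 0 < inner ℝ z n}, ((1 + ‖z‖ ^ 2) ^ 2)⁻¹ := by
    rw [← integral_indicator hm, ← integral_indicator hm', ← integral_neg_eq_self]
    congr 1
    funext z
    simp [Set.indicator_apply]
  have h2 : (∫ z in {z : Plane | inner ℝ z n < 0}, ((1 + ‖z‖ ^ 2) ^ 2)⁻¹) +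
      ∫ z in {z : Plane | 0 < inner ℝ z n}, ((1 + ‖z‖ ^ 2) ^ 2)⁻¹ = Real.pi := by
    rw [← integral_inv_one_add_norm_sq_sq, ← setIntegral_union _ hm' hi.integrableOn hi.integrableOn]
    · rw [← setIntegral_univ (μ := volume)]
      refine setIntegral_congr_set (eventuallyEq_univ.2 ?_)
      filter_upwards [ae_inner_ne_zero hn] with z hz
      exact lt_or_gt_of_ne hz
    · rw [Set.disjoint_left]
      intro z hz hz'
      simp only [Set.mem_ofPred_eq] at hz hz'
      linarith
  linarith


/-- The kernel `ε² / (π (|x - c|² + ε²)²)` concentrates at the boundary point `c`, where `U` has half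
of the full angle. -/
lemma tendsto_integral_mul_kernel {U : Set Plane} {w : Plane → ℝ} {c n : Plane} {a C : ℝ}
    (hn : IsOuterNormal U c n) (hU : MeasurableSet U) (hw : ContinuousOn w U)
    (hC : ∀ x ∈ U, |w x| ≤ C) (ha : Tendsto w (𝓝[U] c) (𝓝 a)) :
    Tendsto (fun ε : ℝ => ∫ x in U, w x * (2 / Real.pi * (ε ^ 2 / (‖x - c‖ ^ 2 + ε ^ 2) ^ 2)))
      (𝓝[>] 0) (𝓝 a) := by
  classical
  have hn0 : n ≠ 0 := fun h => by simpa [h] using hn.1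
  have hm : Measurable (U.indicator w) := by
    have := hw.measurable_piecewise (g := fun _ => (0 : ℝ)) continuousOn_const hU
    rwa [show U.piecewise w (fun _ => 0) = U.indicator w from Set.piecewise_eq_indicator] at this
  -- The substitution x = c + εz, with Jacobian ε², moves all dependence on ε into `w` and `U`.
  have hscale : ∀ ε : ℝ, 0 < ε →
      ∫ x in U, w x * (2 / Real.pi * (ε ^ 2 / (‖x - c‖ ^ 2 + ε ^ 2) ^ 2)) =
      2 / Real.pi * ∫ z : Plane, U.indicator w (c + ε • z) * ((1 + ‖z‖ ^ 2) ^ 2)⁻¹ := by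
    intro ε hε
    let F : Plane → ℝ := fun x => U.indicator w x * (ε ^ 2 / (‖x - c‖ ^ 2 + ε ^ 2) ^ 2)
    have h1 : ∀ z, U.indicator w (c + ε • z) * ((1 + ‖z‖ ^ 2) ^ 2)⁻¹ =
        ε ^ 2 * F (c + ε • z) := fun z => by
      simp only [F, add_sub_cancel_left, norm_smul, Real.norm_of_nonneg hε.le]
      have : 1 + ‖z‖ ^ 2 ≠ 0 := by positivity
      have h3 : (ε * ‖z‖) ^ 2 + ε ^ 2 = ε ^ 2 * (1 + ‖z‖ ^ 2) := by ring
      rw [h3]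
      field_simp
    simp only [h1]
    rw [integral_const_mul, Measure.integral_comp_smul volume (fun y => F (c + y)) ε,
      integral_add_left_eq_self, ← integral_indicator hU]
    have h2 : ∀ x, U.indicator (fun x => w x * (2 / Real.pi * (ε ^ 2 / (‖x - c‖ ^ 2 + ε ^ 2) ^ 2))) x
        = 2 / Real.pi * F x := fun x => by
      by_cases hx : x ∈ U
      · simp [F, hx]; ring
      · simp [F, hx]
    simp only [h2, integral_const_mul]
    have : |(ε ^ Module.finrank ℝ Plane)⁻¹| = (ε ^ 2)⁻¹ := by
      simp
    rw [this, smul_eq_mul, mul_inv_cancel_left₀ (by positivity)]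
  have hlim : Tendsto (fun ε : ℝ => ∫ z : Plane, U.indicator w (c + ε • z) * ((1 + ‖z‖ ^ 2) ^ 2)⁻¹)
      (𝓝[>] 0) (𝓝 (∫ z : Plane, {z : Plane | inner ℝ z n < 0}.indicator
        (fun z => a * ((1 + ‖z‖ ^ 2) ^ 2)⁻¹) z)) := by
    refine tendsto_integral_filter_of_dominated_convergence
      (fun z => |C| * ((1 + ‖z‖ ^ 2) ^ 2)⁻¹) (Eventually.of_forall fun ε => ?_)
      (Eventually.of_forall fun ε => ae_of_all _ fun z => ?_)
      (integrable_inv_one_add_norm_sq_sq.const_mul _) ?_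
    · exact ((hm.comp (by fun_prop)).mul (by fun_prop)).aestronglyMeasurable
    · rw [norm_mul, Real.norm_of_nonneg (by positivity : (0:ℝ) ≤ ((1 + ‖z‖ ^ 2) ^ 2)⁻¹)]
      refine mul_le_mul_of_nonneg_right ?_ (by positivity)
      by_cases hx : c + ε • z ∈ U
      · simpa [hx] using (hC _ hx).trans (le_abs_self C)
      · simp [hx]
    · filter_upwards [ae_inner_ne_zero hn0] with z hz
      have hz0 : z ≠ 0 := fun h => by simp [h] at hz
      have hzn : 0 < ‖z‖ := norm_pos_iff.2 hz0
      have htend : Tendsto (fun ε : ℝ => c + ε • z) (𝓝[>] 0) (𝓝 c) := by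
        have : Continuous fun ε : ℝ => c + ε • z := by fun_prop
        simpa using (this.tendsto 0).mono_left nhdsWithin_le_nhds
      -- With half of the cosine of the angle between z and n as tolerance, the points c + εz are
      -- eventually inside `U` if ⟪z, n⟫ < 0 and eventually outside if ⟪z, n⟫ > 0.
      have hev := htend.eventually (hn.2 (|inner ℝ z n| / (2 * ‖z‖)) (by positivity))
      rcases lt_or_gt_of_ne hz with h | h
      · have hU' : ∀ᶠ ε : ℝ in 𝓝[>] 0, c + ε • z ∈ U := by
          filter_upwards [hev, self_mem_nhdsWithin] with ε hε hpos
          have hpos : 0 < ε := hpos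
          by_contra hnot
          have := hε.2 hnot
          rw [add_sub_cancel_left, inner_smul_left, norm_smul, Real.norm_of_nonneg hpos.le,
            abs_of_neg h] at this
          have h4 : -inner ℝ z n / (2 * ‖z‖) * (ε * ‖z‖) = -(ε * inner ℝ z n) / 2 := by field_simp
          rw [h4, conj_trivial] at this
          nlinarith [mul_neg_of_pos_of_neg hpos h]
        have hw' : Tendsto (fun ε : ℝ => w (c + ε • z)) (𝓝[>] 0) (𝓝 a) :=
          ha.comp (tendsto_nhdsWithin_iff.2 ⟨htend, hU'⟩)
        have : {z : Plane | inner ℝ z n < 0}.indicator (fun z => a * ((1 + ‖z‖ ^ 2) ^ 2)⁻¹) z =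
            a * ((1 + ‖z‖ ^ 2) ^ 2)⁻¹ := Set.indicator_of_mem (s := {z : Plane | inner ℝ z n < 0}) h _
        rw [this]
        refine (hw'.mul_const _).congr' ?_
        filter_upwards [hU'] with ε hε
        simp [hε]
      · have hU' : ∀ᶠ ε : ℝ in 𝓝[>] 0, c + ε • z ∉ U := by
          filter_upwards [hev, self_mem_nhdsWithin] with ε hε hpos hin
          have hpos : 0 < ε := hpos
          have := hε.1 hin
          rw [add_sub_cancel_left, inner_smul_left, norm_smul, Real.norm_of_nonneg hpos.le,
            abs_of_pos h] at this
          have h4 : inner ℝ z n / (2 * ‖z‖) * (ε * ‖z‖) = (ε * inner ℝ z n) / 2 := by field_simp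
          rw [h4, conj_trivial] at this
          nlinarith [mul_pos hpos h]
        have : {z : Plane | inner ℝ z n < 0}.indicator (fun z => a * ((1 + ‖z‖ ^ 2) ^ 2)⁻¹) z = 0 :=
          Set.indicator_of_notMem (s := {z : Plane | inner ℝ z n < 0}) (not_lt.2 h.le) _
        rw [this]
        refine tendsto_const_nhds.congr' ?_
        filter_upwards [hU'] with ε hε
        simp [hε]
  rw [integral_indicator (measurableSet_lt (by fun_prop) measurable_const), integral_const_mul,
    integral_half_plane hn0] at hlim
  have h5 := hlim.const_mul (2 / Real.pi)
  have h6 : 2 / Real.pi * (a * (Real.pi / 2)) = a := by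
    have := Real.pi_ne_zero; field_simp
  rw [h6] at h5
  refine h5.congr' ?_
  filter_upwards [self_mem_nhdsWithin] with ε hε
  exact (hscale ε hε).symm

/-- On a smooth boundary the normal derivatives of the regularized potentials converge boundedly. -/
lemma tendsto_integral_mul_normalDeriv_logPot {U : Set Plane} (hb : Bornology.IsBounded U)
    (hS : HasSmoothBoundary U) {c : Plane} (hc : c ∈ frontier U) {w : Plane → ℝ}
    (hw : ContinuousOn w (frontier U)) :
    Integrable (fun y => w y * (-(1 / Real.pi) *
        (inner ℝ (y - c) (outerNormal U y) / ‖y - c‖ ^ 2))) (arcLength U) ∧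
    Tendsto (fun ε : ℝ => ∫ y, w y * fderiv ℝ (logPot ε c) y (outerNormal U y) ∂arcLength U)
      (𝓝[>] 0) (𝓝 (∫ y, w y * (-(1 / Real.pi) *
        (inner ℝ (y - c) (outerNormal U y) / ‖y - c‖ ^ 2)) ∂arcLength U)) := by
  have hL := hS.hasLipschitzBoundary
  have := isFiniteMeasure_arcLength hb hL
  obtain ⟨C, hC0, hC⟩ := hS.exists_abs_inner_outerNormal_le hc
  have hwi := integrable_arcLength_of_continuousOn hb hL hw
  have hνm := aestronglyMeasurable_outerNormal hb hL
  have hmeas : ∀ ε : ℝ, AEStronglyMeasurable (fun y => w y * (-(1 / Real.pi) *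
      (inner ℝ (y - c) (outerNormal U y) / (‖y - c‖ ^ 2 + ε ^ 2)))) (arcLength U) := fun ε => by
    refine hwi.1.mul (AEStronglyMeasurable.const_mul ?_ _)
    simp only [div_eq_mul_inv]
    refine AEStronglyMeasurable.mul ?_ (Measurable.aestronglyMeasurable (by fun_prop))
    exact AEStronglyMeasurable.inner (by fun_prop) hνm
  -- The quadratic bound on the normal part of the chord cancels the denominator, uniformly in ε.
  have hbound : ∀ ε : ℝ, ∀ y ∈ frontier U, ‖w y * (-(1 / Real.pi) *
      (inner ℝ (y - c) (outerNormal U y) / (‖y - c‖ ^ 2 + ε ^ 2)))‖ ≤ ‖w y‖ * (1 / Real.pi * C) :=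
    fun ε y hy => by
      rw [norm_mul, norm_mul, norm_neg, Real.norm_of_nonneg (by positivity : 0 ≤ 1 / Real.pi)]
      refine mul_le_mul_of_nonneg_left (mul_le_mul_of_nonneg_left ?_ (by positivity)) (norm_nonneg _)
      rw [norm_div, Real.norm_of_nonneg (by positivity : 0 ≤ ‖y - c‖ ^ 2 + ε ^ 2)]
      refine div_le_of_le_mul₀ (by positivity) hC0 ((hC y hy).trans ?_)
      exact mul_le_mul_of_nonneg_left (by nlinarith [sq_nonneg ε]) hC0
  have hint := hwi.norm.mul_const (1 / Real.pi * C)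
  constructor
  · refine hint.mono' (by simpa using hmeas 0) ?_
    filter_upwards [ae_mem_frontier U] with y hy
    simpa using hbound 0 y hy
  · refine Tendsto.congr' (f₁ := fun ε : ℝ => ∫ y, w y * (-(1 / Real.pi) *
      (inner ℝ (y - c) (outerNormal U y) / (‖y - c‖ ^ 2 + ε ^ 2))) ∂arcLength U) ?_ ?_
    · filter_upwards [self_mem_nhdsWithin] with ε hε
      refine integral_congr_ae (ae_of_all _ fun y => ?_)
      simp only [fderiv_logPot_apply (norm_sub_sq_add_pos hε c y).ne']
    · refine tendsto_integral_filter_of_dominated_convergence _ (Eventually.of_forall hmeas)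
        (Eventually.of_forall fun ε => ?_) hint ?_
      · filter_upwards [ae_mem_frontier U] with y hy using hbound ε y hy
      · refine ae_of_all _ fun y => ?_
        -- At the pole the numerator vanishes, so both sides are zero for every ε.
        by_cases hyc : y = c
        · simp [hyc]
        have hpos : ‖y - c‖ ^ 2 + (0 : ℝ) ^ 2 ≠ 0 := by
          have : 0 < ‖y - c‖ := norm_pos_iff.2 (sub_ne_zero.2 hyc)
          positivity
        have hcont : ContinuousAt (fun ε : ℝ => w y * (-(1 / Real.pi) *
            (inner ℝ (y - c) (outerNormal U y) / (‖y - c‖ ^ 2 + ε ^ 2)))) 0 := by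
          refine continuousAt_const.mul (continuousAt_const.mul (continuousAt_const.div ?_ hpos))
          fun_prop
        simpa using hcont.tendsto.mono_left nhdsWithin_le_nhds

/-! ### Green's formula for the logarithmic potential with pole on the boundary -/

section GreenPole

variable {U : Set Plane} {w : Plane → ℝ} {G : Plane → Plane →L[ℝ] ℝ}

/-- The weight is merely integrable, so L² convergence of traces would not be enough; uniform
convergence supplies the dominating function. -/
lemma tendsto_integral_mul_of_tendstoUniformlyOn (hb : Bornology.IsBounded U)
    (hw : ContinuousOn w (closure U)) {φ : ℕ → Plane → ℝ} (hφ : ∀ n, Continuous (φ n))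
    (h : TendstoUniformlyOn φ w atTop (closure U)) {f : Plane → ℝ}
    (hf : Integrable f (arcLength U)) :
    Tendsto (fun n => ∫ y, φ n y * f y ∂arcLength U) atTop (𝓝 (∫ y, w y * f y ∂arcLength U)) := by
  obtain ⟨C, hC⟩ := hb.isCompact_closure.exists_bound_of_continuousOn hw
  refine tendsto_integral_filter_of_dominated_convergence (fun y => (C + 1) * ‖f y‖)
    (Eventually.of_forall fun n => (hφ n).aestronglyMeasurable.mul hf.1) ?_
    (hf.norm.const_mul _) ?_
  · filter_upwards [Metric.tendstoUniformlyOn_iff.1 h 1 one_pos] with n hn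
    filter_upwards [ae_mem_frontier U] with y hy
    have hy := frontier_subset_closure hy
    rw [norm_mul]
    refine mul_le_mul_of_nonneg_right ?_ (norm_nonneg _)
    have h1 := hn y hy
    rw [dist_comm, dist_eq_norm] at h1
    calc ‖φ n y‖ = ‖w y + (φ n y - w y)‖ := by congr 1; ring
      _ ≤ ‖w y‖ + ‖φ n y - w y‖ := norm_add_le _ _
      _ ≤ C + 1 := add_le_add (hC y hy) h1.le
  · filter_upwards [ae_mem_frontier U] with y hy
    exact (h.tendsto_at (frontier_subset_closure hy)).mul_const _

lemma continuous_laplacian {v : Plane → ℝ} (hv : ContDiff ℝ 2 v) :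
    Continuous (Laplacian.laplacian v) := by
  have : Laplacian.laplacian v = fun y =>
      ∑ i, fderiv ℝ (fun z => fderiv ℝ v z (stdBasis i)) y (stdBasis i) :=
    funext fun y => laplacian_eq_sum hv y
  rw [this]
  refine continuous_finsetSum _ fun i _ => ?_
  have h1 : ContDiff ℝ 1 (fun z => fderiv ℝ v z (stdBasis i)) :=
    (hv.fderiv_right (m := 1) (by norm_num)).clm_apply contDiff_const
  exact (h1.continuous_fderiv one_ne_zero).clm_apply continuous_const

/-- Green's formula for a function in `H¹` that is continuous up to the boundary. -/
theorem green_of_continuousOn (hb : Bornology.IsBounded U) (hU : IsOpen U)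
    (hL : HasLipschitzBoundary U) (h : IsH1 U w G) (hw : ContinuousOn w (closure U))
    {v : Plane → ℝ} (hv : ContDiff ℝ 2 v) :
    (∫ y in U, pair (fderiv ℝ v y) (G y)) + ∫ y in U, w y * Laplacian.laplacian v y =
      ∫ y, w y * fderiv ℝ v y (outerNormal U y) ∂arcLength U := by
  have := isFiniteMeasure_arcLength hb hL
  obtain ⟨φ, hφ, h0, h1, h2⟩ := exists_smooth_approx hb hU hL h
  have hφ1 : ∀ n, ContDiff ℝ 1 (φ n) := fun n => (hφ n).of_le (by exact_mod_cast le_top)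
  have hv' : Continuous (fderiv ℝ v) := hv.continuous_fderiv two_ne_zero
  have l1 := tendsto_integral_bilin pair (memLp_of_continuous hb hv' 2)
    (fun n => memLp_of_continuous hb ((hφ1 n).continuous_fderiv one_ne_zero) 2) h.memLp_deriv h1
  have l2 := tendsto_integral_bilin (ContinuousLinearMap.mul ℝ ℝ)
    (memLp_of_continuous hb (continuous_laplacian hv) 2)
    (fun n => memLp_of_continuous hb (hφ n).continuous 2) h.memLp h0
  have l3 := tendsto_integral_mul_of_tendstoUniformlyOn hb hw (fun n => (hφ n).continuous) (h2 hw)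
    ((memLp_fderiv_outerNormal hb hL hv').integrable (by norm_num))
  simp only [ContinuousLinearMap.mul_apply', mul_comm (Laplacian.laplacian v _)] at l2
  refine tendsto_nhds_unique (l1.add l2) (l3.congr fun n => (green hb hL (hφ1 n) hv).symm)

/-- Passing to the limit in Green's formula for the regularized potential with pole at a point `c` of
a smooth boundary. -/
theorem tendsto_integral_pair_logPot (hb : Bornology.IsBounded U) (hU : IsOpen U)
    (hS : HasSmoothBoundary U) (h : IsH1 U w G) (hw : ContinuousOn w (closure U)) {c : Plane}
    (hc : c ∈ frontier U) :
    Tendsto (fun ε : ℝ => ∫ y in U, pair (fderiv ℝ (logPot ε c) y) (G y)) (𝓝[>] 0)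
      (𝓝 ((∫ y, w y * (-(1 / Real.pi) *
        (inner ℝ (y - c) (outerNormal U y) / ‖y - c‖ ^ 2)) ∂arcLength U) + w c)) := by
  obtain ⟨n, hn⟩ := hS.exists_isOuterNormal hc
  obtain ⟨C, hC⟩ := hb.isCompact_closure.exists_bound_of_continuousOn hw
  have l1 := (tendsto_integral_mul_normalDeriv_logPot hb hS hc (hw.mono frontier_subset_closure)).2
  have l2 := tendsto_integral_mul_kernel hn hU.measurableSet (hw.mono subset_closure)
    (fun x hx => hC x (subset_closure hx))
    ((hw c (frontier_subset_closure hc)).mono_left (nhdsWithin_mono _ subset_closure))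
  refine (l1.add l2).congr' ?_
  filter_upwards [self_mem_nhdsWithin] with ε hε
  have h2 : ContDiff ℝ 2 (logPot ε c) :=
    (contDiff_logPot hε c).of_le (WithTop.coe_le_coe.2 (le_top : (2 : ℕ∞) ≤ ⊤))
  rw [← green_of_continuousOn hb hU hS.hasLipschitzBoundary h hw h2]
  simp only [laplacian_logPot hε, mul_neg, integral_neg]
  ring

end GreenPole

/-! ### Geometry of the inclusions -/

section Geometry

variable {m : ℕ} {Ω : Set Plane} {D : Fin m → Set Plane} {k : Fin m → ℝ}

lemma closure_iUnion_fin (D : Fin m → Set Plane) : closure (⋃ j, D j) = ⋃ j, closure (D j) :=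
  closure_iUnion_of_finite D

lemma IsInclusion.subset (hD : IsInclusion Ω D) (j : Fin m) : D j ⊆ Ω :=
  subset_closure.trans (hD.closure_subset j)

lemma IsInclusion.isBounded (hD : IsInclusion Ω D) (j : Fin m) : Bornology.IsBounded (D j) :=
  hD.isBounded_domain.subset (hD.subset j)

lemma IsInclusion.closure_iUnion_subset (hD : IsInclusion Ω D) : closure (⋃ j, D j) ⊆ Ω := by
  rw [closure_iUnion_fin]
  exact Set.iUnion_subset hD.closure_subset

lemma IsInclusion.notMem_of_frontier (hD : IsInclusion Ω D) {y : Plane} (hy : y ∈ frontier Ω) :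
    y ∉ Ω := fun h => by
  rw [hD.isOpen_domain.frontier_eq] at hy
  exact hy.2 h

lemma IsInclusion.ne_of_mem (hD : IsInclusion Ω D) {x c : Plane} (hx : x ∈ Ω)
    (hc : c ∈ frontier Ω) : x ≠ c := by
  rintro rfl
  exact hD.notMem_of_frontier hc hx

lemma IsInclusion.normal_eq_outerNormal (hD : IsInclusion Ω D) {y : Plane} (hy : y ∈ frontier Ω) :
    normal Ω D y = outerNormal Ω y := by
  refine outerNormal_congr ?_
  have : y ∈ (closure (⋃ j, D j))ᶜ := fun h =>
    hD.notMem_of_frontier hy (hD.closure_iUnion_subset h)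
  filter_upwards [isClosed_closure.isOpen_compl.mem_nhds this] with z hz
  exact ⟨fun h => h.1, fun h => ⟨h, hz⟩⟩

/-- The closures of the other inclusions and the complement of Ω stay away from ∂D_j. Near it, Ω
minus the closed inclusions is therefore the complement of the closure of D_j. -/
lemma IsInclusion.ae_normal_eq (hD : IsInclusion Ω D) (j : Fin m) :
    ∀ᵐ y ∂arcLength (D j), normal Ω D y = -outerNormal (D j) y := by
  filter_upwards [ae_isOuterNormal (hD.isBounded j) (hD.lipschitz j), ae_mem_frontier (D j)]
    with y hy hfr
  have hcl := frontier_subset_closure hfr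
  have hev : ∀ᶠ z in 𝓝 y, ∀ i, i ≠ j → z ∉ closure (D i) := by
    rw [eventually_all]
    intro i
    by_cases hij : i = j
    · exact Eventually.of_forall fun z h => absurd hij h
    · have : y ∈ (closure (D i))ᶜ := fun h => Set.disjoint_left.1 (hD.disjoint hij) h hcl
      filter_upwards [isClosed_closure.isOpen_compl.mem_nhds this] with z hz _ using hz
  refine (hy.compl_closure.congr ?_).outerNormal_eq
  filter_upwards [hev, hD.isOpen_domain.mem_nhds (hD.closure_subset j hcl)] with z hz hzΩ
  rw [closure_iUnion_fin]
  simp only [Set.mem_compl_iff, Set.mem_sdiff, Set.mem_iUnion, not_exists, hzΩ, true_and]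
  exact ⟨fun h i => by
    by_cases hij : i = j
    · rwa [hij]
    · exact hz i hij, fun h => h j⟩

/-- The contrast `γ - 1`. -/
def contrast (D : Fin m → Set Plane) (k : Fin m → ℝ) (x : Plane) : ℝ :=
  ∑ j, (D j).indicator (fun _ => k j - 1) x

lemma conductivity_eq (x : Plane) : conductivity D k x = 1 + contrast D k x := rfl

lemma IsInclusion.measurable_contrast (hD : IsInclusion Ω D) : Measurable (contrast D k) :=
  Finset.measurable_fun_sum _ fun j _ => measurable_const.indicator (hD.isOpen j).measurableSet

lemma abs_contrast_le (x : Plane) : |contrast D k x| ≤ ∑ j, |k j - 1| := by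
  refine (Finset.abs_sum_le_sum_abs _ _).trans (Finset.sum_le_sum fun j _ => ?_)
  by_cases hx : x ∈ D j <;> simp [hx]

lemma contrast_eq_zero {x : Plane} (hx : x ∉ ⋃ j, D j) : contrast D k x = 0 :=
  Finset.sum_eq_zero fun j _ => Set.indicator_of_notMem (fun h => hx (Set.mem_iUnion.2 ⟨j, h⟩)) _

lemma IsInclusion.integral_contrast_mul (hD : IsInclusion Ω D) {f : Plane → ℝ}
    (hf : ∀ j, IntegrableOn f (D j)) :
    ∫ x in Ω, contrast D k x * f x = ∑ j, (k j - 1) * ∫ x in D j, f x := by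
  have h1 : ∀ x, contrast D k x * f x = ∑ j, (D j).indicator (fun x => (k j - 1) * f x) x :=
    fun x => by
      rw [contrast, Finset.sum_mul]
      refine Finset.sum_congr rfl fun j _ => ?_
      by_cases hx : x ∈ D j <;> simp [hx]
  simp only [h1]
  rw [integral_finsetSum]
  · refine Finset.sum_congr rfl fun j _ => ?_
    rw [setIntegral_indicator (hD.isOpen j).measurableSet, Set.inter_eq_right.2 (hD.subset j),
      integral_const_mul]
  · intro j _
    have h2 : IntegrableOn (fun x => (k j - 1) * f x) (D j) := (hf j).const_mul _
    exact (h2.integrable_indicator (hD.isOpen j).measurableSet).integrableOn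

lemma MemLp.contrast_smul {E : Type*} [NormedAddCommGroup E] [NormedSpace ℝ E]
    (hD : IsInclusion Ω D) {μ : Measure Plane} {f : Plane → E} (hf : MemLp f 2 μ) :
    MemLp (fun x => contrast D k x • f x) 2 μ := by
  refine hf.of_le_mul (c := ∑ j, |k j - 1|)
    (hD.measurable_contrast.aestronglyMeasurable.smul hf.1) (ae_of_all _ fun x => ?_)
  rw [norm_smul]
  exact mul_le_mul_of_nonneg_right (abs_contrast_le x) (norm_nonneg _)

/-- The poles have positive distance from the inclusions, so (γ - 1)∇V is bounded although ∇V is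
not. -/
lemma IsInclusion.exists_dist_le (hD : IsInclusion Ω D) {c : Plane} (hc : c ∈ frontier Ω) :
    ∃ d > 0, ∀ x ∈ ⋃ j, D j, d ≤ ‖x - c‖ := by
  have : c ∈ (closure (⋃ j, D j))ᶜ := fun h =>
    hD.notMem_of_frontier hc (hD.closure_iUnion_subset h)
  obtain ⟨d, hd, hsub⟩ := Metric.isOpen_iff.1 isClosed_closure.isOpen_compl c this
  refine ⟨d, hd, fun x hx => ?_⟩
  by_contra! hlt
  exact hsub (by rwa [Metric.mem_ball, dist_eq_norm]) (subset_closure hx)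

end Geometry

/-! ### The potential of the dipole -/

section Dipole

lemma logPot_zero (c x : Plane) : logPot 0 c x = -(1 / Real.pi) * Real.log ‖x - c‖ := by
  rw [logPot, zero_pow two_ne_zero, add_zero, Real.log_pow]
  push_cast
  field_simp

lemma potV_eq (P Q : Plane) : potV P Q = fun x => logPot 0 P x - logPot 0 Q x := by
  funext x
  rw [potV, logPot_zero, logPot_zero, norm_sub_rev P, norm_sub_rev Q]
  ring

lemma fderiv_potV {P Q x : Plane} (hP : x ≠ P) (hQ : x ≠ Q) :
    fderiv ℝ (potV P Q) x = fderiv ℝ (logPot 0 P) x - fderiv ℝ (logPot 0 Q) x := by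
  have h : ∀ {c : Plane}, x ≠ c → ‖x - c‖ ^ 2 + (0 : ℝ) ^ 2 ≠ 0 := fun h => by
    have := norm_pos_iff.2 (sub_ne_zero.2 h)
    positivity
  rw [potV_eq]
  exact fderiv_fun_sub (hasFDerivAt_logPot (h hP)).differentiableAt
    (hasFDerivAt_logPot (h hQ)).differentiableAt

lemma contDiffAt_potV {P Q x : Plane} (hP : x ≠ P) (hQ : x ≠ Q) :
    ContDiffAt ℝ (⊤ : ℕ∞) (potV P Q) x := by
  have h : ∀ {c : Plane}, x ≠ c → ‖x - c‖ ^ 2 + (0 : ℝ) ^ 2 ≠ 0 := fun h => by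
    have := norm_pos_iff.2 (sub_ne_zero.2 h)
    positivity
  rw [potV_eq]
  exact (contDiffAt_logPot (h hP)).sub (contDiffAt_logPot (h hQ))

lemma fluxPsi_eq (ν : Plane → Plane) (P Q y : Plane) : fluxPsi ν P Q y =
    -(1 / Real.pi) * (inner ℝ (y - P) (ν y) / ‖y - P‖ ^ 2) -
      -(1 / Real.pi) * (inner ℝ (y - Q) (ν y) / ‖y - Q‖ ^ 2) := by
  rw [fluxPsi, inner_sub_left, real_inner_smul_left, real_inner_smul_left]
  ring

lemma norm_fderiv_logPot_le (ε : ℝ) {c x : Plane} {d : ℝ} (hd : 0 < d) (hx : d ≤ ‖x - c‖) :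
    ‖fderiv ℝ (logPot ε c) x‖ ≤ 1 / Real.pi * d⁻¹ := by
  have hpos : 0 < ‖x - c‖ := hd.trans_le hx
  have h : ‖x - c‖ ^ 2 + ε ^ 2 ≠ 0 := by positivity
  rw [(hasFDerivAt_logPot h).fderiv, norm_smul, innerSL_apply_norm, norm_mul, norm_neg,
    Real.norm_of_nonneg (by positivity : 0 ≤ 1 / Real.pi),
    Real.norm_of_nonneg (by positivity : 0 ≤ (‖x - c‖ ^ 2 + ε ^ 2)⁻¹), mul_assoc]
  refine mul_le_mul_of_nonneg_left ?_ (by positivity)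
  rw [inv_mul_eq_div, div_le_iff₀ (by positivity), inv_mul_eq_div, le_div_iff₀ hd]
  nlinarith [sq_nonneg ε]

variable {m : ℕ} {Ω : Set Plane} {D : Fin m → Set Plane} {k : Fin m → ℝ}

lemma norm_contrast_smul_fderiv_logPot_le {c : Plane} {d : ℝ} (hd : 0 < d)
    (hdist : ∀ x ∈ ⋃ j, D j, d ≤ ‖x - c‖) (ε : ℝ) (x : Plane) :
    ‖contrast D k x • fderiv ℝ (logPot ε c) x‖ ≤ (∑ j, |k j - 1|) * (1 / Real.pi * d⁻¹) := by
  have hs : 0 ≤ ∑ j, |k j - 1| := Finset.sum_nonneg fun _ _ => abs_nonneg _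
  by_cases hx : x ∈ ⋃ j, D j
  · rw [norm_smul]
    exact mul_le_mul (abs_contrast_le x) (norm_fderiv_logPot_le ε hd (hdist x hx)) (norm_nonneg _) hs
  · rw [contrast_eq_zero hx, zero_smul, norm_zero]
    positivity

lemma IsInclusion.memLp_contrast_smul_fderiv_logPot (hD : IsInclusion Ω D) {c : Plane}
    (hc : c ∈ frontier Ω) (ε : ℝ) :
    MemLp (fun x => contrast D k x • fderiv ℝ (logPot ε c) x) 2 (volume.restrict Ω) := by
  have := isFiniteMeasure_restrict hD.isBounded_domain
  obtain ⟨d, hd, hdist⟩ := hD.exists_dist_le hc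
  refine MemLp.of_bound (hD.measurable_contrast.aestronglyMeasurable.smul
    (measurable_fderiv ℝ _).aestronglyMeasurable) _
    (ae_of_all _ (norm_contrast_smul_fderiv_logPot_le hd hdist ε))

/-- The contrast vanishes near the pole, so the regularized gradients are dominated uniformly in ε
and converge pointwise where it does not vanish. -/
lemma IsInclusion.tendsto_integral_contrast_pair_logPot (hD : IsInclusion Ω D) {c : Plane}
    (hc : c ∈ frontier Ω) {G : Plane → Plane →L[ℝ] ℝ} (hG : MemLp G 2 (volume.restrict Ω)) :
    Tendsto (fun ε : ℝ => ∫ x in Ω, pair (contrast D k x • fderiv ℝ (logPot ε c) x) (G x)) (𝓝[>] 0)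
      (𝓝 (∫ x in Ω, pair (contrast D k x • fderiv ℝ (logPot 0 c) x) (G x))) := by
  have := isFiniteMeasure_restrict hD.isBounded_domain
  obtain ⟨d, hd, hdist⟩ := hD.exists_dist_le hc
  refine tendsto_integral_filter_of_dominated_convergence
    (fun x => (∑ j, |k j - 1|) * (1 / Real.pi * d⁻¹) * ‖G x‖) (Eventually.of_forall fun ε =>
      (integrable_bilin pair (hD.memLp_contrast_smul_fderiv_logPot hc ε) hG).1)
    (Eventually.of_forall fun ε => ae_of_all _ fun x => ?_)
    ((hG.integrable (by norm_num)).norm.const_mul _) (ae_of_all _ fun x => ?_)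
  · exact (abs_pair_le _ _).trans (mul_le_mul_of_nonneg_right
      (norm_contrast_smul_fderiv_logPot_le hd hdist ε x) (norm_nonneg _))
  · by_cases hx : x ∈ ⋃ j, D j
    · have hpos : 0 < ‖x - c‖ := hd.trans_le (hdist x hx)
      have hne : ∀ ε : ℝ, ‖x - c‖ ^ 2 + ε ^ 2 ≠ 0 := fun ε => by positivity
      have hcont : Continuous fun ε : ℝ => fderiv ℝ (logPot ε c) x := by
        have : (fun ε : ℝ => fderiv ℝ (logPot ε c) x) = fun ε =>
            (-(1 / Real.pi) * (‖x - c‖ ^ 2 + ε ^ 2)⁻¹) • innerSL ℝ (x - c) :=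
          funext fun ε => (hasFDerivAt_logPot (hne ε)).fderiv
        rw [this]
        exact (continuous_const.mul ((by fun_prop : Continuous fun ε : ℝ =>
          ‖x - c‖ ^ 2 + ε ^ 2).inv₀ hne)).smul continuous_const
      have h2 : Continuous fun ε : ℝ => pair (contrast D k x • fderiv ℝ (logPot ε c) x) (G x) := by
        have h3 : Continuous fun ε : ℝ => pair (fderiv ℝ (logPot ε c) x) (G x) :=
          (pair.continuous.comp hcont).clm_apply continuous_const
        simp only [map_smul, smul_apply, smul_eq_mul]
        exact continuous_const.mul h3
      exact (h2.tendsto 0).mono_left nhdsWithin_le_nhds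
    · simp [contrast_eq_zero hx]

end Dipole

/-! ### The dipole identity -/

section DipoleIdentity

variable {m : ℕ} {Ω : Set Plane} {D : Fin m → Set Plane} {k : Fin m → ℝ} {P Q : Plane}
  {e u u₁ : Plane → ℝ} {Ge Gu G₁ : Plane → Plane →L[ℝ] ℝ}

lemma abs_conductivity_le (x : Plane) : |conductivity D k x| ≤ 1 + ∑ j, |k j - 1| := by
  rw [conductivity_eq]
  exact (abs_add_le _ _).trans (add_le_add (by simp) (abs_contrast_le x))

lemma MemLp.conductivity_smul {E : Type*} [NormedAddCommGroup E] [NormedSpace ℝ E]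
    (hD : IsInclusion Ω D) {μ : Measure Plane} {f : Plane → E} (hf : MemLp f 2 μ) :
    MemLp (fun x => conductivity D k x • f x) 2 μ := by
  refine hf.of_le_mul (c := 1 + ∑ j, |k j - 1|)
    ((hD.measurable_contrast.const_add 1).aestronglyMeasurable.smul hf.1) (ae_of_all _ fun x => ?_)
  rw [norm_smul]
  exact mul_le_mul_of_nonneg_right (abs_conductivity_le x) (norm_nonneg _)

lemma pair_smul_left (a : ℝ) (ℓ ℓ' : Plane →L[ℝ] ℝ) : pair (a • ℓ) ℓ' = a * pair ℓ ℓ' := by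
  simp

lemma IsInclusion.memLp_contrast_smul_fderiv_potV (hD : IsInclusion Ω D) (hP : P ∈ frontier Ω)
    (hQ : Q ∈ frontier Ω) :
    MemLp (fun x => contrast D k x • fderiv ℝ (potV P Q) x) 2 (volume.restrict Ω) := by
  refine ((hD.memLp_contrast_smul_fderiv_logPot (k := k) hP 0).sub
    (hD.memLp_contrast_smul_fderiv_logPot (k := k) hQ 0)).ae_eq ?_
  filter_upwards [ae_restrict_mem hD.isOpen_domain.measurableSet] with x hx
  rw [Pi.sub_apply, fderiv_potV (hD.ne_of_mem hx hP) (hD.ne_of_mem hx hQ), smul_sub]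

lemma integral_pair_sub {μ : Measure Plane} {A B B' : Plane → Plane →L[ℝ] ℝ} (hA : MemLp A 2 μ)
    (hB : MemLp B 2 μ) (hB' : MemLp B' 2 μ) :
    ∫ x, pair (A x) ((B - B') x) ∂μ = (∫ x, pair (A x) (B x) ∂μ) - ∫ x, pair (A x) (B' x) ∂μ := by
  rw [← integral_sub (integrable_bilin pair hA hB) (integrable_bilin pair hA hB')]
  simp

lemma integral_pair_conductivity {μ : Measure Plane} (hD : IsInclusion Ω D)
    {A B : Plane → Plane →L[ℝ] ℝ} (hA : MemLp A 2 μ) (hB : MemLp B 2 μ) :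
    ∫ x, pair (conductivity D k x • A x) (B x) ∂μ =
      (∫ x, pair (A x) (B x) ∂μ) + ∫ x, pair (contrast D k x • A x) (B x) ∂μ := by
  rw [← integral_add (integrable_bilin pair hA hB)
    (integrable_bilin pair (MemLp.contrast_smul hD hA) hB)]
  refine integral_congr_ae (ae_of_all _ fun x => ?_)
  simp only [pair_smul_left, conductivity_eq]
  ring

/-- The value at a boundary point of the difference of two solutions with the same datum. -/
lemma IsInclusion.value_at_pole (hD : IsInclusion Ω D) {c : Plane} (hc : c ∈ frontier Ω)
    (hu : IsH1 Ω u Gu) (hu₁ : IsH1 Ω u₁ G₁) (hw : ContinuousOn (u - u₁) (closure Ω))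
    (hγ : ∀ φ : Plane → ℝ, ContDiff ℝ (⊤ : ℕ∞) φ →
      ∫ x in Ω, pair (conductivity D k x • Gu x) (fderiv ℝ φ x) =
        ∫ x in Ω, pair (G₁ x) (fderiv ℝ φ x)) :
    (∫ y, (u - u₁) y * (-(1 / Real.pi) *
        (inner ℝ (y - c) (outerNormal Ω y) / ‖y - c‖ ^ 2)) ∂arcLength Ω) + (u - u₁) c =
      -∫ x in Ω, pair (contrast D k x • fderiv ℝ (logPot 0 c) x) (Gu x) := by
  have l1 := tendsto_integral_pair_logPot hD.isBounded_domain hD.isOpen_domain hD.smooth_domain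
    (hu.sub hD.isBounded_domain hu₁) hw hc
  have l2 := (hD.tendsto_integral_contrast_pair_logPot (k := k) hc hu.memLp_deriv).neg
  refine tendsto_nhds_unique l1 (l2.congr' ?_)
  filter_upwards [self_mem_nhdsWithin] with ε hε
  have hV : ContDiff ℝ 1 (logPot ε c) := (contDiff_logPot hε c).of_le (by exact_mod_cast le_top)
  have hVm := memLp_of_continuous hD.isBounded_domain (hV.continuous_fderiv one_ne_zero) 2
  -- The regularized potential is a legitimate smooth test function. Writing γ = 1 + (γ - 1) turns
  -- the equality of fluxes into ∫ ∇logPot · ∇w = -∫ (γ - 1) ∇logPot · ∇u.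
  have h1 := hγ _ (contDiff_logPot hε c)
  rw [integral_pair_conductivity hD hu.memLp_deriv hVm] at h1
  rw [integral_pair_sub hVm hu.memLp_deriv hu₁.memLp_deriv]
  simp only [pair_smul_left, pair_comm (fderiv ℝ (logPot ε c) _)] at h1 ⊢
  linarith

/-- `hA`, `hB` and `hC` below are the identities (A), (B) and (C); the conclusion is linear algebra
in them, using the symmetry of the energy forms. -/
theorem IsInclusion.dipole_identity (hD : IsInclusion Ω D) (hP : P ∈ frontier Ω)
    (hQ : Q ∈ frontier Ω) (he : IsH1 Ω e Ge)
    (hcorr : ∀ φ : Plane → ℝ, ContDiff ℝ (⊤ : ℕ∞) φ →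
      ∫ x in Ω, pair (conductivity D k x • Ge x) (fderiv ℝ φ x) =
        -(∫ x in Ω, pair (contrast D k x • fderiv ℝ (potV P Q) x) (fderiv ℝ φ x))
          - ∫ y, φ y * fluxPsi (outerNormal Ω) P Q y ∂(arcLength Ω))
    (hu : IsH1 Ω u Gu) (hu₁ : IsH1 Ω u₁ G₁) (hw : ContinuousOn (u - u₁) (closure Ω))
    (hγ : ∀ φ : Plane → ℝ, ContDiff ℝ (⊤ : ℕ∞) φ →
      ∫ x in Ω, pair (conductivity D k x • Gu x) (fderiv ℝ φ x) =
        ∫ x in Ω, pair (G₁ x) (fderiv ℝ φ x)) :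
    (u - u₁) P - (u - u₁) Q =
      -(∫ x in Ω, pair (contrast D k x • fderiv ℝ (potV P Q) x) (G₁ x))
        - ∫ x in Ω, pair (contrast D k x • Ge x) (G₁ x) := by
  have hb := hD.isBounded_domain
  have hL := hD.smooth_domain.hasLipschitzBoundary
  have hwH := hu.sub hb hu₁
  have hVm := hD.memLp_contrast_smul_fderiv_potV (k := k) hP hQ
  have hsm : ∀ {φ : Plane → ℝ}, ContDiff ℝ (⊤ : ℕ∞) φ →
      MemLp (fderiv ℝ φ) 2 (volume.restrict Ω) := fun hφ =>
    memLp_of_continuous hb (hφ.continuous_fderiv (by simp)) 2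
  -- Ψ is the difference of two pole terms, each integrable against continuous functions by the
  -- chord estimate.
  have hΨ : ∀ {w : Plane → ℝ}, ContinuousOn w (frontier Ω) →
      Integrable (fun y => w y * fluxPsi (outerNormal Ω) P Q y) (arcLength Ω) ∧
      ∫ y, w y * fluxPsi (outerNormal Ω) P Q y ∂arcLength Ω =
      (∫ y, w y * (-(1 / Real.pi) *
        (inner ℝ (y - P) (outerNormal Ω y) / ‖y - P‖ ^ 2)) ∂arcLength Ω) -
      ∫ y, w y * (-(1 / Real.pi) *
        (inner ℝ (y - Q) (outerNormal Ω y) / ‖y - Q‖ ^ 2)) ∂arcLength Ω := fun hw => by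
    have i1 := (tendsto_integral_mul_normalDeriv_logPot hb hD.smooth_domain hP hw).1
    have i2 := (tendsto_integral_mul_normalDeriv_logPot hb hD.smooth_domain hQ hw).1
    simp only [fluxPsi_eq, mul_sub]
    exact ⟨i1.sub i2, integral_sub i1 i2⟩
  have hA : (∫ y, (u - u₁) y * fluxPsi (outerNormal Ω) P Q y ∂arcLength Ω) +
      ((u - u₁) P - (u - u₁) Q) =
      -∫ x in Ω, pair (contrast D k x • fderiv ℝ (potV P Q) x) (Gu x) := by
    have p1 := hD.value_at_pole hP hu hu₁ hw hγ
    have p2 := hD.value_at_pole hQ hu hu₁ hw hγ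
    have p3 : ∫ x in Ω, pair (contrast D k x • fderiv ℝ (potV P Q) x) (Gu x) =
        (∫ x in Ω, pair (contrast D k x • fderiv ℝ (logPot 0 P) x) (Gu x)) -
          ∫ x in Ω, pair (contrast D k x • fderiv ℝ (logPot 0 Q) x) (Gu x) := by
      rw [← integral_sub
        (integrable_bilin pair (hD.memLp_contrast_smul_fderiv_logPot hP 0) hu.memLp_deriv)
        (integrable_bilin pair (hD.memLp_contrast_smul_fderiv_logPot hQ 0) hu.memLp_deriv)]
      refine setIntegral_congr_fun hD.isOpen_domain.measurableSet fun x hx => ?_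
      simp only [fderiv_potV (hD.ne_of_mem hx hP) (hD.ne_of_mem hx hQ), pair_smul_left, map_sub,
        sub_apply, mul_sub]
    rw [(hΨ (hw.mono frontier_subset_closure)).2, p3]
    linarith
  -- The corrector equation extended to the test function w = u - u₁; uniform convergence of the
  -- approximations takes care of the boundary term.
  have hB : ∫ x in Ω, pair (conductivity D k x • Ge x) ((Gu - G₁) x) =
      -(∫ x in Ω, pair (contrast D k x • fderiv ℝ (potV P Q) x) ((Gu - G₁) x))
        - ∫ y, (u - u₁) y * fluxPsi (outerNormal Ω) P Q y ∂(arcLength Ω) := by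
    obtain ⟨φ, hφ, -, h1, h2⟩ := exists_smooth_approx hb hD.isOpen_domain hL hwH
    have l1 := tendsto_integral_bilin pair (MemLp.conductivity_smul (k := k) hD he.memLp_deriv)
      (fun n => hsm (hφ n)) hwH.memLp_deriv h1
    have l2 := tendsto_integral_bilin pair hVm (fun n => hsm (hφ n)) hwH.memLp_deriv h1
    have l3 := tendsto_integral_mul_of_tendstoUniformlyOn hb hw (fun n => (hφ n).continuous) (h2 hw)
      (by simpa using (hΨ (w := fun _ => 1) continuousOn_const).1)
    exact tendsto_nhds_unique l1 ((l2.neg.sub l3).congr fun n => (hcorr _ (hφ n)).symm)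
  -- Equality of the two fluxes extended to the corrector as test function. No boundary term
  -- remains, so convergence of gradients is enough.
  have hC : ∫ x in Ω, pair (conductivity D k x • Gu x) (Ge x) = ∫ x in Ω, pair (G₁ x) (Ge x) := by
    obtain ⟨φ, hφ, -, h1, -⟩ := exists_smooth_approx hb hD.isOpen_domain hL he
    have l1 := tendsto_integral_bilin pair (MemLp.conductivity_smul (k := k) hD hu.memLp_deriv)
      (fun n => hsm (hφ n)) he.memLp_deriv h1
    have l2 := tendsto_integral_bilin pair hu₁.memLp_deriv (fun n => hsm (hφ n)) he.memLp_deriv h1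
    exact tendsto_nhds_unique l1 (l2.congr fun n => (hγ _ (hφ n)).symm)
  rw [integral_pair_sub (MemLp.conductivity_smul hD he.memLp_deriv) hu.memLp_deriv hu₁.memLp_deriv,
    integral_pair_sub hVm hu.memLp_deriv hu₁.memLp_deriv,
    integral_pair_conductivity hD he.memLp_deriv hu₁.memLp_deriv] at hB
  have hsym : ∫ x in Ω, pair (conductivity D k x • Ge x) (Gu x) =
      ∫ x in Ω, pair (conductivity D k x • Gu x) (Ge x) := by
    simp only [pair_smul_left, pair_comm (Ge _)]
  have hsym' : ∫ x in Ω, pair (Ge x) (G₁ x) = ∫ x in Ω, pair (G₁ x) (Ge x) := by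
    simp only [pair_comm (Ge _)]
  rw [hsym, hC, hsym'] at hB
  linarith

/-- Weak solutions of the Neumann problem with the same datum have the same gradient. -/
lemma ae_eq_of_integral_pair_eq (hb : Bornology.IsBounded Ω) (hΩ : IsOpen Ω)
    (hL : HasLipschitzBoundary Ω) {v : Plane → ℝ} {Gv : Plane → Plane →L[ℝ] ℝ}
    (hu₁ : IsH1 Ω u₁ G₁) (hv : IsH1 Ω v Gv)
    (h : ∀ φ : Plane → ℝ, ContDiff ℝ (⊤ : ℕ∞) φ →
      ∫ x in Ω, pair (G₁ x) (fderiv ℝ φ x) = ∫ x in Ω, pair (Gv x) (fderiv ℝ φ x)) :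
    G₁ =ᵐ[volume.restrict Ω] Gv := by
  have hz := hu₁.sub hb hv
  obtain ⟨φ, hφ, -, h1, -⟩ := exists_smooth_approx hb hΩ hL hz
  have hsm : ∀ n, MemLp (fderiv ℝ (φ n)) 2 (volume.restrict Ω) := fun n =>
    memLp_of_continuous hb ((hφ n).continuous_fderiv (by simp)) 2
  have l1 := tendsto_integral_bilin pair hu₁.memLp_deriv hsm hz.memLp_deriv h1
  have l2 := tendsto_integral_bilin pair hv.memLp_deriv hsm hz.memLp_deriv h1
  have h2 := tendsto_nhds_unique l1 (l2.congr fun n => (h _ (hφ n)).symm)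
  have h3 : ∫ x in Ω, pair ((G₁ - Gv) x) ((G₁ - Gv) x) = 0 := by
    have h4 := integral_sub (integrable_bilin pair hu₁.memLp_deriv hz.memLp_deriv)
      (integrable_bilin pair hv.memLp_deriv hz.memLp_deriv)
    rw [h2, sub_self] at h4
    rw [← h4]
    simp
  rw [integral_eq_zero_iff_of_nonneg
    (fun x => by simp only [pair_self]; exact sq_nonneg _)
    (integrable_bilin pair hz.memLp_deriv hz.memLp_deriv)] at h3
  filter_upwards [h3] with x hx
  simp only [pair_self, Pi.zero_apply, Pi.sub_apply] at hx
  exact sub_eq_zero.1 (norm_eq_zero.1 (pow_eq_zero_iff two_ne_zero |>.1 hx))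

end DipoleIdentity

/-! ### Representation by boundary integrals over the inclusions -/

section Representation

variable {m : ℕ} {Ω : Set Plane} {D : Fin m → Set Plane} {k : Fin m → ℝ} {P Q : Plane}
  {e 𝒟 u u₁ v : Plane → ℝ} {Ge Gu G₁ Gv : Plane → Plane →L[ℝ] ℝ}

/-- On the closure of D_j the potential V is smooth, because the poles lie on ∂Ω. It can be replaced
there by a function smooth on the whole plane, which is in H¹ of any bounded set. -/
lemma IsInclusion.exists_isH1_dipole (hD : IsInclusion Ω D) (hP : P ∈ frontier Ω)
    (hQ : Q ∈ frontier Ω) (he : IsH1 Ω e Ge) (h𝒟 : ∀ x ∈ Ω, 𝒟 x = potV P Q x + e x) (j : Fin m) :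
    ∃ G, IsH1 (D j) 𝒟 G ∧ ∀ x ∈ D j, G x = fderiv ℝ (potV P Q) x + Ge x := by
  obtain ⟨V, hV, hVeq⟩ := exists_contDiff_extension (n := ⊤) (hD.isBounded j).isCompact_closure
    hD.isOpen_domain (hD.closure_subset j)
    (fun x hx => contDiffAt_potV (hD.ne_of_mem hx hP) (hD.ne_of_mem hx hQ))
  have h1 := (isH1_of_contDiff (hD.isBounded j) (hV.of_le (by exact_mod_cast le_top))).add
    (hD.isBounded j) (he.mono (hD.subset j))
  refine ⟨_, h1.congr ?_, fun x hx => ?_⟩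
  · filter_upwards [ae_restrict_mem (hD.isOpen j).measurableSet] with x hx
    rw [Pi.add_apply, h𝒟 x (hD.subset j hx), (hVeq x (subset_closure hx)).self_of_nhds]
  · rw [Pi.add_apply, (hVeq x (subset_closure hx)).fderiv_eq]

theorem IsInclusion.isTrace_dipole (hD : IsInclusion Ω D) (hP : P ∈ frontier Ω)
    (hQ : Q ∈ frontier Ω) (he : IsH1 Ω e Ge) (h𝒟 : ∀ x ∈ Ω, 𝒟 x = potV P Q x + e x) (j : Fin m) :
    IsTrace (D j) 𝒟 (boundaryTrace (D j) 𝒟) := by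
  obtain ⟨G, hG, -⟩ := hD.exists_isH1_dipole hP hQ he h𝒟 j
  obtain ⟨φ, hφ, h0, h1, -⟩ := exists_smooth_approx (hD.isBounded j) (hD.isOpen j) (hD.lipschitz j) hG
  exact isTrace_boundaryTrace (exists_isTrace (hD.isBounded j) (hD.lipschitz j) hG hφ h0 h1)

/-- The energy over one inclusion as a boundary integral. -/
lemma IsInclusion.integral_pair_dipole (hD : IsInclusion Ω D) (hP : P ∈ frontier Ω)
    (hQ : Q ∈ frontier Ω) (he : IsH1 Ω e Ge) (h𝒟 : ∀ x ∈ Ω, 𝒟 x = potV P Q x + e x)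
    (hv : IsH1 Ω v Gv) (hv2 : ∀ x ∈ Ω, ContDiffAt ℝ 2 v x)
    (hΔ : ∀ x ∈ Ω, Laplacian.laplacian v x = 0) (j : Fin m) :
    IntegrableOn (fun x => pair (fderiv ℝ (potV P Q) x + Ge x) (Gv x)) (D j) ∧
    Integrable (fun y => boundaryTrace (D j) 𝒟 y * fderiv ℝ v y (normal Ω D y))
      (arcLength (D j)) ∧
    ∫ x in D j, pair (fderiv ℝ (potV P Q) x + Ge x) (Gv x) =
      -∫ y, boundaryTrace (D j) 𝒟 y * fderiv ℝ v y (normal Ω D y) ∂arcLength (D j) := by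
  have hb := hD.isBounded j
  have hL := hD.lipschitz j
  have hT := hD.isTrace_dipole hP hQ he h𝒟 j
  obtain ⟨G, hG, hGeq⟩ := hD.exists_isH1_dipole hP hQ he h𝒟 j
  -- `v` is C² only near points of Ω, whereas Green's formula asks for a globally C² function; the
  -- two agree near the closure of D_j.
  obtain ⟨v', hv', hveq⟩ := exists_contDiff_extension (n := 2) hb.isCompact_closure
    hD.isOpen_domain (hD.closure_subset j) (v := v) hv2
  have hv'2 : ContDiff ℝ 2 v' := hv'
  have hmem := ae_restrict_mem (μ := (volume : Measure Plane)) (hD.isOpen j).measurableSet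
  have hGv : Gv =ᵐ[volume.restrict (D j)] fderiv ℝ v' :=
    (hv.mono (hD.subset j)).ae_eq_deriv (hD.isOpen j) hb
      (isH1_of_contDiff hb (hv'2.of_le one_le_two)) (by
        filter_upwards [hmem] with x hx
        exact (hveq x (subset_closure hx)).self_of_nhds.symm)
  have h1 : (fun x => pair (fderiv ℝ (potV P Q) x + Ge x) (Gv x)) =ᵐ[volume.restrict (D j)]
      fun x => pair (fderiv ℝ v' x) (G x) := by
    filter_upwards [hmem, hGv] with x hx hx'
    rw [hGeq x hx, hx', pair_comm]
  have h2 : (fun y => boundaryTrace (D j) 𝒟 y * fderiv ℝ v y (normal Ω D y))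
      =ᵐ[arcLength (D j)]
      fun y => -(boundaryTrace (D j) 𝒟 y * fderiv ℝ v' y (outerNormal (D j) y)) := by
    filter_upwards [hD.ae_normal_eq j, ae_mem_frontier (D j)] with y hy hy'
    rw [hy, (hveq y (frontier_subset_closure hy')).fderiv_eq, map_neg, mul_neg]
  have hv'c : Continuous (fderiv ℝ v') := hv'2.continuous_fderiv two_ne_zero
  refine ⟨(integrable_bilin pair (memLp_of_continuous hb hv'c 2) hG.memLp_deriv).congr h1.symm,
    (integrable_bilin (ContinuousLinearMap.mul ℝ ℝ) hT.1
      (memLp_fderiv_outerNormal hb hL hv'c)).neg.congr h2.symm, ?_⟩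
  rw [integral_congr_ae h1, integral_congr_ae h2, integral_neg, neg_neg]
  refine green_trace (hD.isOpen j) hb hL hG hT hv'2 fun x hx => ?_
  rw [(InnerProductSpace.laplacian_congr_nhds (hveq x (subset_closure hx))).self_of_nhds]
  exact hΔ x (hD.subset j hx)

/-- Combines the dipole identity with Green's formula on each inclusion, after replacing the
gradient of u₁ by that of v. The contrast localizes the integral over Ω to the D_j. -/
theorem IsInclusion.representation (hD : IsInclusion Ω D) (hP : P ∈ frontier Ω)
    (hQ : Q ∈ frontier Ω) (he : IsH1 Ω e Ge)
    (hcorr : ∀ φ : Plane → ℝ, ContDiff ℝ (⊤ : ℕ∞) φ →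
      ∫ x in Ω, pair (conductivity D k x • Ge x) (fderiv ℝ φ x) =
        -(∫ x in Ω, pair (contrast D k x • fderiv ℝ (potV P Q) x) (fderiv ℝ φ x))
          - ∫ y, φ y * fluxPsi (outerNormal Ω) P Q y ∂(arcLength Ω))
    (h𝒟 : ∀ x ∈ Ω, 𝒟 x = potV P Q x + e x)
    (hu : IsH1 Ω u Gu) (hu₁ : IsH1 Ω u₁ G₁) (hw : ContinuousOn (u - u₁) (closure Ω))
    (hγ : ∀ φ : Plane → ℝ, ContDiff ℝ (⊤ : ℕ∞) φ →
      ∫ x in Ω, pair (conductivity D k x • Gu x) (fderiv ℝ φ x) =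
        ∫ x in Ω, pair (G₁ x) (fderiv ℝ φ x))
    (hv : IsH1 Ω v Gv) (hv2 : ∀ x ∈ Ω, ContDiffAt ℝ 2 v x)
    (hΔ : ∀ x ∈ Ω, Laplacian.laplacian v x = 0)
    (h₁ : ∀ φ : Plane → ℝ, ContDiff ℝ (⊤ : ℕ∞) φ →
      ∫ x in Ω, pair (G₁ x) (fderiv ℝ φ x) = ∫ x in Ω, pair (Gv x) (fderiv ℝ φ x)) :
    (u - u₁) P - (u - u₁) Q = ∑ j, (k j - 1) *
      ∫ y, boundaryTrace (D j) 𝒟 y * fderiv ℝ v y (normal Ω D y) ∂arcLength (D j) := by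
  -- Solutions with the same datum may differ by a constant, but only the gradient enters the
  -- energy.
  have hG := ae_eq_of_integral_pair_eq hD.isBounded_domain hD.isOpen_domain
    hD.smooth_domain.hasLipschitzBoundary hu₁ hv h₁
  rw [hD.dipole_identity hP hQ he hcorr hu hu₁ hw hγ]
  have h2 : (∫ x in Ω, pair (contrast D k x • fderiv ℝ (potV P Q) x) (G₁ x)) +
      (∫ x in Ω, pair (contrast D k x • Ge x) (G₁ x)) =
      ∫ x in Ω, contrast D k x * pair (fderiv ℝ (potV P Q) x + Ge x) (Gv x) := by
    rw [← integral_add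
      (integrable_bilin pair (hD.memLp_contrast_smul_fderiv_potV hP hQ) hu₁.memLp_deriv)
      (integrable_bilin pair (MemLp.contrast_smul hD he.memLp_deriv) hu₁.memLp_deriv)]
    refine integral_congr_ae ?_
    filter_upwards [hG] with x hx
    simp only [hx, pair_smul_left, map_add, add_apply]
    ring
  have h3 := fun j => hD.integral_pair_dipole hP hQ he h𝒟 hv hv2 hΔ j
  rw [← neg_add', h2, hD.integral_contrast_mul fun j => (h3 j).1, ← Finset.sum_neg_distrib]
  refine Finset.sum_congr rfl fun j _ => ?_
  rw [(h3 j).2.2, mul_neg, neg_neg]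

end Representation

/-! ### Complex-valued functions -/

section Complexify

variable {U : Set Plane}

/-- The conductivity is real, so the whole problem commutes with real-linear functionals and complex
data reduce to real ones. -/
lemma IsH1.comp_clm (hb : Bornology.IsBounded U) {u : Plane → ℂ} {G : Plane → Plane →L[ℝ] ℂ}
    (h : IsH1 U u G) (L : ℂ →L[ℝ] ℝ) : IsH1 U (fun x => L (u x)) (fun x => L.comp (G x)) where
  memLp := L.comp_memLp' h.memLp
  memLp_deriv := (ContinuousLinearMap.compL ℝ Plane ℂ ℝ L).comp_memLp' h.memLp_deriv
  weak_deriv φ hφ hc hs e := by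
    have := isFiniteMeasure_restrict hb
    have hφ' : Continuous fun x => fderiv ℝ φ x e :=
      (hφ.continuous_fderiv (by simp)).clm_apply continuous_const
    have hc' : HasCompactSupport fun x => fderiv ℝ φ x e := hc.fderiv_apply (𝕜 := ℝ) e
    have i1 := integrable_smul_of_memLp h.memLp hφ' hc'
    have i2 : Integrable (fun x => φ x • G x e) (volume.restrict U) :=
      (integrable_smul_of_memLp h.memLp_deriv hφ.continuous hc).apply_continuousLinearMap e
    have h1 := L.integral_comp_comm i1
    have h2 := L.integral_comp_comm i2
    simp only [map_smul] at h1 h2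
    simp only [ContinuousLinearMap.comp_apply]
    rw [h1, h2, h.weak_deriv φ hφ hc hs e, map_neg]

lemma integrable_apply_gradient (hb : Bornology.IsBounded U) {G : Plane → Plane →L[ℝ] ℂ}
    (hG : MemLp G 2 (volume.restrict U)) {φ : Plane → ℝ} (hφ : ContDiff ℝ 1 φ) :
    IntegrableOn (fun x => G x (gradient φ x)) U := by
  have := isFiniteMeasure_restrict hb
  have hg : Continuous (gradient φ) :=
    (InnerProductSpace.toDual ℝ Plane).symm.continuous.comp (hφ.continuous_fderiv one_ne_zero)
  obtain ⟨C, hC⟩ := hb.isCompact_closure.exists_bound_of_continuousOn hg.continuousOn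
  refine ((hG.integrable (by norm_num)).norm.mul_const C).mono' ?_ ?_
  · exact (ContinuousLinearMap.apply ℝ ℂ).aestronglyMeasurable_comp₂ hg.aestronglyMeasurable hG.1
  · filter_upwards [ae_mem_closure U] with x hx
    exact ((G x).le_opNorm _).trans (mul_le_mul_of_nonneg_left (hC x hx) (norm_nonneg _))

lemma clm_integral_apply_gradient (hb : Bornology.IsBounded U) {G : Plane → Plane →L[ℝ] ℂ}
    (hG : MemLp G 2 (volume.restrict U)) {φ : Plane → ℝ} (hφ : ContDiff ℝ (⊤ : ℕ∞) φ)
    (L : ℂ →L[ℝ] ℝ) :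
    L (∫ x in U, G x (gradient φ x)) = ∫ x in U, pair (L.comp (G x)) (fderiv ℝ φ x) :=
  (L.integral_comp_comm
    (integrable_apply_gradient hb hG (hφ.of_le (by exact_mod_cast le_top)))).symm

variable {m : ℕ} {Ω : Set Plane} {D : Fin m → Set Plane} {k : Fin m → ℝ} {P Q : Plane}
  {e 𝒟 : Plane → ℝ} {Ge : Plane → Plane →L[ℝ] ℝ}

/-- A real component of the representation of the Neumann-to-Dirichlet data. -/
lemma IsInclusion.component_representation (hD : IsInclusion Ω D) (hP : P ∈ frontier Ω)
    (hQ : Q ∈ frontier Ω) (he : IsH1 Ω e Ge)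
    (hcorr : ∀ φ : Plane → ℝ, ContDiff ℝ (⊤ : ℕ∞) φ →
      ∫ x in Ω, pair (conductivity D k x • Ge x) (fderiv ℝ φ x) =
        -(∫ x in Ω, pair (contrast D k x • fderiv ℝ (potV P Q) x) (fderiv ℝ φ x))
          - ∫ y, φ y * fluxPsi (outerNormal Ω) P Q y ∂(arcLength Ω))
    (h𝒟 : ∀ x ∈ Ω, 𝒟 x = potV P Q x + e x) {g : Plane → ℂ} {b c : ℂ}
    (hb : IsNDValue Ω (conductivity D k) P Q g b) (hc : IsNDValue Ω (fun _ => 1) P Q g c)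
    (L : ℂ →L[ℝ] ℝ) {v : Plane → ℝ} {Gv : Plane → Plane →L[ℝ] ℝ}
    (hv : IsH1 Ω v Gv) (hv2 : ∀ x ∈ Ω, ContDiffAt ℝ 2 v x)
    (hΔ : ∀ x ∈ Ω, Laplacian.laplacian v x = 0)
    (hg : ∀ φ : Plane → ℝ, ContDiff ℝ (⊤ : ℕ∞) φ →
      L (∫ y, φ y • g y ∂arcLength Ω) = ∫ x in Ω, pair (Gv x) (fderiv ℝ φ x)) :
    L (b - c) = ∑ j, (k j - 1) *
      ∫ y, boundaryTrace (D j) 𝒟 y * fderiv ℝ v y (normal Ω D y) ∂arcLength (D j) := by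
  obtain ⟨u, ⟨Gu, hu, hγ⟩, hcu, rfl⟩ := hb
  obtain ⟨u₁, ⟨G₁, hu₁, h₁⟩, hcu₁, rfl⟩ := hc
  have hbd := hD.isBounded_domain
  have e1 : ∀ φ : Plane → ℝ, ContDiff ℝ (⊤ : ℕ∞) φ → L (∫ y, φ y • g y ∂arcLength Ω) =
      ∫ x in Ω, pair (conductivity D k x • L.comp (Gu x)) (fderiv ℝ φ x) := fun φ hφ => by
    have h2 := clm_integral_apply_gradient hbd
      (MemLp.conductivity_smul (k := k) hD hu.memLp_deriv) hφ L
    simp only [smul_apply] at h2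
    rw [← hγ φ hφ, h2]
    simp only [ContinuousLinearMap.comp_smul]
  have e2 : ∀ φ : Plane → ℝ, ContDiff ℝ (⊤ : ℕ∞) φ → L (∫ y, φ y • g y ∂arcLength Ω) =
      ∫ x in Ω, pair (L.comp (G₁ x)) (fderiv ℝ φ x) := fun φ hφ => by
    have h2 := h₁ φ hφ
    simp only [one_smul] at h2
    rw [← h2, clm_integral_apply_gradient hbd hu₁.memLp_deriv hφ L]
  have hrep := hD.representation hP hQ he hcorr h𝒟 (hu.comp_clm hbd L) (hu₁.comp_clm hbd L)
    ((L.continuous.comp_continuousOn hcu).sub (L.continuous.comp_continuousOn hcu₁))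
    (fun φ hφ => (e1 φ hφ).symm.trans (e2 φ hφ)) hv hv2 hΔ
    (fun φ hφ => (e2 φ hφ).symm.trans (hg φ hφ))
  rw [← hrep]
  simp only [map_sub, Pi.sub_apply]
  ring

/-- Asking for the weak Neumann identity of `v` through each functional `L` covers both uses: an
abstract weak solution, and an explicit smooth harmonic function whose datum is its normal
derivative. -/
theorem IsInclusion.complex_representation (hD : IsInclusion Ω D) (hP : P ∈ frontier Ω)
    (hQ : Q ∈ frontier Ω) (h𝒟 : IsDipoleSolution Ω (conductivity D k) (normal Ω D) P Q 𝒟)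
    {g : Plane → ℂ} {b c : ℂ} (hb : IsNDValue Ω (conductivity D k) P Q g b)
    (hc : IsNDValue Ω (fun _ => 1) P Q g c) {v : Plane → ℂ}
    (hharm : InnerProductSpace.HarmonicOnNhd v Ω)
    (hv : ∀ L : ℂ →L[ℝ] ℝ, ∃ Gv, IsH1 Ω (fun x => L (v x)) Gv ∧
      ∀ φ : Plane → ℝ, ContDiff ℝ (⊤ : ℕ∞) φ →
        L (∫ y, φ y • g y ∂arcLength Ω) = ∫ x in Ω, pair (Gv x) (fderiv ℝ φ x)) :
    b - c = boundarySum Ω D k 𝒟 v := by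
  obtain ⟨e, ⟨⟨Ge, he, hcorr⟩, -⟩, h𝒟e⟩ := h𝒟
  have hcorr' : ∀ φ : Plane → ℝ, ContDiff ℝ (⊤ : ℕ∞) φ →
      ∫ x in Ω, pair (conductivity D k x • Ge x) (fderiv ℝ φ x) =
        -(∫ x in Ω, pair (contrast D k x • fderiv ℝ (potV P Q) x) (fderiv ℝ φ x))
          - ∫ y, φ y * fluxPsi (outerNormal Ω) P Q y ∂(arcLength Ω) := fun φ hφ => by
    have h1 := hcorr φ hφ
    have h2 : ∫ y, fluxPsi (normal Ω D) P Q y * φ y ∂arcLength Ω =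
        ∫ y, φ y * fluxPsi (outerNormal Ω) P Q y ∂arcLength Ω := by
      refine integral_congr_ae ?_
      filter_upwards [ae_mem_frontier Ω] with y hy
      simp only [fluxPsi, hD.normal_eq_outerNormal hy, mul_comm]
    rw [h2] at h1
    convert h1 using 3
    · rw [pair_smul_left]; rfl
    · refine integral_congr_ae (ae_of_all _ fun x => ?_)
      simp only [pair_smul_left, conductivity_eq, add_sub_cancel_left]
      rw [pair_eq_inner]
      rfl
  have hv2 : ∀ L : ℂ →L[ℝ] ℝ, ∀ x ∈ Ω, ContDiffAt ℝ 2 (fun x => L (v x)) x := fun L x hx =>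
    L.contDiff.contDiffAt.comp x (hharm x hx).1
  have hΔ : ∀ L : ℂ →L[ℝ] ℝ, ∀ x ∈ Ω, Laplacian.laplacian (fun x => L (v x)) x = 0 :=
    fun L x hx => by
      have h1 := (hharm x hx).1.laplacian_CLM_comp_left (l := L)
      have h2 : Laplacian.laplacian v x = 0 := (hharm x hx).2.self_of_nhds
      rw [Function.comp_def] at h1
      rw [h1, Function.comp_apply, h2, map_zero]
  have hfd : ∀ L : ℂ →L[ℝ] ℝ, ∀ j, ∀ y ∈ frontier (D j),
      fderiv ℝ (fun x => L (v x)) y (normal Ω D y) = L (normalDeriv (normal Ω D) v y) :=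
    fun L j y hy => by
      have hd : DifferentiableAt ℝ v y :=
        (hharm y (hD.closure_subset j (frontier_subset_closure hy))).1.differentiableAt two_ne_zero
      have := (L.hasFDerivAt.comp y hd.hasFDerivAt).fderiv
      rw [Function.comp_def] at this
      rw [this]
      rfl
  have hint : ∀ L : ℂ →L[ℝ] ℝ, ∀ j, Integrable
      (fun y => boundaryTrace (D j) 𝒟 y * L (normalDeriv (normal Ω D) v y)) (arcLength (D j)) :=
    fun L j => by
      obtain ⟨Gv, hGv, -⟩ := hv L
      refine (hD.integral_pair_dipole hP hQ he h𝒟e hGv (hv2 L) (hΔ L) j).2.1.congr ?_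
      filter_upwards [ae_mem_frontier (D j)] with y hy
      rw [hfd L j y hy]
  have hcomp : ∀ L : ℂ →L[ℝ] ℝ, L (b - c) = ∑ j, (k j - 1) *
      ∫ y, boundaryTrace (D j) 𝒟 y * L (normalDeriv (normal Ω D) v y) ∂arcLength (D j) :=
    fun L => by
      obtain ⟨Gv, hGv, hg⟩ := hv L
      rw [hD.component_representation hP hQ he hcorr' h𝒟e hb hc L hGv (hv2 L) (hΔ L) hg]
      refine Finset.sum_congr rfl fun j _ => ?_
      congr 1
      refine integral_congr_ae ?_
      filter_upwards [ae_mem_frontier (D j)] with y hy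
      rw [hfd L j y hy]
  -- Integrability of the complex integrand is assembled from its real and imaginary parts; without
  -- it `L` could not be moved through the integral.
  have hint' : ∀ j, Integrable (fun y => ((boundaryTrace (D j) 𝒟 y : ℝ) : ℂ) *
      normalDeriv (normal Ω D) v y) (arcLength (D j)) := fun j => by
    have h1 := (hint Complex.reCLM j).ofReal (𝕜 := ℂ)
    have h2 := ((hint Complex.imCLM j).ofReal (𝕜 := ℂ)).mul_const Complex.I
    refine (h1.add h2).congr (ae_of_all _ fun y => ?_)
    apply Complex.ext <;> simp
  have hsum : ∀ L : ℂ →L[ℝ] ℝ, L (boundarySum Ω D k 𝒟 v) = ∑ j, (k j - 1) *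
      ∫ y, boundaryTrace (D j) 𝒟 y * L (normalDeriv (normal Ω D) v y) ∂arcLength (D j) :=
    fun L => by
      rw [boundarySum, map_sum]
      refine Finset.sum_congr rfl fun j _ => ?_
      rw [← Complex.real_smul, map_smul, smul_eq_mul, ← L.integral_comp_comm (hint' j)]
      congr 1
      refine integral_congr_ae (ae_of_all _ fun y => ?_)
      simp only [← Complex.real_smul, map_smul, smul_eq_mul]
  apply Complex.ext
  · exact (hcomp Complex.reCLM).trans (hsum Complex.reCLM).symm
  · exact (hcomp Complex.imCLM).trans (hsum Complex.imCLM).symm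

end Complexify

/-! ### The exponential solutions -/

section ExpSol

/-- The complex linear form `x ↦ τ x · (ω + i ω')`. -/
def expForm (ω ω' : Plane) (τ : ℝ) : Plane →L[ℝ] ℂ :=
  τ • (Complex.ofRealCLM.comp (innerSL ℝ ω) + Complex.I • Complex.ofRealCLM.comp (innerSL ℝ ω'))

lemma expSol_eq (ω ω' : Plane) (τ : ℝ) :
    expSol ω ω' τ = fun x => Complex.exp (expForm ω ω' τ x) := by
  funext x
  simp [expSol, expForm, real_inner_comm, mul_add]

lemma hasFDerivAt_expSol (ω ω' : Plane) (τ : ℝ) (x : Plane) :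
    HasFDerivAt (expSol ω ω' τ) (expSol ω ω' τ x • expForm ω ω' τ) x := by
  rw [expSol_eq]
  exact (expForm ω ω' τ).hasFDerivAt.cexp

lemma contDiff_expSol (ω ω' : Plane) (τ : ℝ) : ContDiff ℝ (⊤ : ℕ∞) (expSol ω ω' τ) := by
  rw [expSol_eq]
  exact (expForm ω ω' τ).contDiff.cexp

/-- The complex vector ω + iω' is isotropic: its bilinear square is |ω|² - |ω'|² + 2i ω · ω' = 0.
This makes the exponential harmonic. -/
lemma sum_expForm_sq {ω ω' : Plane} (hω : ‖ω‖ = 1) (hω' : ‖ω'‖ = 1) (h : inner ℝ ω ω' = 0)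
    (τ : ℝ) : ∑ i, expForm ω ω' τ (stdBasis i) ^ 2 = 0 := by
  have h1 : ω 0 ^ 2 + ω 1 ^ 2 = 1 := by
    have := EuclideanSpace.real_norm_sq_eq ω
    rw [hω, Fin.sum_univ_two] at this
    linarith
  have h2 : ω' 0 ^ 2 + ω' 1 ^ 2 = 1 := by
    have := EuclideanSpace.real_norm_sq_eq ω'
    rw [hω', Fin.sum_univ_two] at this
    linarith
  have h3 : ω 0 * ω' 0 + ω 1 * ω' 1 = 0 := by
    simpa [PiLp.inner_apply, Fin.sum_univ_two, mul_comm] using h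
  simp only [Fin.sum_univ_two, expForm, stdBasis]
  apply Complex.ext
  · simp [pow_two, EuclideanSpace.inner_single_right]
    linear_combination τ ^ 2 * (h1 - h2)
  · simp [pow_two, EuclideanSpace.inner_single_right]
    linear_combination 2 * τ ^ 2 * h3

lemma laplacian_expSol {ω ω' : Plane} (hω : ‖ω‖ = 1) (hω' : ‖ω'‖ = 1) (h : inner ℝ ω ω' = 0)
    (τ : ℝ) (y : Plane) : Laplacian.laplacian (expSol ω ω' τ) y = 0 := by
  rw [InnerProductSpace.laplacian_eq_iteratedFDeriv_orthonormalBasis _ stdBasis]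
  simp only [iteratedFDeriv_two_apply]
  have h1 : fderiv ℝ (expSol ω ω' τ) = fun x => expSol ω ω' τ x • expForm ω ω' τ :=
    funext fun x => (hasFDerivAt_expSol ω ω' τ x).fderiv
  have h2 : fderiv ℝ (fderiv ℝ (expSol ω ω' τ)) y =
      (expSol ω ω' τ y • expForm ω ω' τ).smulRight (expForm ω ω' τ) := by
    have h3 : HasFDerivAt (fun x => expSol ω ω' τ x • expForm ω ω' τ)
        ((expSol ω ω' τ y • expForm ω ω' τ).smulRight (expForm ω ω' τ)) y :=
      (hasFDerivAt_expSol ω ω' τ y).smul_const (expForm ω ω' τ)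
    rw [h1, h3.fderiv]
  have h4 := sum_expForm_sq hω hω' h τ
  rw [h2]
  simp only [Fin.sum_univ_two] at h4
  simp
  linear_combination expSol ω ω' τ y * h4

/-- A smooth harmonic function solves the Neumann problem with datum its normal derivative. -/
lemma IsInclusion.clm_integral_normalDeriv {m : ℕ} {Ω : Set Plane} {D : Fin m → Set Plane}
    (hD : IsInclusion Ω D) {v : Plane → ℂ} (hv : ContDiff ℝ 2 v)
    (hΔ : ∀ x, Laplacian.laplacian v x = 0) (L : ℂ →L[ℝ] ℝ) {φ : Plane → ℝ}
    (hφ : ContDiff ℝ 1 φ) :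
    L (∫ y, φ y • normalDeriv (normal Ω D) v y ∂arcLength Ω) =
      ∫ x in Ω, pair (fderiv ℝ (fun x => L (v x)) x) (fderiv ℝ φ x) := by
  have hb := hD.isBounded_domain
  have hL := hD.smooth_domain.hasLipschitzBoundary
  have hfd : Continuous (fderiv ℝ v) := hv.continuous_fderiv two_ne_zero
  have h1 : ∫ y, φ y • normalDeriv (normal Ω D) v y ∂arcLength Ω =
      ∫ y, φ y • fderiv ℝ v y (outerNormal Ω y) ∂arcLength Ω := by
    refine integral_congr_ae ?_
    filter_upwards [ae_mem_frontier Ω] with y hy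
    rw [normalDeriv, hD.normal_eq_outerNormal hy]
  have hint : Integrable (fun y => φ y • fderiv ℝ v y (outerNormal Ω y)) (arcLength Ω) := by
    refine (integrable_arcLength_of_continuousOn hb hL (f := fun y => ‖φ y‖ * ‖fderiv ℝ v y‖)
      (hφ.continuous.norm.mul hfd.norm).continuousOn).mono' ?_ (ae_of_all _ fun y => ?_)
    · exact hφ.continuous.aestronglyMeasurable.smul
        ((ContinuousLinearMap.apply ℝ ℂ).aestronglyMeasurable_comp₂
          (aestronglyMeasurable_outerNormal hb hL) hfd.aestronglyMeasurable)
    · rw [norm_smul]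
      refine mul_le_mul_of_nonneg_left (((fderiv ℝ v y).le_opNorm _).trans ?_) (norm_nonneg _)
      exact mul_le_of_le_one_right (norm_nonneg _) (norm_outerNormal_le Ω y)
  have hLv : ContDiff ℝ 2 (fun x => L (v x)) := L.contDiff.comp hv
  have hgr := green hb hL hφ hLv
  have hLΔ : ∀ x, Laplacian.laplacian (fun x => L (v x)) x = 0 := fun x => by
    have h2 := hv.contDiffAt.laplacian_CLM_comp_left (l := L) (x := x)
    rw [Function.comp_def] at h2
    rw [h2, Function.comp_apply, hΔ, map_zero]
  simp only [hLΔ, mul_zero, integral_zero, add_zero] at hgr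
  rw [h1, hgr, ← L.integral_comp_comm hint]
  refine integral_congr_ae (ae_of_all _ fun y => ?_)
  have h3 := (L.hasFDerivAt.comp y (hv.differentiable two_ne_zero y).hasFDerivAt).fderiv
  rw [Function.comp_def] at h3
  simp only [h3, map_smul, smul_eq_mul, ContinuousLinearMap.comp_apply]

end ExpSol

end Inclusion

end

/-! ### Traces, indicator function and general currents -/

theorem proposition3p1 {m : ℕ} (Ω : Set Inclusion.Plane) (D : Fin m → Set Inclusion.Plane)
    (k : Fin m → ℝ) (hD : Inclusion.IsInclusion Ω D) (hk : ∀ j, 0 < k j)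
    (P Q : Inclusion.Plane) (hP : P ∈ frontier Ω) (hQ : Q ∈ frontier Ω) (hPQ : P ≠ Q)
    (𝒟 : Inclusion.Plane → ℝ)
    (h𝒟 : Inclusion.IsDipoleSolution Ω (Inclusion.conductivity D k) (Inclusion.normal Ω D) P Q 𝒟) :
    -- the traces of `𝒟` on the curves `∂D_j` exist
    (∀ j, Inclusion.IsTrace (D j) 𝒟 (Inclusion.boundaryTrace (D j) 𝒟)) ∧
    -- the representation of the indicator function
    (∀ ω ω' : Inclusion.Plane, ‖ω‖ = 1 → ‖ω'‖ = 1 → inner ℝ ω ω' = 0 →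
      ω 0 * ω' 1 - ω' 0 * ω 1 < 0 →
      ∀ τ : ℝ, 0 < τ → ∀ (t : ℝ) (a : ℂ),
        Inclusion.IsIndicatorValue Ω D k P Q ω ω' τ t a →
        a = Complex.exp (-(τ * t)) *
          Inclusion.boundarySum Ω D k 𝒟 (Inclusion.expSol ω ω' τ)) ∧
    -- the representation of `(Λ_γ(P, Q) - Λ_1(P, Q)) g` for an arbitrary current `g`
    (∀ g : Inclusion.Plane → ℂ, MeasureTheory.MemLp g ⊤ (Inclusion.arcLength Ω) →
      ∫ y, g y ∂(Inclusion.arcLength Ω) = 0 →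
      ∀ v : Inclusion.Plane → ℂ, InnerProductSpace.HarmonicOnNhd v Ω →
        Inclusion.IsNeumannSolution Ω (fun _ => 1) g v →
        ∀ b c : ℂ, Inclusion.IsNDValue Ω (Inclusion.conductivity D k) P Q g b →
          Inclusion.IsNDValue Ω (fun _ => 1) P Q g c →
          b - c = Inclusion.boundarySum Ω D k 𝒟 v) := by
  refine ⟨fun j => ?_, fun ω ω' hω hω' hωω' _ τ _ t a ha => ?_,
    fun g _ _ v hv hvN b c hb hc => ?_⟩
  · obtain ⟨e, ⟨⟨Ge, he, -⟩, -⟩, h𝒟e⟩ := h𝒟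
    exact hD.isTrace_dipole hP hQ he h𝒟e j
  · obtain ⟨b, c, hb, hc, rfl⟩ := ha
    have hΔ := Inclusion.laplacian_expSol hω hω' hωω' τ
    have h2 : ContDiff ℝ 2 (Inclusion.expSol ω ω' τ) :=
      (Inclusion.contDiff_expSol ω ω' τ).of_le (WithTop.coe_le_coe.2 (le_top : (2 : ℕ∞) ≤ ⊤))
    rw [hD.complex_representation hP hQ h𝒟 hb hc
      (fun x _ => ⟨h2.contDiffAt, Eventually.of_forall hΔ⟩) fun L => ?_]
    exact ⟨_, Inclusion.isH1_of_contDiff hD.isBounded_domain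
      (L.contDiff.comp (h2.of_le one_le_two)),
      fun φ hφ => hD.clm_integral_normalDeriv h2 hΔ L (hφ.of_le (by exact_mod_cast le_top))⟩
  · obtain ⟨G, hG, hGφ⟩ := hvN
    refine hD.complex_representation hP hQ h𝒟 hb hc hv fun L =>
      ⟨_, hG.comp_clm hD.isBounded_domain L, fun φ hφ => ?_⟩
    rw [← hGφ φ hφ, ← Inclusion.clm_integral_apply_gradient hD.isBounded_domain hG.memLp_deriv hφ L]
    simp only [one_smul]
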